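/- All graphs are finite and simple. Let $\mathcal G$ be the set of connected graphs whose adjacency matrix has, counting multiplicities, exactly one eigenvalue $r>1$, exactly one eigenvalue $s<-1$, and all other eigenvalues equal to $1$ or $-1$. Write $J$ for an all-ones matrix (of suitable size), $\mathbf 1$ and $\mathbf 0$ for the all-ones and all-zeros column vectors, $O$ for a zero matrix, $I_n$ for the identity matrix of order $n$, and $R_n$ for the reverse identity matrix of order $n$ (ones on the anti-diagonal, zeros elsewhere), so that $R_{2k}$ is the adjacency matrix of $kK_2$. In a spectrum, exponents denote multiplicities; thus $-1^{q}$ means the eigenvalue $-1$ with multiplicity $q$. **Theorem.** A graph $G$ belongs to $\mathcal G$ if and only if, for a suitable ordering of its vertices, its adjacency matrix is one of the following. Moreover, each of these matrices is the adjacency matrix of a simple graph, and it has the indicated spectrum. (i) $\begin{bmatrix} O & J-I_m\\ J-I_m & O\end{bmatrix}$ with $m\ge 3$ (that is, $K_{m,m}$ minus a perfect matching); spectrum $\{\pm(m-1),\,1^{m-1},\,-1^{m-1}\}$. (ii) $\begin{bmatrix} J-I_a & J\\ J & R_{2k}\end{bmatrix}$ with $a\ge 1$, $k\ge 2$ (that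 is, $K_a$ joined to $kK_2$; for $a=1$ this is the friendship graph consisting of $k$ triangles sharing a vertex); spectrum $\{\tfrac a2\pm\tfrac12\sqrt{a^2+8ak-4a+4},\,1^{k-1},\,-1^{a+k-1}\}$. (iii) $\begin{bmatrix} R_{2\ell} & J\\ J & R_{2m}\end{bmatrix}$ with $\ell\ge m\ge 2$ (that is, $\ell K_2$ joined to $mK_2$); spectrum $\{1\pm2\sqrt{\ell m},\,1^{\ell+m-2},\,-1^{\ell+m}\}$. (iv) $\begin{bmatrix} O & N\\ N^\top & O\end{bmatrix}$ with $N=\begin{bmatrix}1&\mathbf 1^\top\\ \mathbf 1& I_4\end{bmatrix}$ or $N=\begin{bmatrix}J-I_3&J\\ O&J-I_3\end{bmatrix}$; spectra $\{\pm3,\,1^4,\,-1^4\}$ and $\{\pm4,\,1^5,\,-1^5\}$, respectively. (v) $\begin{bmatrix} J-I_a&J&\mathbf 1\\ J&J-I_b&\mathbf 0\\ \mathbf 1^\top&\mathbf 0^\top&0\end{bmatrix}$ with $(a,b)=(6,5)$, $(4,6)$ or $(3,8)$; spectra $\{4\pm2\sqrt{10},\,1^1,\,-1^9\}$, $\{(7\pm\sqrt{129})/2,\,1^1,\,-1^8\}$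 and $\{4\pm\sqrt{37},\,1^1,\,-1^9\}$, respectively. (vi) $\begin{bmatrix} J-I_a&J&O\\ J&O&J-I_m\\ O&J-I_m&O\end{bmatrix}$ with $(a,m)=(3,5)$ or $(4,4)$; spectra $\{(1\pm\sqrt{129})/2,\,1^5,\,-1^6\}$ and $\{1\pm2\sqrt7,\,1^4,\,-1^6\}$, respectively. -/

import Mathlib

open Matrix

/-- The all-ones matrix `J` (of arbitrary shape). -/
def allOnes (α β : Type*) : Matrix α β ℝ := Matrix.of fun _ _ => 1

/-- The matrix `J - I_n`, i.e. the adjacency matrix of the complete graph on `n` vertices. -/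
def JsubI (n : ℕ) : Matrix (Fin n) (Fin n) ℝ := allOnes (Fin n) (Fin n) - 1

/-- The reverse identity matrix `R_n`. For even `n = 2k` it is the adjacency matrix of `kK_2`,
the disjoint union of `k` edges. -/
def revId (n : ℕ) : Matrix (Fin n) (Fin n) ℝ := Matrix.of fun i j => if i = Fin.rev j then 1 else 0

/-- The symmetric bipartite block matrix `[O N; Nᵀ O]`. -/
def bipartiteBlock {α β : Type*} (N : Matrix α β ℝ) : Matrix (α ⊕ β) (α ⊕ β) ℝ :=
  Matrix.fromBlocks 0 N Nᵀ 0

/-- A matrix partitioned into `3 × 3` blocks, given row by row. -/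
def blocks3 {α β γ : Type*}
    (A₁₁ : Matrix α α ℝ) (A₁₂ : Matrix α β ℝ) (A₁₃ : Matrix α γ ℝ)
    (A₂₁ : Matrix β α ℝ) (A₂₂ : Matrix β β ℝ) (A₂₃ : Matrix β γ ℝ)
    (A₃₁ : Matrix γ α ℝ) (A₃₂ : Matrix γ β ℝ) (A₃₃ : Matrix γ γ ℝ) :
    Matrix (α ⊕ β ⊕ γ) (α ⊕ β ⊕ γ) ℝ :=
  Matrix.fromBlocks A₁₁ (Matrix.fromCols A₁₂ A₁₃) (Matrix.fromRows A₂₁ A₃₁)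
    (Matrix.fromBlocks A₂₂ A₂₃ A₃₂ A₃₃)

/-- Type (i): `[O, J - I_m; J - I_m, O]`, that is, `K_{m,m}` minus a perfect matching. -/
def matI (m : ℕ) : Matrix (Fin m ⊕ Fin m) (Fin m ⊕ Fin m) ℝ :=
  Matrix.fromBlocks 0 (JsubI m) (JsubI m) 0

/-- Type (ii): `[J - I_a, J; J, R_{2k}]`, that is, `K_a` joined to `kK_2`. -/
def matII (a k : ℕ) : Matrix (Fin a ⊕ Fin (2 * k)) (Fin a ⊕ Fin (2 * k)) ℝ :=
  Matrix.fromBlocks (JsubI a) (allOnes _ _) (allOnes _ _) (revId (2 * k))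

/-- Type (iii): `[R_{2l}, J; J, R_{2m}]`, that is, `lK_2` joined to `mK_2`. -/
def matIII (l m : ℕ) : Matrix (Fin (2 * l) ⊕ Fin (2 * m)) (Fin (2 * l) ⊕ Fin (2 * m)) ℝ :=
  Matrix.fromBlocks (revId (2 * l)) (allOnes _ _) (allOnes _ _) (revId (2 * m))

/-- The first matrix `N` of type (iv): `[1, 𝟏ᵀ; 𝟏, I_4]`. -/
def matN₁ : Matrix (Unit ⊕ Fin 4) (Unit ⊕ Fin 4) ℝ :=
  Matrix.fromBlocks 1 (allOnes _ _) (allOnes _ _) 1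

/-- The second matrix `N` of type (iv): `[J - I_3, J; O, J - I_3]`. -/
def matN₂ : Matrix (Fin 3 ⊕ Fin 3) (Fin 3 ⊕ Fin 3) ℝ :=
  Matrix.fromBlocks (JsubI 3) (allOnes _ _) 0 (JsubI 3)

/-- Type (v): `[J - I_a, J, 𝟏; J, J - I_b, 𝟎; 𝟏ᵀ, 𝟎ᵀ, 0]`. -/
def matV (a b : ℕ) : Matrix (Fin a ⊕ Fin b ⊕ Unit) (Fin a ⊕ Fin b ⊕ Unit) ℝ :=
  blocks3
    (JsubI a)       (allOnes _ _) (allOnes _ _)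
    (allOnes _ _)   (JsubI b)     0
    (allOnes _ _)   0             0

/-- Type (vi): `[J - I_a, J, O; J, O, J - I_m; O, J - I_m, O]`. -/
def matVI (a m : ℕ) : Matrix (Fin a ⊕ Fin m ⊕ Fin m) (Fin a ⊕ Fin m ⊕ Fin m) ℝ :=
  blocks3
    (JsubI a)       (allOnes _ _) 0
    (allOnes _ _)   0             (JsubI m)
    0               (JsubI m)     0

/-- The multiset `{r, s, 1^p, (-1)^q}` (exponents denote multiplicities). -/
def specMultiset (r s : ℝ) (p q : ℕ) : Multiset ℝ :=
  {r, s} + Multiset.replicate p 1 + Multiset.replicate q (-1)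

/-- The spectrum of a (real symmetric) matrix: its eigenvalues with multiplicities. -/
noncomputable def matSpectrum {α : Type*} [Fintype α] [DecidableEq α] (M : Matrix α α ℝ) :
    Multiset ℝ :=
  M.charpoly.roots

/-- The class `𝒢`: connected graphs whose adjacency matrix has (with multiplicities counted)
one eigenvalue `r > 1`, one eigenvalue `s < -1`, and all other eigenvalues equal to `±1`. -/
def InClassG {V : Type*} [Fintype V] [DecidableEq V] (G : SimpleGraph V) [DecidableRel G.Adj] :
    Prop :=
  G.Connected ∧ ∃ (r s : ℝ) (p q : ℕ), 1 < r ∧ s < -1 ∧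
    matSpectrum (G.adjMatrix ℝ) = specMultiset r s p q

/-- `M` is the adjacency matrix of `G` with respect to some ordering of the vertices. -/
def HasAdjMatrix {V α : Type*} (G : SimpleGraph V) [DecidableRel G.Adj] (M : Matrix α α ℝ) :
    Prop :=
  ∃ e : V ≃ α, Matrix.reindex e e (G.adjMatrix ℝ) = M

/-- `M` is the adjacency matrix of a simple graph (symmetric, `0`-`1`, zero diagonal), and its
spectrum is `S`. -/
def IsGraphMatrixWithSpectrum {α : Type*} [Fintype α] [DecidableEq α] (M : Matrix α α ℝ)
    (S : Multiset ℝ) : Prop :=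
  M.IsAdjMatrix ∧ matSpectrum M = S

/-!
Let `A` be the adjacency matrix of a connected graph with one eigenvalue `r > 1`, one eigenvalue
`s < -1` and all others `±1`. Then `A² - 1` vanishes on the eigenspaces of `±1`, so it is positive
semidefinite of rank two: `A² - 1 = P Pᵀ + Q Qᵀ` with `P`, `Q` multiples of the eigenvectors of `r`
and `s` (`exists_gram_of_roots`). Attach to each vertex `i` the plane vector `v i = (P i, Q i)`.
Then `⟪v i, v j⟫` is the number of common neighbours of `i ≠ j`, and `‖v i‖² = deg i - 1`
(`PlanarRep`). Everything is deduced from these vectors.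

Any three plane vectors satisfy a linear relation, and the same combination of the rows of `A` has
squared length `x² + y² + z²`, where `x, y, z` are the coefficients (`sum_sq_relation`). This is a
strong restriction: a triangle contains two vertices with the same vector (`same_of_triangle`), and
the neighbours of `j` with other vectors lie on one side of the line through `v j`. Since the cross
products `v j × v u`, for `u ~ j`, sum to `(s - r) P j Q j`, that side is determined by the sign of
`P j Q j`. So this sign splits the vertices into two sides such that the ends of an edge have the
same vector if and only if they are on the same side (`side_mul_side_neg`, `same_of_adj`). For `i`,
`j` on opposite sides, `⟪v i, v j⟫` is `0` if they are not adjacent and `e i + e j` if they are,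
where `e i` is the number of neighbours of `i` with the vector of `i` (`gram_of_not_adj`,
`gram_of_adj`).

If no two vertices on opposite sides have orthogonal vectors, the graph is the join of its sides,
and it is of type `matII`, `matIII` or `matV` (`join_cases`). Otherwise an orthogonal pair `v l`,
`v c` provides coordinate axes. If all vectors lie on the axes, the graph is bipartite; the vectors in
each colour class are parallel, and distinct parallel vectors force the degrees `2` and `5`
(`of_parallel`), which leads to `matI` and the matrices made from `matN₁`, `matN₂` (`bip_cases`). If
some vector lies off the axes, the structure is that of `matVI` (`interior_cases`). In all cases,
vertices with the same vector have neighbourhoods that differ by a swap (`exists_sdiff_of_same`), so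
a class is a clique or a matching or has no edges, and a block between two classes is determined by
`coMatching_of_swap`; the sizes come from small Diophantine equations.

For the spectra, each listed `M` has an equitable partition on whose blocks `M² - 1` is constant. A
computation with the small quotient matrices shows that `M` is annihilated by
`(x² - 1)(x - r)(x - s)`, and the traces of `M`, `M² - 1` and `M (M² - 1)` determine the multiplicities
(`matSpectrum_eq_of_trace`, `matSpectrum_eq_of_quotient`).
-/

/-! ### Planar Gram representation -/

/-- If all eigenvalues of `M` other than one `r > 1` and one `s < -1` are `±1`, then `M² - 1` is a
positive semidefinite matrix of rank two: it is `x xᵀ + y yᵀ` for the unit eigenvectors of `r` and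
`s` scaled by `√(r² - 1)` and `√(s² - 1)`. The last clause records that `x` and `y` are not
proportional. -/
theorem exists_gram_of_roots {V : Type*} [Fintype V] [DecidableEq V] {M : Matrix V V ℝ}
    (hM : M.IsHermitian) {r s : ℝ} {p q : ℕ}
    (hr : 1 < r) (hs : s < -1) (h : M.charpoly.roots = specMultiset r s p q) :
    ∃ x y : V → ℝ, M *ᵥ x = r • x ∧ M *ᵥ y = s • y ∧
      (∀ i j, (M * M) i j = x i * x j + y i * y j + if i = j then 1 else 0) ∧
      ∃ i j, x i * y j - x j * y i ≠ 0 := by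
  have hroots := hM.roots_charpoly_eq_eigenvalues
  rw [h] at hroots
  obtain ⟨k₀, k₁, hne, h0, h1, hrest⟩ : ∃ k₀ k₁, k₀ ≠ k₁ ∧ hM.eigenvalues k₀ = r ∧
      hM.eigenvalues k₁ = s ∧ ∀ k, k ≠ k₀ → k ≠ k₁ → hM.eigenvalues k ^ 2 = 1 := by
    have e1 : specMultiset r s p q
        = r ::ₘ s ::ₘ (Multiset.replicate p 1 + Multiset.replicate q (-1)) := by
      simp [specMultiset]
    have hm : Multiset.map (fun i => hM.eigenvalues i) Finset.univ.val
        = r ::ₘ s ::ₘ (Multiset.replicate p 1 + Multiset.replicate q (-1)) := by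
      rw [← e1, hroots]; rfl
    have hr' : r ∈ Multiset.map (fun i => hM.eigenvalues i) Finset.univ.val := by simp [hm]
    obtain ⟨k₀, -, h0⟩ := Multiset.mem_map.1 hr'
    have hu : (Finset.univ : Finset V).val = k₀ ::ₘ (Finset.univ.erase k₀).val := by
      rw [Finset.erase_val, Multiset.cons_erase (Finset.mem_univ k₀)]
    rw [hu, Multiset.map_cons, h0, Multiset.cons_inj_right] at hm
    have hs' : s ∈ Multiset.map (fun i => hM.eigenvalues i) (Finset.univ.erase k₀).val := by
      rw [hm]; simp
    obtain ⟨k₁, hk₁, h1⟩ := Multiset.mem_map.1 hs'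
    have hk₁' : k₁ ∈ Finset.univ.erase k₀ := hk₁
    have hu' : (Finset.univ.erase k₀).val = k₁ ::ₘ ((Finset.univ.erase k₀).erase k₁).val := by
      rw [Finset.erase_val (Finset.univ.erase k₀), Multiset.cons_erase hk₁]
    rw [hu', Multiset.map_cons, h1, Multiset.cons_inj_right] at hm
    refine ⟨k₀, k₁, (Finset.ne_of_mem_erase hk₁').symm, h0, h1, fun k hk hk' => ?_⟩
    have : hM.eigenvalues k ∈ Multiset.map (fun i => hM.eigenvalues i)
        ((Finset.univ.erase k₀).erase k₁).val :=
      Multiset.mem_map_of_mem _ (by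
        show k ∈ (Finset.univ.erase k₀).erase k₁
        simp [hk, hk'])
    rw [hm] at this
    simp only [Multiset.mem_add, Multiset.mem_replicate] at this
    rcases this with h | h <;> rw [h.2] <;> norm_num
  let U : Matrix V V ℝ := hM.eigenvectorUnitary
  have hcol : ∀ k, (fun i => U i k) = ⇑(hM.eigenvectorBasis k) := by
    intro k; ext i; exact hM.eigenvectorUnitary_apply i k
  have hUU : U * Uᵀ = 1 := by
    have := Unitary.mul_star_self_of_mem hM.eigenvectorUnitary.2
    simpa [star_eq_conjTranspose, U] using this
  have hUU' : Uᵀ * U = 1 := mul_eq_one_comm.1 hUU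
  have hMU : M * U = U * diagonal hM.eigenvalues := by
    ext i k
    have := congrFun (hM.mulVec_eigenvectorBasis k) i
    rw [← hcol] at this
    rw [mul_diagonal, mul_apply]
    simpa [mulVec, dotProduct, mul_comm] using this
  have hMM : M * M - 1 = U * (diagonal fun k => hM.eigenvalues k ^ 2 - 1) * Uᵀ := by
    have e : (M * M - 1) * U = U * (diagonal fun k => hM.eigenvalues k ^ 2 - 1) := by
      rw [Matrix.sub_mul, Matrix.mul_assoc, hMU, ← Matrix.mul_assoc, hMU, Matrix.mul_assoc,
        diagonal_mul_diagonal, Matrix.one_mul]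
      nth_rewrite 2 [← Matrix.mul_one U]
      rw [← Matrix.mul_sub, ← diagonal_one, diagonal_sub]
      simp only [pow_two]
    rw [← e, Matrix.mul_assoc, hUU, Matrix.mul_one]
  have hev : ∀ k, M *ᵥ (fun i => U i k) = hM.eigenvalues k • (fun i => U i k) := by
    intro k; rw [hcol]; exact hM.mulVec_eigenvectorBasis k
  have hnz : ∀ k, ∃ i, U i k ≠ 0 := by
    intro k
    by_contra! hc
    have := congrFun (congrFun hUU' k) k
    simp [mul_apply, hc] at this
  have hr2 : 0 ≤ r ^ 2 - 1 := by nlinarith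
  have hs2 : 0 ≤ s ^ 2 - 1 := by nlinarith
  have hr3 : √(r ^ 2 - 1) ≠ 0 := (Real.sqrt_pos.2 (by nlinarith)).ne'
  have hs3 : √(s ^ 2 - 1) ≠ 0 := (Real.sqrt_pos.2 (by nlinarith)).ne'
  refine ⟨√(r ^ 2 - 1) • fun i => U i k₀, √(s ^ 2 - 1) • fun i => U i k₁, ?_, ?_, ?_, ?_⟩
  · rw [mulVec_smul, hev, h0, smul_comm]
  · rw [mulVec_smul, hev, h1, smul_comm]
  · intro i j
    have e := congrFun (congrFun hMM i) j
    rw [Matrix.sub_apply, one_apply, sub_eq_iff_eq_add] at e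
    rw [e, mul_apply]
    congr 1
    simp only [mul_diagonal, transpose_apply, Pi.smul_apply, smul_eq_mul]
    rw [Finset.sum_eq_add k₀ k₁ hne (fun k _ hk => by rw [hrest k hk.1 hk.2]; ring)
      (by simp) (by simp), h0, h1]
    have e1 := Real.mul_self_sqrt hr2
    have e2 := Real.mul_self_sqrt hs2
    linear_combination (-U i k₀ * U j k₀) * e1 + (-U i k₁ * U j k₁) * e2
  · by_contra! hc
    obtain ⟨j, hj⟩ := hnz k₁
    obtain ⟨i, hi⟩ := hnz k₀
    have hpar : ∀ a b, U a k₀ * U b k₁ = U b k₀ * U a k₁ := by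
      intro a b
      have := hc a b
      simp only [Pi.smul_apply, smul_eq_mul] at this
      have h' : (√(r ^ 2 - 1) * √(s ^ 2 - 1)) * (U a k₀ * U b k₁ - U b k₀ * U a k₁) = 0 := by
        linear_combination this
      rcases mul_eq_zero.1 h' with h' | h'
      · exact absurd h' (mul_ne_zero hr3 hs3)
      · linarith
    have e0 := congrFun (hev k₀) i
    have e1 := congrFun (hev k₁) i
    simp only [mulVec, dotProduct, h0, h1, Pi.smul_apply, smul_eq_mul] at e0 e1
    have e2 : (∑ x, M i x * U x k₀) * U j k₁ = (∑ x, M i x * U x k₁) * U j k₀ := by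
      rw [Finset.sum_mul, Finset.sum_mul]
      exact Finset.sum_congr rfl fun x _ => by linear_combination (M i x) * hpar x j
    rw [e0, e1] at e2
    have := hpar i j
    have h5 : (r - s) * (U i k₀ * U j k₁) = 0 := by linear_combination e2 - s * this
    exact mul_ne_zero (by linarith) (mul_ne_zero hi hj) h5

/-- A planar Gram representation of a connected graph: vectors `v i = (P i, Q i)` with `⟪v i, v j⟫`
the number of common neighbours of `i ≠ j` and `‖v i‖² = deg i - 1`, whose coordinate functions `P`
and `Q` are eigenvectors of the adjacency matrix for `r > s`. The field `nd` says that the vectors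
span the plane. Inner products and the cross products `P i * Q j - P j * Q i` are written out in
coordinates throughout. -/
structure PlanarRep {V : Type*} [Fintype V] [DecidableEq V] (G : SimpleGraph V)
    [DecidableRel G.Adj] (P Q : V → ℝ) (r s : ℝ) : Prop where
  conn : G.Connected
  deg : ∀ i, (G.degree i : ℝ) = P i * P i + Q i * Q i + 1
  codeg : ∀ i j, i ≠ j →
    ((G.neighborFinset i ∩ G.neighborFinset j).card : ℝ) = P i * P j + Q i * Q j
  eigP : ∀ i, ∑ m ∈ G.neighborFinset i, P m = r * P i
  eigQ : ∀ i, ∑ m ∈ G.neighborFinset i, Q m = s * Q i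
  lt : s < r
  nd : ∃ i j, P i * Q j - P j * Q i ≠ 0

section
variable {V : Type*} [Fintype V] [DecidableEq V] {G : SimpleGraph V} [DecidableRel G.Adj]

theorem InClassG.exists_planarRep (h : InClassG G) : ∃ P Q r s, PlanarRep G P Q r s := by
  obtain ⟨hc, r, s, p, q, hr, hs, hspec⟩ := h
  have hM : (G.adjMatrix ℝ).IsHermitian := by
    rw [IsHermitian, conjTranspose_eq_transpose_of_trivial, G.transpose_adjMatrix]
  obtain ⟨P, Q, hP, hQ, hg, hnd⟩ := exists_gram_of_roots hM hr hs hspec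
  refine ⟨P, Q, r, s, hc, fun i => ?_, fun i j hij => ?_, fun i => ?_, fun i => ?_,
    by linarith, hnd⟩
  · rw [← G.adjMatrix_mul_self_apply_self, hg]; simp
  · have := hg i j
    rw [if_neg hij, add_zero] at this
    rw [← this, SimpleGraph.adjMatrix_mul_apply]
    simp only [SimpleGraph.adjMatrix_apply, Finset.sum_boole]
    congr 2
    ext x
    simp [G.adj_comm j x]
  · have := congrFun hP i
    rwa [SimpleGraph.adjMatrix_mulVec_apply] at this
  · have := congrFun hQ i
    rwa [SimpleGraph.adjMatrix_mulVec_apply] at this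

namespace PlanarRep
variable {P Q : V → ℝ} {r s : ℝ}

/-- Reflection in the first axis, which exchanges the signs of the products `P i * Q i`. -/
theorem neg (h : PlanarRep G P Q r s) : PlanarRep G P (fun i => -Q i) r s where
  conn := h.conn
  deg i := by rw [h.deg]; ring
  codeg i j hij := by rw [h.codeg i j hij]; ring
  eigP := h.eigP
  eigQ i := by rw [Finset.sum_neg_distrib, h.eigQ]; ring
  lt := h.lt
  nd := by
    obtain ⟨i, j, hij⟩ := h.nd
    exact ⟨i, j, fun e => hij (by linear_combination -e)⟩

theorem sum_adj_mul (h : PlanarRep G P Q r s) (i j : V) :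
    ∑ m, G.adjMatrix ℝ i m * G.adjMatrix ℝ j m
      = P i * P j + Q i * Q j + if i = j then 1 else 0 := by
  have : ∑ m, G.adjMatrix ℝ i m * G.adjMatrix ℝ j m
      = ((G.neighborFinset i ∩ G.neighborFinset j).card : ℝ) := by
    simp only [SimpleGraph.adjMatrix_apply, mul_ite, mul_one, mul_zero, ← ite_and,
      Finset.sum_boole]
    congr 2
    ext x
    simp [and_comm]
  rw [this]
  split_ifs with e
  · subst e
    rw [Finset.inter_self, SimpleGraph.card_neighborFinset_eq_degree, h.deg]
  · rw [h.codeg i j e, add_zero]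

/-- A linear relation between three of the vectors, applied to the corresponding rows of the
adjacency matrix `A`: since `A² = 1 + (Gram matrix)`, only the identity contributes to the squared
length of the combination. -/
theorem sum_sq_relation (h : PlanarRep G P Q r s) {i j k : V} (hij : i ≠ j) (hik : i ≠ k)
    (hjk : j ≠ k) {x y z : ℝ} (hP : x * P i + y * P j + z * P k = 0)
    (hQ : x * Q i + y * Q j + z * Q k = 0) :
    ∑ m, (x * G.adjMatrix ℝ i m + y * G.adjMatrix ℝ j m + z * G.adjMatrix ℝ k m) ^ 2
      = x ^ 2 + y ^ 2 + z ^ 2 := by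
  have e : ∀ m, (x * G.adjMatrix ℝ i m + y * G.adjMatrix ℝ j m + z * G.adjMatrix ℝ k m) ^ 2
      = x ^ 2 * (G.adjMatrix ℝ i m * G.adjMatrix ℝ i m)
        + y ^ 2 * (G.adjMatrix ℝ j m * G.adjMatrix ℝ j m)
        + z ^ 2 * (G.adjMatrix ℝ k m * G.adjMatrix ℝ k m)
        + 2 * x * y * (G.adjMatrix ℝ i m * G.adjMatrix ℝ j m)
        + 2 * x * z * (G.adjMatrix ℝ i m * G.adjMatrix ℝ k m)
        + 2 * y * z * (G.adjMatrix ℝ j m * G.adjMatrix ℝ k m) := fun m => by ring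
  simp only [e, Finset.sum_add_distrib, ← Finset.mul_sum, h.sum_adj_mul, if_neg hij,
    if_neg hik, if_neg hjk, if_true]
  linear_combination (x * P i + y * P j + z * P k) * hP + (x * Q i + y * Q j + z * Q k) * hQ

theorem sum_sq_le (h : PlanarRep G P Q r s) {i j k : V} (hij : i ≠ j) (hik : i ≠ k)
    (hjk : j ≠ k) {x y z : ℝ} (hP : x * P i + y * P j + z * P k = 0)
    (hQ : x * Q i + y * Q j + z * Q k = 0) (T : Finset V) :
    ∑ m ∈ T, (x * G.adjMatrix ℝ i m + y * G.adjMatrix ℝ j m + z * G.adjMatrix ℝ k m) ^ 2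
      ≤ x ^ 2 + y ^ 2 + z ^ 2 := by
  rw [← h.sum_sq_relation hij hik hjk hP hQ]
  exact Finset.sum_le_univ_sum_of_nonneg fun m => sq_nonneg _

/-- By connectedness, a set containing a vertex and closed under adjacency is everything. -/
theorem eq_univ_of_closed (h : PlanarRep G P Q r s) {S : Finset V} {i : V} (hi : i ∈ S)
    (hS : ∀ x ∈ S, ∀ y, G.Adj x y → y ∈ S) (y : V) : y ∈ S := by
  obtain ⟨w⟩ := h.conn.preconnected i y
  induction w with
  | nil => exact hi
  | cons hadj _ ih => exact ih (hS _ hi _ hadj)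

theorem exists_adj (h : PlanarRep G P Q r s) (i : V) : ∃ j, G.Adj i j := by
  by_contra! hc
  have hall := h.eq_univ_of_closed (S := {i}) (Finset.mem_singleton_self i)
    (fun x hx y hxy => by
      rw [Finset.mem_singleton] at hx; subst hx; exact absurd hxy (hc y))
  obtain ⟨a, b, hab⟩ := h.nd
  have ha := Finset.mem_singleton.1 (hall a)
  have hb := Finset.mem_singleton.1 (hall b)
  subst ha; subst hb
  exact hab (by ring)

/-- An end vertex `i` would have the zero vector, hence no common neighbour with any other vertex;
then `i` and its neighbour form a component, and their vectors do not span the plane. -/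
theorem two_le_degree (h : PlanarRep G P Q r s) (i : V) : 2 ≤ G.degree i := by
  obtain ⟨u, hu⟩ := h.exists_adj i
  have h1 : 0 < G.degree i := (G.degree_pos_iff_exists_adj i).2 ⟨u, hu⟩
  by_contra hlt
  have h1 : G.degree i = 1 := by omega
  have hz := h.deg i
  rw [h1] at hz
  push_cast at hz
  have hPi : P i = 0 := by nlinarith [mul_self_nonneg (P i), mul_self_nonneg (Q i)]
  have hQi : Q i = 0 := by nlinarith [mul_self_nonneg (P i), mul_self_nonneg (Q i)]
  have hall := h.eq_univ_of_closed (S := {i, u}) (i := i) (by simp) (by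
    intro x hx y hxy
    rw [Finset.mem_insert, Finset.mem_singleton] at hx ⊢
    rcases hx with rfl | rfl
    · right
      rw [← SimpleGraph.card_neighborFinset_eq_degree, Finset.card_eq_one] at h1
      obtain ⟨c, hc⟩ := h1
      have a1 : u ∈ G.neighborFinset x := by simpa using hu
      have a2 : y ∈ G.neighborFinset x := by simpa using hxy
      rw [hc, Finset.mem_singleton] at a1 a2
      rw [a1, a2]
    · left
      by_contra hne
      have := h.codeg i y (Ne.symm hne)
      rw [hPi, hQi, zero_mul, zero_mul, add_zero, Nat.cast_eq_zero, Finset.card_eq_zero] at this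
      have hm : x ∈ G.neighborFinset i ∩ G.neighborFinset y := by
        simp [hu, hxy.symm]
      rw [this] at hm
      simp at hm)
  obtain ⟨a, b, hab⟩ := h.nd
  have ha := hall a
  have hb := hall b
  rw [Finset.mem_insert, Finset.mem_singleton] at ha hb
  rcases ha with rfl | rfl <;> rcases hb with rfl | rfl <;> exact hab (by simp [hPi, hQi, mul_comm])

end PlanarRep
end

/-! ### Parallel vectors, triangles and the two sides -/

/-- The vertices `i` and `j` have the same vector `(P i, Q i) = (P j, Q j)`. -/
def SameVec {V : Type*} (P Q : V → ℝ) (i j : V) : Prop := P i = P j ∧ Q i = Q j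

namespace SameVec
variable {V : Type*} {P Q : V → ℝ} {i j k : V}
theorem refl (i : V) : SameVec P Q i i := ⟨rfl, rfl⟩
theorem symm (h : SameVec P Q i j) : SameVec P Q j i := ⟨h.1.symm, h.2.symm⟩
theorem trans (h : SameVec P Q i j) (h' : SameVec P Q j k) : SameVec P Q i k :=
  ⟨h.1.trans h'.1, h.2.trans h'.2⟩
theorem neg_iff : SameVec P (fun i => -Q i) i j ↔ SameVec P Q i j := by
  simp [SameVec]
/-- Two vectors at distance zero are equal. -/
theorem of_dist (h : (P i * P i + Q i * Q i) + (P j * P j + Q j * Q j)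
    = 2 * (P i * P j + Q i * Q j)) : SameVec P Q i j := by
  have h1 : (P i - P j) ^ 2 + (Q i - Q j) ^ 2 = 0 := by linear_combination h
  constructor <;> nlinarith [sq_nonneg (P i - P j), sq_nonneg (Q i - Q j)]
end SameVec

section
variable {V : Type*} [Fintype V] [DecidableEq V] {G : SimpleGraph V} [DecidableRel G.Adj]
namespace PlanarRep
variable {P Q : V → ℝ} {r s : ℝ}

theorem card_inter_add_card_sdiff (i j : V) :
    (G.neighborFinset i ∩ G.neighborFinset j).card
      + (G.neighborFinset i \ G.neighborFinset j).card = G.degree i := by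
  rw [Finset.card_inter_add_card_sdiff, SimpleGraph.card_neighborFinset_eq_degree]

/-- Equal neighbourhoods would give `‖v i - v j‖² = -2`. -/
theorem neighborFinset_ne (h : PlanarRep G P Q r s) {i j : V} (hij : i ≠ j) :
    G.neighborFinset i ≠ G.neighborFinset j := by
  intro e
  have h1 := h.codeg i j hij
  have h2 := h.codeg i j hij
  rw [← e, Finset.inter_self, SimpleGraph.card_neighborFinset_eq_degree, h.deg] at h1
  rw [e, Finset.inter_self, SimpleGraph.card_neighborFinset_eq_degree, h.deg] at h2
  nlinarith [sq_nonneg (P i - P j), sq_nonneg (Q i - Q j)]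

/-- Adjacent vertices with the same vector have the same closed neighbourhood. -/
theorem adj_of_same_of_adj (h : PlanarRep G P Q r s) {i j x : V} (hs : SameVec P Q i j)
    (hij : G.Adj i j) (hx : x ≠ j) (hix : G.Adj i x) : G.Adj j x := by
  have h1 := h.codeg i j hij.ne
  have h2 := h.deg i
  rw [← hs.1, ← hs.2] at h1
  have h3 : (G.neighborFinset i ∩ G.neighborFinset j).card + 1 = G.degree i := by
    have : ((G.neighborFinset i ∩ G.neighborFinset j).card : ℝ) + 1 = G.degree i := by
      rw [h1, h2]
    exact_mod_cast this
  have h4 := card_inter_add_card_sdiff (G := G) i j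
  have h5 : (G.neighborFinset i \ G.neighborFinset j).card = 1 := by omega
  obtain ⟨c, hc⟩ := Finset.card_eq_one.1 h5
  by_contra hn
  have a1 : x ∈ G.neighborFinset i \ G.neighborFinset j := by simp [hix, hn]
  have a2 : j ∈ G.neighborFinset i \ G.neighborFinset j := by simp [hij]
  rw [hc, Finset.mem_singleton] at a1 a2
  exact hx (a1.trans a2.symm)

/-- The neighbourhoods of two distinct vertices with the same vector differ by a swap: each has
exactly one vertex (possibly the other one of the two) that is not in the other neighbourhood. By
the eigenvector equations the two swapped vertices have the same vector as well. -/
theorem exists_sdiff_of_same (h : PlanarRep G P Q r s) {i j : V} (hs : SameVec P Q i j)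
    (hne : i ≠ j) :
    ∃ x y, G.neighborFinset i \ G.neighborFinset j = {x} ∧
      G.neighborFinset j \ G.neighborFinset i = {y} ∧ SameVec P Q x y := by
  have h1 := h.codeg i j hne
  have h2 := h.deg i
  have h2' := h.deg j
  have h3 : (G.neighborFinset i ∩ G.neighborFinset j).card + 1 = G.degree i := by
    have : ((G.neighborFinset i ∩ G.neighborFinset j).card : ℝ) + 1 = G.degree i := by
      rw [h1, h2, hs.1, hs.2]
    exact_mod_cast this
  have h3' : (G.neighborFinset i ∩ G.neighborFinset j).card + 1 = G.degree j := by
    have : ((G.neighborFinset i ∩ G.neighborFinset j).card : ℝ) + 1 = G.degree j := by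
      rw [h1, h2', hs.1, hs.2]
    exact_mod_cast this
  have h4 := card_inter_add_card_sdiff (G := G) i j
  have h4' := card_inter_add_card_sdiff (G := G) j i
  rw [Finset.inter_comm] at h4'
  obtain ⟨x, hx⟩ := Finset.card_eq_one.1
    (show (G.neighborFinset i \ G.neighborFinset j).card = 1 by omega)
  obtain ⟨y, hy⟩ := Finset.card_eq_one.1
    (show (G.neighborFinset j \ G.neighborFinset i).card = 1 by omega)
  refine ⟨x, y, hx, hy, ?_⟩
  have key : ∀ f : V → ℝ, (∑ m ∈ G.neighborFinset i, f m = ∑ m ∈ G.neighborFinset j, f m) →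
      f x = f y := by
    intro f hf
    rw [← Finset.sum_inter_add_sum_sdiff (G.neighborFinset i) (G.neighborFinset j) f,
      ← Finset.sum_inter_add_sum_sdiff (G.neighborFinset j) (G.neighborFinset i) f, hx, hy,
      Finset.sum_singleton, Finset.sum_singleton, Finset.inter_comm] at hf
    linarith
  exact ⟨key P (by rw [h.eigP, h.eigP, hs.1]), key Q (by rw [h.eigQ, h.eigQ, hs.2])⟩

theorem codeg_le_degree (i j : V) :
    (G.neighborFinset i ∩ G.neighborFinset j).card ≤ G.degree i := by
  have := card_inter_add_card_sdiff (G := G) i j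
  omega

theorem codeg_lt_degree {i j : V} (hij : G.Adj i j) :
    (G.neighborFinset i ∩ G.neighborFinset j).card < G.degree i := by
  have := card_inter_add_card_sdiff (G := G) i j
  have h : 0 < (G.neighborFinset i \ G.neighborFinset j).card :=
    Finset.card_pos.2 ⟨j, by simp [hij]⟩
  omega

/-- Distinct parallel vectors occur only for degrees `2` and `5`: with `c` common neighbours,
`c² = (deg i - 1)(deg j - 1)` and `c ≤ deg i`, which leaves `c = deg i = 2`, `deg j = 5`. -/
theorem of_parallel (h : PlanarRep G P Q r s) {i j : V} (hc : P i * Q j - P j * Q i = 0)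
    (hs : ¬ SameVec P Q i j) (hd : G.degree i ≤ G.degree j) :
    G.degree i = 2 ∧ G.degree j = 5 ∧ ¬ G.Adj i j ∧
      G.neighborFinset i ⊆ G.neighborFinset j := by
  have hne : i ≠ j := fun e => hs (e ▸ SameVec.refl i)
  have h1 := h.codeg i j hne
  have h2 := h.deg i
  have h3 := h.deg j
  have d1 := h.two_le_degree i
  have hle := codeg_le_degree (G := G) i j
  obtain ⟨a, ha⟩ : ∃ a, G.degree i = a + 1 := ⟨G.degree i - 1, by omega⟩
  obtain ⟨b, hb⟩ : ∃ b, G.degree j = b + 1 := ⟨G.degree j - 1, by omega⟩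
  set c := (G.neighborFinset i ∩ G.neighborFinset j).card with hcdef
  rw [ha] at h2; rw [hb] at h3
  push_cast at h2 h3
  have hcc : c * c = a * b := by
    have : (c : ℝ) * c = a * b := by
      rw [h1]
      have ha' : (a : ℝ) = P i * P i + Q i * Q i := by linarith
      have hb' : (b : ℝ) = P j * P j + Q j * Q j := by linarith
      rw [ha', hb']
      linear_combination -(P i * Q j - P j * Q i) * hc
    exact_mod_cast this
  have hac : a ≤ c := by nlinarith
  have hca : c = a + 1 := by
    by_contra hne'
    have hca : c = a := by omega
    rw [hca] at hcc
    have hab : a = b := Nat.eq_of_mul_eq_mul_left (by omega) hcc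
    refine hs (SameVec.of_dist ?_)
    rw [← h1, hca]
    have : (a : ℝ) = b := by exact_mod_cast hab
    linarith
  rw [hca] at hcc
  have ha1 : a = 1 := by
    have : a + 3 ≤ b := by
      by_contra hlt
      have : b ≤ a + 2 := by omega
      nlinarith
    nlinarith
  subst ha1
  refine ⟨by omega, by omega, fun hadj => ?_, ?_⟩
  · have := codeg_lt_degree hadj
    omega
  · have h4 := card_inter_add_card_sdiff (G := G) i j
    have h5 : (G.neighborFinset i \ G.neighborFinset j).card = 0 := by omega
    rwa [Finset.card_eq_zero, Finset.sdiff_eq_empty_iff_subset] at h5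

theorem cross_ne_zero (h : PlanarRep G P Q r s) {i j : V} (hs : ¬ SameVec P Q i j)
    (hij : G.Adj i j) : P i * Q j - P j * Q i ≠ 0 := by
  intro hc
  rcases le_total (G.degree i) (G.degree j) with hd | hd
  · exact (h.of_parallel hc hs hd).2.2.1 hij
  · exact (h.of_parallel (by linear_combination -hc) (fun e => hs e.symm) hd).2.2.1 hij.symm

omit [Fintype V] [DecidableEq V] in
/-- The linear relation between three plane vectors, with cross products as coefficients. -/
theorem cross_relation (P Q : V → ℝ) (i j k : V) :
    (P j * Q k - P k * Q j) * P i + (P k * Q i - P i * Q k) * P j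
      + (P i * Q j - P j * Q i) * P k = 0 ∧
    (P j * Q k - P k * Q j) * Q i + (P k * Q i - P i * Q k) * Q j
      + (P i * Q j - P j * Q i) * Q k = 0 := by
  constructor <;> ring

/-- In a triangle, two vertices have the same vector. Otherwise, with `x, y, z` the coefficients of
`cross_relation`, the terms of `sum_sq_le` belonging to the triangle already sum to
`x² + y² + z² + (x + y + z)²`; hence `x + y + z = 0` and every other vertex is adjacent to all or
none of `i, j, k`, so that `i` and `j` have the same closed neighbourhood. -/
theorem same_of_triangle (h : PlanarRep G P Q r s) {i j k : V} (hij : G.Adj i j)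
    (hik : G.Adj i k) (hjk : G.Adj j k) (h1 : ¬ SameVec P Q i j) (h2 : ¬ SameVec P Q i k) :
    SameVec P Q j k := by
  by_contra h3
  have hx := h.cross_ne_zero h3 hjk
  have hy := h.cross_ne_zero (fun e => h2 e.symm) hik.symm
  have hz := h.cross_ne_zero h1 hij
  obtain ⟨eP, eQ⟩ := cross_relation P Q i j k
  set x := P j * Q k - P k * Q j
  set y := P k * Q i - P i * Q k
  set z := P i * Q j - P j * Q i
  have ht := h.sum_sq_le hij.ne hik.ne hjk.ne eP eQ
  have hsum : x + y + z = 0 := by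
    have := ht {i, j, k}
    rw [Finset.sum_insert (by simp [hij.ne, hik.ne]), Finset.sum_insert (by simp [hjk.ne]),
      Finset.sum_singleton] at this
    simp only [SimpleGraph.adjMatrix_apply, hij, hik, hjk, hij.symm, hik.symm, hjk.symm,
      SimpleGraph.irrefl, if_true, if_false] at this
    nlinarith [sq_nonneg (x + y + z)]
  have hout : ∀ m, m ≠ i → m ≠ j → m ≠ k → (G.Adj i m ↔ G.Adj j m) := by
    intro m hmi hmj hmk
    have := ht {i, j, k, m}
    rw [Finset.sum_insert (by simp [hij.ne, hik.ne, hmi.symm]),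
      Finset.sum_insert (by simp [hjk.ne, hmj.symm]), Finset.sum_insert (by simp [hmk.symm]),
      Finset.sum_singleton] at this
    simp only [SimpleGraph.adjMatrix_apply, hij, hik, hjk, hij.symm, hik.symm, hjk.symm,
      SimpleGraph.irrefl, if_true, if_false] at this
    have e : x * (if G.Adj i m then 1 else 0) + y * (if G.Adj j m then 1 else 0)
        + z * (if G.Adj k m then 1 else 0) = 0 := by
      rw [← sq_eq_zero_iff]
      refine le_antisymm ?_ (sq_nonneg _)
      have hz' : z = -x - y := by linarith
      rw [hz'] at this ⊢
      nlinarith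
    by_cases b1 : G.Adj i m <;> by_cases b2 : G.Adj j m <;> by_cases b3 : G.Adj k m <;>
      simp only [b1, b2, b3, if_true, if_false, mul_one, mul_zero, add_zero, zero_add] at e ⊢
    · exact (hy (by linarith)).elim
    · exact (hx e).elim
    · exact (hx (by linarith)).elim
    · exact (hy e).elim
  have hint : ∀ t u, G.Adj t u → (∀ m, m ≠ i → m ≠ j → m ≠ k → G.Adj t m → G.Adj u m) →
      (t = i ∧ u = j ∨ t = j ∧ u = i) →
      G.neighborFinset t \ G.neighborFinset u = {u} := by
    intro t u htu hm hcase
    ext m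
    simp only [Finset.mem_sdiff, SimpleGraph.mem_neighborFinset, Finset.mem_singleton]
    constructor
    · rintro ⟨a, b⟩
      by_contra hmu
      rcases hcase with ⟨rfl, rfl⟩ | ⟨rfl, rfl⟩
      · by_cases hmk : m = k
        · exact b (hmk ▸ hjk)
        · exact b (hm m a.ne' hmu hmk a)
      · by_cases hmk : m = k
        · exact b (hmk ▸ hik)
        · exact b (hm m hmu a.ne' hmk a)
    · rintro rfl
      exact ⟨htu, G.irrefl⟩
  have c1 := card_inter_add_card_sdiff (G := G) i j
  have c2 := card_inter_add_card_sdiff (G := G) j i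
  rw [hint i j hij (fun m a b c => (hout m a b c).1) (Or.inl ⟨rfl, rfl⟩),
    Finset.card_singleton] at c1
  rw [hint j i hij.symm (fun m a b c => (hout m a b c).2) (Or.inr ⟨rfl, rfl⟩),
    Finset.card_singleton, Finset.inter_comm] at c2
  refine h1 (SameVec.of_dist ?_)
  rw [← h.codeg i j hij.ne]
  have d1 := h.deg i
  have d2 := h.deg j
  rw [← c1] at d1
  rw [← c2] at d2
  push_cast at d1 d2
  linarith

/-- The neighbours of `j` with vectors other than `v j` all lie on the same side of the line
spanned by `v j`. -/
theorem cross_mul_cross_pos (h : PlanarRep G P Q r s) {i j k : V} (hji : G.Adj j i)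
    (hjk : G.Adj j k) (h1 : ¬ SameVec P Q j i) (h2 : ¬ SameVec P Q j k) :
    0 < (P j * Q i - P i * Q j) * (P j * Q k - P k * Q j) := by
  have hx := h.cross_ne_zero h2 hjk
  have hz := h.cross_ne_zero h1 hji
  by_cases hik : i = k
  · subst hik
    exact mul_self_pos.2 hx
  by_cases hadj : G.Adj i k
  · have := h.same_of_triangle hji hjk hadj h1 h2
    rw [← this.1, ← this.2] at hx ⊢
    exact mul_self_pos.2 hx
  · obtain ⟨eP, eQ⟩ := cross_relation P Q i j k
    set x := P j * Q k - P k * Q j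
    set y := P k * Q i - P i * Q k
    have ht := h.sum_sq_le hji.ne' hik hjk.ne eP eQ {i, j, k}
    rw [Finset.sum_insert (by simp [hji.ne', hik]), Finset.sum_insert (by simp [hjk.ne]),
      Finset.sum_singleton] at ht
    have hadj' : ¬ G.Adj k i := fun e => hadj e.symm
    simp only [SimpleGraph.adjMatrix_apply, hji, hadj, hadj', hjk, hji.symm, hjk.symm,
      SimpleGraph.irrefl, if_true, if_false] at ht
    have hge : 0 ≤ (P j * Q i - P i * Q j) * x := by nlinarith [sq_nonneg y]
    exact lt_of_le_of_ne hge (mul_ne_zero hz hx).symm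

/-- If all neighbours of `i` had the vector of `i`, the closed neighbourhood of `i` would be a
component carrying a single vector. -/
theorem exists_adj_not_same (h : PlanarRep G P Q r s) (i : V) :
    ∃ j, G.Adj i j ∧ ¬ SameVec P Q i j := by
  by_contra! hc
  have hall := h.eq_univ_of_closed (S := insert i (G.neighborFinset i)) (i := i) (by simp) (by
    intro x hx y hxy
    rw [Finset.mem_insert, SimpleGraph.mem_neighborFinset] at hx ⊢
    rcases hx with rfl | hx
    · exact Or.inr hxy
    · by_cases hyi : y = i
      · exact Or.inl hyi
      · exact Or.inr (h.adj_of_same_of_adj (hc x hx).symm hx.symm hyi hxy))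
  have hsame : ∀ x, SameVec P Q i x := by
    intro x
    have := hall x
    rw [Finset.mem_insert, SimpleGraph.mem_neighborFinset] at this
    rcases this with rfl | hx
    · exact SameVec.refl _
    · exact hc x hx
  obtain ⟨a, b, hab⟩ := h.nd
  rw [← (hsame a).1, ← (hsame b).1, ← (hsame a).2, ← (hsame b).2] at hab
  exact hab (by ring)

theorem sum_cross (h : PlanarRep G P Q r s) (j : V) :
    ∑ u ∈ G.neighborFinset j, (P j * Q u - P u * Q j) = (s - r) * (P j * Q j) := by
  rw [Finset.sum_sub_distrib, ← Finset.mul_sum, ← Finset.sum_mul, h.eigP, h.eigQ]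
  ring

/-- Which side of the line spanned by `v j` the neighbours lie on is determined by the sign of
`P j * Q j`, because the cross products sum to `(s - r) * (P j * Q j)`. -/
theorem cross_mul_side_neg (h : PlanarRep G P Q r s) {j u : V} (hju : G.Adj j u)
    (hs : ¬ SameVec P Q j u) : (P j * Q u - P u * Q j) * (P j * Q j) < 0 := by
  have hpos : 0 < ∑ v ∈ G.neighborFinset j,
      (P j * Q u - P u * Q j) * (P j * Q v - P v * Q j) := by
    refine Finset.sum_pos' (fun v hv => ?_)
      ⟨u, by simpa using hju, h.cross_mul_cross_pos hju hju hs hs⟩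
    by_cases hsv : SameVec P Q j v
    · rw [← hsv.1, ← hsv.2]
      simp
    · exact (h.cross_mul_cross_pos hju (by simpa using hv) hs hsv).le
  rw [← Finset.mul_sum, h.sum_cross] at hpos
  nlinarith [h.lt]

theorem side_ne_zero (h : PlanarRep G P Q r s) (j : V) : P j * Q j ≠ 0 := by
  obtain ⟨u, hu, hs⟩ := h.exists_adj_not_same j
  intro e
  have := h.cross_mul_side_neg hu hs
  rw [e, mul_zero] at this
  exact lt_irrefl _ this

/-- Adjacent vertices with different vectors have products `P * Q` of opposite signs. The sign of
`P i * Q i` thus divides the vertices into two sides, and an edge stays within a side exactly when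
its ends have the same vector. -/
theorem side_mul_side_neg (h : PlanarRep G P Q r s) {j u : V} (hju : G.Adj j u)
    (hs : ¬ SameVec P Q j u) : (P j * Q j) * (P u * Q u) < 0 := by
  have h1 := h.cross_mul_side_neg hju hs
  have h2 := h.cross_mul_side_neg hju.symm (fun e => hs e.symm)
  have h3 : 0 < ((P j * Q u - P u * Q j) * (P j * Q j)) *
    ((P u * Q j - P j * Q u) * (P u * Q u)) := mul_pos_of_neg_of_neg h1 h2
  have h4 : 0 < (P j * Q u - P u * Q j) ^ 2 := by
    have := h.cross_ne_zero hs hju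
    positivity
  by_contra hge
  push Not at hge
  nlinarith [mul_nonneg h4.le hge]

end PlanarRep
end

/-! ### Inner neighbours -/

open Classical in
/-- The inner neighbours of `i`: the neighbours with the same vector as `i`. -/
noncomputable def innerNbrs {V : Type*} [Fintype V] (G : SimpleGraph V) [DecidableRel G.Adj]
    (P Q : V → ℝ) (i : V) : Finset V :=
  {x ∈ G.neighborFinset i | SameVec P Q i x}

section
variable {V : Type*} [Fintype V] [DecidableEq V] {G : SimpleGraph V} [DecidableRel G.Adj]

omit [DecidableEq V] in
theorem mem_innerNbrs {P Q : V → ℝ} {i x : V} :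
    x ∈ innerNbrs G P Q i ↔ G.Adj i x ∧ SameVec P Q i x := by
  simp [innerNbrs]

omit [DecidableEq V] in
theorem innerNbrs_neg {P Q : V → ℝ} {i : V} :
    innerNbrs G P (fun i => -Q i) i = innerNbrs G P Q i := by
  ext x
  simp [mem_innerNbrs, SameVec.neg_iff]

omit [DecidableEq V] in
theorem innerNbrs_card_pos {P Q : V → ℝ} {i : V} :
    (innerNbrs G P Q i).card ≠ 0 ↔ ∃ x, G.Adj i x ∧ SameVec P Q i x := by
  rw [Finset.card_ne_zero]
  exact ⟨fun ⟨x, hx⟩ => ⟨x, mem_innerNbrs.1 hx⟩, fun ⟨x, hx⟩ => ⟨x, mem_innerNbrs.2 hx⟩⟩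

namespace PlanarRep
variable {P Q : V → ℝ} {r s : ℝ}

theorem same_of_adj (h : PlanarRep G P Q r s) {i j : V} (hij : G.Adj i j)
    (hs : 0 < P i * Q i * (P j * Q j)) : SameVec P Q i j := by
  by_contra hn
  exact lt_asymm hs (h.side_mul_side_neg hij hn)

omit [Fintype V] [DecidableEq V] in
theorem not_same_of_opp {i j : V} (hs : P i * Q i * (P j * Q j) < 0) : ¬ SameVec P Q i j := by
  intro e
  rw [← e.1, ← e.2] at hs
  nlinarith [mul_self_nonneg (P i * Q i)]

omit [Fintype V] [DecidableEq V] in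
theorem ne_of_opp {i j : V} (hs : P i * Q i * (P j * Q j) < 0) : i ≠ j :=
  fun e => not_same_of_opp hs (e ▸ SameVec.refl i)

theorem adj_iff_of_twin (h : PlanarRep G P Q r s) {i j x : V} (hs : SameVec P Q i j)
    (hij : G.Adj i j) (hxi : x ≠ i) (hxj : x ≠ j) : G.Adj i x ↔ G.Adj j x :=
  ⟨h.adj_of_same_of_adj hs hij hxj, h.adj_of_same_of_adj hs.symm hij.symm hxi⟩

/-- The common neighbours of adjacent vertices with different vectors are, by `same_of_triangle`,
the inner neighbours of the two. -/
theorem gram_of_adj (h : PlanarRep G P Q r s) {i j : V} (hij : G.Adj i j)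
    (hs : ¬ SameVec P Q i j) : P i * P j + Q i * Q j
      = (innerNbrs G P Q i).card + (innerNbrs G P Q j).card := by
  rw [← h.codeg i j hij.ne, ← Nat.cast_add, ← Finset.card_union_of_disjoint]
  · congr 2
    ext x
    simp only [Finset.mem_inter, SimpleGraph.mem_neighborFinset, Finset.mem_union, mem_innerNbrs]
    constructor
    · rintro ⟨a, b⟩
      by_cases e : SameVec P Q i x
      · exact Or.inl ⟨a, e⟩
      · exact Or.inr ⟨b, h.same_of_triangle hij a b hs e⟩
    · rintro (⟨a, b⟩ | ⟨a, b⟩)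
      · exact ⟨a, (h.adj_of_same_of_adj b a (fun e => hs (by rw [e]; exact b)) hij).symm⟩
      · exact ⟨(h.adj_of_same_of_adj b a (fun e => hs (by rw [e]; exact b.symm)) hij.symm).symm,
          a⟩
  · rw [Finset.disjoint_left]
    intro x hx hx'
    exact hs ((mem_innerNbrs.1 hx).2.trans (mem_innerNbrs.1 hx').2.symm)

/-- Non-adjacent vertices on opposite sides have no common neighbour `x`: as `x` has the same
vector as one of them, it would share its closed neighbourhood with that one. -/
theorem gram_of_not_adj (h : PlanarRep G P Q r s) {i j : V} (hij : ¬ G.Adj i j)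
    (hs : P i * Q i * (P j * Q j) < 0) : P i * P j + Q i * Q j = 0 := by
  have hns := not_same_of_opp hs
  rw [← h.codeg i j (ne_of_opp hs), Nat.cast_eq_zero, Finset.card_eq_zero,
    Finset.eq_empty_iff_forall_notMem]
  intro x hx
  simp only [Finset.mem_inter, SimpleGraph.mem_neighborFinset] at hx
  rcases lt_or_gt_of_ne (mul_ne_zero (h.side_ne_zero i) (h.side_ne_zero x)) with hl | hl
  · have hl' : 0 < P j * Q j * (P x * Q x) := by
      have h1 := mul_pos_of_neg_of_neg hs hl
      have h2 : 0 < (P i * Q i) ^ 2 := by have := h.side_ne_zero i; positivity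
      by_contra hc
      push Not at hc
      nlinarith [mul_nonneg h2.le (neg_nonneg.2 hc)]
    have e := h.same_of_adj hx.2 hl'
    exact hij (h.adj_of_same_of_adj e.symm hx.2.symm (ne_of_opp hs) hx.1.symm).symm
  · have e := h.same_of_adj hx.1 hl
    exact hij (h.adj_of_same_of_adj e.symm hx.1.symm (ne_of_opp hs).symm hx.2.symm)

/-- Two non-adjacent vertices with different vectors and a common neighbour `k` do not both have
inner neighbours `i'`, `j'`: the columns of `i, i', j, j', k` alone would exceed the bound of
`sum_sq_le`, unless `v i = v j`. -/
theorem innerNbrs_eq_empty_or (h : PlanarRep G P Q r s) {i j k : V}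
    (hns : ¬ SameVec P Q i j) (hnadj : ¬ G.Adj i j) (hki : G.Adj i k) (hkj : G.Adj j k)
    (hik : ¬ SameVec P Q i k) (hjk : ¬ SameVec P Q j k) :
    (innerNbrs G P Q i).card = 0 ∨ (innerNbrs G P Q j).card = 0 := by
  by_contra! hc
  obtain ⟨⟨i', hi', si⟩, ⟨j', hj', sj⟩⟩ :=
    And.intro (innerNbrs_card_pos.1 hc.1) (innerNbrs_card_pos.1 hc.2)
  have hij : i ≠ j := fun e => hns (e ▸ SameVec.refl i)
  have n1 : i' ≠ j := fun e => hns (e ▸ si)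
  have n2 : j' ≠ i := fun e => hns (e ▸ sj.symm)
  have n3 : i' ≠ j' := fun e => hns (si.trans (e ▸ sj.symm))
  have n4 : i' ≠ k := fun e => hik (e ▸ si)
  have n5 : j' ≠ k := fun e => hjk (e ▸ sj)
  have a1 : G.Adj k i' := ((h.adj_iff_of_twin si hi' hki.ne' n4.symm).1 hki).symm
  have a2 : G.Adj k j' := ((h.adj_iff_of_twin sj hj' hkj.ne' n5.symm).1 hkj).symm
  have b1 : ¬ G.Adj j i' := fun e =>
    hnadj ((h.adj_iff_of_twin si hi' hij.symm n1.symm).2 e.symm)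
  have b2 : ¬ G.Adj i j' := fun e =>
    hnadj ((h.adj_iff_of_twin sj hj' hij n2.symm).2 e.symm).symm
  obtain ⟨eP, eQ⟩ := cross_relation P Q i j k
  have hz : P j * Q k - P k * Q j ≠ 0 := h.cross_ne_zero hjk hkj
  have hz' : P k * Q i - P i * Q k ≠ 0 := h.cross_ne_zero (fun e => hik e.symm) hki.symm
  set x := P j * Q k - P k * Q j with hxd
  set y := P k * Q i - P i * Q k with hyd
  set z := P i * Q j - P j * Q i with hzd
  have ht := h.sum_sq_le hij hki.ne hkj.ne eP eQ {i, i', j, j', k}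
  rw [Finset.sum_insert (by simp [hij, hi'.ne, n2.symm, hki.ne]),
    Finset.sum_insert (by simp [n1, n3, n4]), Finset.sum_insert (by simp [hj'.ne, hkj.ne]),
    Finset.sum_insert (by simp [n5]), Finset.sum_singleton] at ht
  have hnadj' : ¬ G.Adj j i := fun e => hnadj e.symm
  simp only [SimpleGraph.adjMatrix_apply, hi', hj', hki, hkj, hki.symm, hkj.symm, a1, a2, b1, b2,
    hnadj, hnadj', SimpleGraph.irrefl, if_true, if_false] at ht
  have hz0 : z = 0 := by nlinarith [sq_nonneg z, sq_nonneg (x + y + z)]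
  have hxy : x + y = 0 := by
    rw [hz0] at ht
    nlinarith [sq_nonneg (x + y)]
  -- With `z = 0` and `x + y = 0`, the relation `x v_i + y v_j + z v_k = 0` reads
  -- `x (v_i - v_j) = 0`.
  have h1 : x * (P i - P j) = 0 := by
    rw [hz0] at eP; linear_combination eP - P j * hxy
  have h2 : x * (Q i - Q j) = 0 := by
    rw [hz0] at eQ; linear_combination eQ - Q j * hxy
  refine hns ⟨?_, ?_⟩
  · have := (mul_eq_zero.1 h1).resolve_left hz; linarith
  · have := (mul_eq_zero.1 h2).resolve_left hz; linarith

/-- An inner neighbour of `i` is not adjacent to a non-adjacent `k` with the same vector, so it is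
the single vertex in which the neighbourhood of `i` exceeds that of `k`. -/
theorem card_innerNbrs_eq_one (h : PlanarRep G P Q r s) {i k : V} (hik : SameVec P Q i k)
    (hne : i ≠ k) (hadj : ¬ G.Adj i k) (hi : (innerNbrs G P Q i).card ≠ 0) :
    (innerNbrs G P Q i).card = 1 := by
  obtain ⟨x, -, hx, -⟩ := h.exists_sdiff_of_same hik hne
  have hsub : innerNbrs G P Q i ⊆ {x} := by
    rw [← hx]
    intro u hu
    rw [mem_innerNbrs] at hu
    simp only [Finset.mem_sdiff, SimpleGraph.mem_neighborFinset]
    refine ⟨hu.1, fun e => hadj ?_⟩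
    exact h.adj_of_same_of_adj hu.2.symm hu.1.symm hne.symm e.symm
  have := Finset.card_le_card hsub
  rw [Finset.card_singleton] at this
  omega

/-- `S` is the set of neighbours of `i` with a different vector. -/
theorem degree_eq_add (P Q : V → ℝ) {i : V} (S : Finset V)
    (hS : ∀ x, x ∈ S ↔ (G.Adj i x ∧ ¬ SameVec P Q i x)) :
    G.degree i = (innerNbrs G P Q i).card + S.card := by
  rw [← SimpleGraph.card_neighborFinset_eq_degree, ← Finset.card_union_of_disjoint]
  · congr 1
    ext x
    simp only [SimpleGraph.mem_neighborFinset, Finset.mem_union, mem_innerNbrs, hS]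
    tauto
  · rw [Finset.disjoint_left]
    intro x hx hx'
    exact ((hS x).1 hx').2 (mem_innerNbrs.1 hx).2

end PlanarRep
end

/-! ### Enumerations and the shape of a class of equal vectors -/

/-- The map `f` lists the elements of the finite set `S` without repetition. -/
def Enumerates {α V : Type*} (f : α → V) (S : Finset V) : Prop :=
  Function.Injective f ∧ ∀ x, x ∈ S ↔ ∃ i, f i = x

namespace Enumerates
variable {α β V : Type*} {f : α → V} {g : β → V} {S T : Finset V}

theorem mem (h : Enumerates f S) (i : α) : f i ∈ S := (h.2 _).2 ⟨i, rfl⟩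

theorem sumElim [DecidableEq V] (hf : Enumerates f S) (hg : Enumerates g T)
    (hd : Disjoint S T) : Enumerates (Sum.elim f g) (S ∪ T) := by
  refine ⟨hf.1.sumElim hg.1 fun i j e => ?_, fun x => ?_⟩
  · exact Finset.disjoint_left.1 hd (hf.mem i) (e ▸ hg.mem j)
  · rw [Finset.mem_union, hf.2, hg.2]
    simp

theorem unit (x : V) : Enumerates (fun _ : Unit => x) {x} :=
  ⟨fun _ _ _ => rfl, fun y => by simp [eq_comm]⟩

theorem exists_fin (S : Finset V) : ∃ f : Fin S.card → V, Enumerates f S := by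
  refine ⟨fun i => S.equivFin.symm i, fun i j e => by simpa using e, fun x => ?_⟩
  constructor
  · intro hx; exact ⟨S.equivFin ⟨x, hx⟩, by simp⟩
  · rintro ⟨i, rfl⟩; exact (S.equivFin.symm i).2

/-- A perfect matching `R` between `S` and `T` admits enumerations of `S` and `T` under which it is
the identity. -/
theorem exists_partner {R : V → V → Prop} (h1 : ∀ x ∈ S, ∃! y, y ∈ T ∧ R x y)
    (h2 : ∀ y ∈ T, ∃! x, x ∈ S ∧ R x y) :
    ∃ f g : Fin S.card → V, Enumerates f S ∧ Enumerates g T ∧ ∀ i j, R (f i) (g j) ↔ i = j := by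
  obtain ⟨f, hf⟩ := exists_fin S
  choose! p hp hp' using h1
  have key : ∀ i j, R (f i) (p (f j)) ↔ i = j := by
    intro i j
    constructor
    · intro hr
      have := (h2 (p (f j)) (hp _ (hf.mem j)).1).unique ⟨hf.mem i, hr⟩
        ⟨hf.mem j, (hp _ (hf.mem j)).2⟩
      exact hf.1 this
    · rintro rfl; exact (hp _ (hf.mem i)).2
  refine ⟨f, fun i => p (f i), hf, ⟨fun i j e => ?_, fun y => ⟨fun hy => ?_, ?_⟩⟩, key⟩
  · have e' : p (f i) = p (f j) := e
    exact (key i j).1 (e' ▸ (key i i).2 rfl)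
  · obtain ⟨x, ⟨hx, hr⟩, -⟩ := h2 y hy
    obtain ⟨i, rfl⟩ := (hf.2 x).1 hx
    exact ⟨i, (hp' (f i) hx y ⟨hy, hr⟩).symm⟩
  · rintro ⟨i, rfl⟩; exact (hp _ (hf.mem i)).1

/-- `exists_partner` with a prescribed name for the cardinality. -/
theorem exists_partner' {R : V → V → Prop} {n : ℕ} (hn : S.card = n)
    (h1 : ∀ x ∈ S, ∃! y, y ∈ T ∧ R x y) (h2 : ∀ y ∈ T, ∃! x, x ∈ S ∧ R x y) :
    ∃ f g : Fin n → V, Enumerates f S ∧ Enumerates g T ∧ ∀ i j, R (f i) (g j) ↔ i = j := by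
  subst hn
  exact exists_partner h1 h2

/-- A fixed-point-free involution is a product of `|X| / 2` transpositions. -/
theorem cycleType_of_involution {X : Type*} [Fintype X] [DecidableEq X] (σ : Equiv.Perm X)
    (h2 : ∀ x, σ (σ x) = x) (h1 : ∀ x, σ x ≠ x) :
    2 * σ.cycleType.card = Fintype.card X ∧
      σ.cycleType = Multiset.replicate σ.cycleType.card 2 := by
  have hp : σ ^ 2 = 1 := by ext x; simp [pow_two, h2]
  have hall := (Equiv.Perm.pow_prime_eq_one_iff (p := 2)).1 hp
  have hrep := Multiset.eq_replicate_card.2 hall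
  refine ⟨?_, hrep⟩
  have hsum := σ.sum_cycleType
  rw [hrep, Multiset.sum_replicate, smul_eq_mul] at hsum
  have hsupp : σ.support = Finset.univ := by ext x; simp [h1]
  rw [hsupp, Finset.card_univ] at hsum
  omega

/-- A perfect matching `R` on `S` admits an enumeration of `S` that pairs `i` with `Fin.rev i`: the
partner map and `Fin.rev` are fixed-point-free involutions, hence conjugate. -/
theorem exists_matching [DecidableEq V] {R : V → V → Prop} (hsymm : ∀ x y, R x y → R y x)
    (hirr : ∀ x, ¬ R x x) (h : ∀ x ∈ S, ∃! y, y ∈ S ∧ R x y) :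
    ∃ k, S.card = 2 * k ∧ ∃ f : Fin (2 * k) → V, Enumerates f S ∧
      ∀ i j, R (f i) (f j) ↔ i = Fin.rev j := by
  choose! p hp hp' using h
  have hpp : ∀ x ∈ S, p (p x) = x := fun x hx =>
    (hp' (p x) (hp x hx).1 x ⟨hx, hsymm _ _ (hp x hx).2⟩).symm
  let σ : Equiv.Perm S :=
    ⟨fun x => ⟨p x, (hp x x.2).1⟩, fun x => ⟨p x, (hp x x.2).1⟩,
      fun x => Subtype.ext (hpp x x.2), fun x => Subtype.ext (hpp x x.2)⟩
  obtain ⟨hk, hc⟩ := cycleType_of_involution σ (fun x => Subtype.ext (hpp x x.2))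
    (fun x e => hirr x (by
      have e' : p x = x := congrArg Subtype.val e
      have := (hp x x.2).2
      rwa [e'] at this))
  rw [Fintype.card_coe] at hk
  set k := σ.cycleType.card
  refine ⟨k, hk.symm, ?_⟩
  obtain ⟨hk', hc'⟩ := cycleType_of_involution (Fin.revPerm : Equiv.Perm (Fin (2 * k)))
    (fun x => by simp) (fun x e => by
      have := congrArg Fin.val e
      simp [Fin.val_rev] at this
      omega)
  rw [Fintype.card_fin] at hk'
  let e : S ≃ Fin (2 * k) := S.equivFinOfCardEq hk.symm
  obtain ⟨τ, hτ⟩ : ∃ τ : Equiv.Perm (Fin (2 * k)),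
      ∀ i, τ (e (σ (e.symm i))) = Fin.rev (τ i) := by
    have hconj : IsConj (e.permCongr σ) Fin.revPerm := by
      rw [Equiv.Perm.isConj_iff_cycleType_eq]
      obtain ⟨hk2, hc2⟩ := cycleType_of_involution (e.permCongr σ)
        (fun x => by simp [Equiv.permCongr_apply, σ, hpp])
        (fun x he => by
          have he' : e (σ (e.symm x)) = x := he
          have h3 : σ (e.symm x) = e.symm x := (Equiv.eq_symm_apply e).2 he'
          have e' : p (e.symm x) = (e.symm x) := congrArg Subtype.val h3
          have := (hp _ (e.symm x).2).2
          rw [e'] at this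
          exact hirr _ this)
      rw [Fintype.card_fin] at hk2
      rw [hc2, hc']
      congr 1
      omega
    obtain ⟨τ, hτ⟩ := isConj_iff.1 hconj
    refine ⟨τ, fun i => ?_⟩
    have := congrArg (fun π : Equiv.Perm (Fin (2 * k)) => π (τ i)) hτ
    simpa [Equiv.permCongr_apply] using this
  refine ⟨fun i => e.symm (τ.symm i), ⟨fun i j hij => ?_, fun x => ⟨fun hx => ?_, ?_⟩⟩, ?_⟩
  · simpa using hij
  · exact ⟨τ (e ⟨x, hx⟩), by simp⟩
  · rintro ⟨i, rfl⟩; exact (e.symm (τ.symm i)).2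
  · intro i j
    have hR : ∀ x y : S, R x y ↔ σ x = y := by
      intro x y
      constructor
      · intro hr; exact Subtype.ext (hp' x x.2 y ⟨y.2, hr⟩).symm
      · rintro rfl; exact (hp x x.2).2
    rw [hR]
    have := hτ (τ.symm i)
    rw [Equiv.apply_symm_apply] at this
    constructor
    · intro e1
      rw [e1] at this
      simp only [Equiv.apply_symm_apply] at this
      rw [this, Fin.rev_rev]
    · rintro rfl
      rw [Fin.rev_rev] at this
      rw [Equiv.eq_symm_apply, Equiv.eq_symm_apply]; exact this

end Enumerates

section
variable {V : Type*} [Fintype V] [DecidableEq V] {G : SimpleGraph V} [DecidableRel G.Adj]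

omit [DecidableEq V] in
theorem hasAdjMatrix_of_enumerates {α : Type*} {M : Matrix α α ℝ} {f : α → V}
    (hf : Enumerates f Finset.univ)
    (h : ∀ x y, M x y = if G.Adj (f x) (f y) then 1 else 0) : HasAdjMatrix G M := by
  let e : α ≃ V := Equiv.ofBijective f ⟨hf.1, fun x => (hf.2 x).1 (Finset.mem_univ x)⟩
  refine ⟨e.symm, ?_⟩
  ext x y
  rw [Matrix.reindex_apply, Matrix.submatrix_apply, h]
  simp only [Equiv.symm_symm, SimpleGraph.adjMatrix_apply]
  rfl

namespace PlanarRep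
variable {P Q : V → ℝ} {r s : ℝ}

/-- A set `S` of vertices with the same vector that contains all their inner neighbours, at least
one for each, induces a complete graph or a perfect matching (with at least three vertices in the
latter case, when it is not complete). -/
theorem clique_or_matching (h : PlanarRep G P Q r s) {S : Finset V}
    (hsame : ∀ x ∈ S, ∀ y ∈ S, SameVec P Q x y)
    (hcl : ∀ x ∈ S, ∀ y, G.Adj x y → SameVec P Q x y → y ∈ S)
    (hpos : ∀ x ∈ S, (innerNbrs G P Q x).card ≠ 0) :
    (∀ x ∈ S, ∀ y ∈ S, x ≠ y → G.Adj x y) ∨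
      ((∀ x ∈ S, (innerNbrs G P Q x).card = 1) ∧ (∀ x ∈ S, ∃! y, y ∈ S ∧ G.Adj x y) ∧
        3 ≤ S.card) := by
  by_cases hc : ∀ x ∈ S, ∀ y ∈ S, x ≠ y → G.Adj x y
  · exact Or.inl hc
  · right
    push Not at hc
    obtain ⟨i, hi, k, hk, hik, hn⟩ := hc
    have hone : ∀ x ∈ S, (innerNbrs G P Q x).card = 1 := by
      intro x hx
      have key : ∀ w ∈ S, x ≠ w → ¬ G.Adj x w → (innerNbrs G P Q x).card = 1 :=
        fun w hw hne hadj => h.card_innerNbrs_eq_one (hsame x hx w hw) hne hadj (hpos x hx)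
      by_cases hxi : x = i
      · subst hxi; exact key k hk hik hn
      by_cases hxk : x = k
      · subst hxk; exact key i hi hik.symm (fun e => hn e.symm)
      by_cases ha : G.Adj x i
      · refine key k hk hxk fun hb => hn ?_
        exact h.adj_of_same_of_adj (hsame x hx i hi) ha hik.symm hb
      · exact key i hi hxi ha
    refine ⟨hone, fun x hx => ?_, ?_⟩
    · obtain ⟨y, hy⟩ := Finset.card_eq_one.1 (hone x hx)
      have hy' : y ∈ innerNbrs G P Q x := by rw [hy]; simp
      rw [mem_innerNbrs] at hy'
      refine ⟨y, ⟨hcl x hx y hy'.1 hy'.2, hy'.1⟩, fun z hz => ?_⟩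
      have : z ∈ innerNbrs G P Q x := mem_innerNbrs.2 ⟨hz.2, hsame x hx z hz.1⟩
      rw [hy] at this
      simpa using this
    · obtain ⟨i', hi', si⟩ := innerNbrs_card_pos.1 (hpos i hi)
      have hsub : ({i, i', k} : Finset V) ⊆ S := by
        intro u hu
        simp only [Finset.mem_insert, Finset.mem_singleton] at hu
        rcases hu with rfl | rfl | rfl
        · exact hi
        · exact hcl i hi _ hi' si
        · exact hk
      have := Finset.card_le_card hsub
      rwa [Finset.card_insert_of_notMem (by simp [hi'.ne, hik]),
        Finset.card_insert_of_notMem (by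
          rw [Finset.mem_singleton]; rintro rfl; exact hn hi'), Finset.card_singleton] at this

end PlanarRep
end

/-! ### Joins of the two sides -/

section
variable {V : Type*} [Fintype V] [DecidableEq V] {G : SimpleGraph V} [DecidableRel G.Adj]

theorem JsubI_apply (n : ℕ) (i j : Fin n) : JsubI n i j = if i = j then 0 else 1 := by
  simp only [JsubI, allOnes, Matrix.sub_apply, of_apply, one_apply]
  split_ifs <;> norm_num

theorem allOnes_apply {α β : Type*} (i : α) (j : β) : allOnes α β i j = 1 := rfl

theorem revId_apply (n : ℕ) (i j : Fin n) :
    revId n i j = if i = Fin.rev j then 1 else 0 := rfl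

theorem hasAdjMatrix_matII {S T : Finset V} (hd : Disjoint S T) (hu : S ∪ T = Finset.univ)
    (hST : ∀ x ∈ S, ∀ y ∈ T, G.Adj x y) (hS : ∀ x ∈ S, ∀ y ∈ S, x ≠ y → G.Adj x y)
    (hT : ∀ x ∈ T, ∃! y, y ∈ T ∧ G.Adj x y) :
    ∃ k, T.card = 2 * k ∧ HasAdjMatrix G (matII S.card k) := by
  obtain ⟨f, hf⟩ := Enumerates.exists_fin S
  obtain ⟨k, hk, g, hg, hgr⟩ := Enumerates.exists_matching (R := G.Adj)
    (fun x y e => e.symm) (fun x => G.irrefl) hT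
  refine ⟨k, hk, hasAdjMatrix_of_enumerates (hu ▸ hf.sumElim hg hd) ?_⟩
  rintro (i | i) (j | j)
  · have : G.Adj (f i) (f j) ↔ ¬ i = j :=
      ⟨fun e h => G.irrefl (h ▸ e), fun h => hS _ (hf.mem i) _ (hf.mem j) fun e => h (hf.1 e)⟩
    simp [matII, JsubI_apply, this]
  · simp [matII, allOnes_apply, hST _ (hf.mem i) _ (hg.mem j)]
  · simp [matII, allOnes_apply, (hST _ (hf.mem j) _ (hg.mem i)).symm]
  · simp [matII, revId_apply, hgr]

theorem hasAdjMatrix_matIII {S T : Finset V} (hd : Disjoint S T) (hu : S ∪ T = Finset.univ)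
    (hST : ∀ x ∈ S, ∀ y ∈ T, G.Adj x y) (hS : ∀ x ∈ S, ∃! y, y ∈ S ∧ G.Adj x y)
    (hT : ∀ x ∈ T, ∃! y, y ∈ T ∧ G.Adj x y) :
    ∃ l m, S.card = 2 * l ∧ T.card = 2 * m ∧ HasAdjMatrix G (matIII l m) := by
  obtain ⟨l, hl, f, hf, hfr⟩ := Enumerates.exists_matching (R := G.Adj)
    (fun x y e => e.symm) (fun x => G.irrefl) hS
  obtain ⟨k, hk, g, hg, hgr⟩ := Enumerates.exists_matching (R := G.Adj)
    (fun x y e => e.symm) (fun x => G.irrefl) hT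
  refine ⟨l, k, hl, hk, hasAdjMatrix_of_enumerates (hu ▸ hf.sumElim hg hd) ?_⟩
  rintro (i | i) (j | j)
  · simp [matIII, revId_apply, hfr]
  · simp [matIII, allOnes_apply, hST _ (hf.mem i) _ (hg.mem j)]
  · simp [matIII, allOnes_apply, (hST _ (hf.mem j) _ (hg.mem i)).symm]
  · simp [matIII, revId_apply, hgr]

theorem hasAdjMatrix_matV {S T : Finset V} {u : V} (hd : Disjoint S T) (huS : u ∉ S) (huT : u ∉ T)
    (hun : ∀ x, x ∈ S ∨ x ∈ T ∨ x = u)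
    (hST : ∀ x ∈ S, ∀ y ∈ T, G.Adj x y) (hS : ∀ x ∈ S, ∀ y ∈ S, x ≠ y → G.Adj x y)
    (hT : ∀ x ∈ T, ∀ y ∈ T, x ≠ y → G.Adj x y) (hSu : ∀ x ∈ S, G.Adj x u)
    (hTu : ∀ x ∈ T, ¬ G.Adj x u) : HasAdjMatrix G (matV S.card T.card) := by
  obtain ⟨f, hf⟩ := Enumerates.exists_fin S
  obtain ⟨g, hg⟩ := Enumerates.exists_fin T
  have hd1 : Disjoint T {u} := by simpa using huT
  have hd2 : Disjoint S (T ∪ {u}) := by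
    rw [Finset.disjoint_union_right]
    exact ⟨hd, by simpa using huS⟩
  have hu : S ∪ (T ∪ {u}) = Finset.univ := by
    ext x
    simp only [Finset.mem_union, Finset.mem_singleton, Finset.mem_univ, iff_true]
    exact hun x
  refine hasAdjMatrix_of_enumerates
    (hu ▸ hf.sumElim (hg.sumElim (Enumerates.unit u) hd1) hd2) ?_
  have h1 : ∀ i j, G.Adj (f i) (f j) ↔ ¬ i = j := fun i j =>
    ⟨fun e h => G.irrefl (h ▸ e), fun h => hS _ (hf.mem i) _ (hf.mem j) fun e => h (hf.1 e)⟩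
  have h2 : ∀ i j, G.Adj (g i) (g j) ↔ ¬ i = j := fun i j =>
    ⟨fun e h => G.irrefl (h ▸ e), fun h => hT _ (hg.mem i) _ (hg.mem j) fun e => h (hg.1 e)⟩
  rintro (i | i | i) (j | j | j)
  · simp [matV, blocks3, JsubI_apply, h1]
  · simp [matV, blocks3, allOnes_apply, hST _ (hf.mem i) _ (hg.mem j)]
  · simp [matV, blocks3, allOnes_apply, hSu _ (hf.mem i)]
  · simp [matV, blocks3, allOnes_apply, (hST _ (hf.mem j) _ (hg.mem i)).symm]
  · simp [matV, blocks3, JsubI_apply, h2]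
  · simp [matV, blocks3, hTu _ (hg.mem i)]
  · simp [matV, blocks3, allOnes_apply, (hSu _ (hf.mem j)).symm]
  · simp [matV, blocks3, G.adj_comm u, hTu _ (hg.mem j)]
  · simp [matV, blocks3]

namespace PlanarRep
variable {P Q : V → ℝ} {r s : ℝ}

/-- In a complete graph all vectors would be equal. -/
theorem not_complete (h : PlanarRep G P Q r s) : ∃ x y, x ≠ y ∧ ¬ G.Adj x y := by
  by_contra! hc
  obtain ⟨i⟩ := h.conn.nonempty
  obtain ⟨j, hij, hs⟩ := h.exists_adj_not_same i
  have hN : ∀ x, G.neighborFinset x = Finset.univ.erase x := by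
    intro x; ext y
    simp only [SimpleGraph.mem_neighborFinset, Finset.mem_erase, Finset.mem_univ, and_true]
    exact ⟨fun e => e.ne', fun e => hc x y e.symm⟩
  have hdeg : ∀ x, G.degree x = Fintype.card V - 1 := by
    intro x
    rw [← SimpleGraph.card_neighborFinset_eq_degree, hN, Finset.card_erase_of_mem (by simp),
      Finset.card_univ]
  have hsd : G.neighborFinset i \ G.neighborFinset j = {j} := by
    ext y
    simp only [Finset.mem_sdiff, SimpleGraph.mem_neighborFinset, Finset.mem_singleton]
    refine ⟨fun e => ?_, ?_⟩
    · by_contra hy; exact e.2 (hc j y (Ne.symm hy))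
    · rintro rfl; exact ⟨hij, G.irrefl⟩
  have h1 := card_inter_add_card_sdiff (G := G) i j
  rw [hsd, Finset.card_singleton] at h1
  have h2 := h.codeg i j hij.ne
  have h3 := h.deg i
  have h4 := h.deg j
  rw [hdeg j, ← hdeg i, ← h1] at h4
  rw [← h1] at h3
  push_cast at h3 h4
  exact hs (SameVec.of_dist (by linarith))

open Classical in
/-- If vertices on opposite sides are always adjacent and every vertex of the negative side has
inner neighbours, then the negative side is a single class. The positive side is one class (`matII`
or `matIII`) or one class and a vertex without inner neighbours; in the latter case the three
vectors that occur have vanishing Gram determinant, an equation for the class sizes that leaves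
`matV`. -/
theorem join_cases (h : PlanarRep G P Q r s)
    (hcomp : ∀ i j, P i * Q i * (P j * Q j) < 0 → G.Adj i j)
    (hR : ∀ j, P j * Q j < 0 → (innerNbrs G P Q j).card ≠ 0) :
    (∃ a k : ℕ, 1 ≤ a ∧ 2 ≤ k ∧ HasAdjMatrix G (matII a k)) ∨
      (∃ l m : ℕ, m ≤ l ∧ 2 ≤ m ∧ HasAdjMatrix G (matIII l m)) ∨
      (HasAdjMatrix G (matV 6 5) ∨ HasAdjMatrix G (matV 4 6) ∨ HasAdjMatrix G (matV 3 8)) := by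
  set Lt : Finset V := {x | 0 < P x * Q x} with hLt
  set Rt : Finset V := {x | P x * Q x < 0} with hRt
  have hLm : ∀ x, x ∈ Lt ↔ 0 < P x * Q x := fun x => by simp [hLt]
  have hRm : ∀ x, x ∈ Rt ↔ P x * Q x < 0 := fun x => by simp [hRt]
  have hopp : ∀ x ∈ Lt, ∀ y ∈ Rt, P x * Q x * (P y * Q y) < 0 := fun x hx y hy =>
    mul_neg_of_pos_of_neg ((hLm x).1 hx) ((hRm y).1 hy)
  have hadj : ∀ x ∈ Lt, ∀ y ∈ Rt, G.Adj x y := fun x hx y hy => hcomp x y (hopp x hx y hy)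
  have hns : ∀ x ∈ Lt, ∀ y ∈ Rt, ¬ SameVec P Q x y := fun x hx y hy =>
    not_same_of_opp (hopp x hx y hy)
  have hd : Disjoint Lt Rt := by
    rw [Finset.disjoint_left]
    intro x hx hx'
    exact hns x hx x hx' (SameVec.refl x)
  have hu : Lt ∪ Rt = Finset.univ := by
    ext x
    simp only [Finset.mem_union, hLm, hRm, Finset.mem_univ, iff_true]
    exact (lt_or_gt_of_ne (h.side_ne_zero x)).symm
  have hsameL : ∀ x ∈ Lt, ∀ y ∈ Lt, G.Adj x y → SameVec P Q x y := fun x hx y hy e =>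
    h.same_of_adj e (mul_pos ((hLm x).1 hx) ((hLm y).1 hy))
  have hsameR : ∀ x ∈ Rt, ∀ y ∈ Rt, G.Adj x y → SameVec P Q x y := fun x hx y hy e =>
    h.same_of_adj e (mul_pos_of_neg_of_neg ((hRm x).1 hx) ((hRm y).1 hy))
  have hclL : ∀ x ∈ Lt, ∀ y, SameVec P Q x y → y ∈ Lt := fun x hx y e => by
    rw [hLm, ← e.1, ← e.2]; exact (hLm x).1 hx
  have hclR : ∀ x ∈ Rt, ∀ y, SameVec P Q x y → y ∈ Rt := fun x hx y e => by
    rw [hRm, ← e.1, ← e.2]; exact (hRm x).1 hx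
  have hcov : ∀ x, x ∈ Lt ∨ x ∈ Rt := fun x => by
    rw [← Finset.mem_union, hu]; exact Finset.mem_univ x
  obtain ⟨l₀, hl₀, r₀, hr₀⟩ : ∃ l ∈ Lt, ∃ r, r ∈ Rt := by
    obtain ⟨i⟩ := h.conn.nonempty
    obtain ⟨j, hij, hs⟩ := h.exists_adj_not_same i
    rcases hcov i with hi | hi <;> rcases hcov j with hj | hj
    · exact absurd (hsameL i hi j hj hij) hs
    · exact ⟨i, hi, j, hj⟩
    · exact ⟨j, hj, i, hi⟩
    · exact absurd (hsameR i hi j hj hij) hs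
  -- The negative side is one class.
  have hRsame : ∀ x ∈ Rt, ∀ y ∈ Rt, SameVec P Q x y := by
    intro x hx y hy
    by_contra hne
    rcases h.innerNbrs_eq_empty_or hne (fun e => hne (hsameR x hx y hy e))
      (hadj l₀ hl₀ x hx).symm (hadj l₀ hl₀ y hy).symm (fun e => hns l₀ hl₀ x hx e.symm)
      (fun e => hns l₀ hl₀ y hy e.symm) with h0 | h0
    · exact hR x ((hRm x).1 hx) h0
    · exact hR y ((hRm y).1 hy) h0
  have hRshape := h.clique_or_matching hRsame (fun x hx y _ e => hclR x hx y e)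
    (fun x hx => hR x ((hRm x).1 hx))
  -- The vertices of the positive side with inner neighbours form one class, and at most one vertex
  -- has none.
  have hL1same : ∀ x ∈ Lt, ∀ y ∈ Lt, (innerNbrs G P Q x).card ≠ 0 →
      (innerNbrs G P Q y).card ≠ 0 → SameVec P Q x y := by
    intro x hx y hy hx0 hy0
    by_contra hne
    rcases h.innerNbrs_eq_empty_or hne (fun e => hne (hsameL x hx y hy e))
      (hadj x hx r₀ hr₀) (hadj y hy r₀ hr₀) (hns x hx r₀ hr₀)
      (hns y hy r₀ hr₀) with h0 | h0
    · exact hx0 h0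
    · exact hy0 h0
  have hL0N : ∀ x ∈ Lt, (innerNbrs G P Q x).card = 0 → G.neighborFinset x = Rt := by
    intro x hx h0
    ext y
    rw [SimpleGraph.mem_neighborFinset]
    refine ⟨fun e => ?_, fun hy => hadj x hx y hy⟩
    rcases hcov y with hy | hy
    · exact absurd h0 (innerNbrs_card_pos.2 ⟨y, e, hsameL x hx y hy e⟩)
    · exact hy
  have hL0 : ∀ x ∈ Lt, ∀ y ∈ Lt, (innerNbrs G P Q x).card = 0 →
      (innerNbrs G P Q y).card = 0 → x = y := by
    intro x hx y hy hx0 hy0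
    by_contra hne
    exact h.neighborFinset_ne hne ((hL0N x hx hx0).trans (hL0N y hy hy0).symm)
  have hdegL : ∀ x ∈ Lt, G.degree x = (innerNbrs G P Q x).card + Rt.card := by
    intro x hx
    refine degree_eq_add P Q Rt fun y => ⟨fun hy => ⟨hadj x hx y hy, hns x hx y hy⟩, fun e => ?_⟩
    rcases hcov y with hy | hy
    · exact absurd (hsameL x hx y hy e.1) e.2
    · exact hy
  have hdegR : ∀ x ∈ Rt, G.degree x = (innerNbrs G P Q x).card + Lt.card := by
    intro x hx
    refine degree_eq_add P Q Lt fun y => ⟨fun hy => ⟨(hadj y hy x hx).symm,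
      fun e => hns y hy x hx e.symm⟩, fun e => ?_⟩
    rcases hcov y with hy | hy
    · exact hy
    · exact absurd (hsameR x hx y hy e.1) e.2
  -- The cases in which the positive side is complete or a matching.
  have hhom : ((∀ x ∈ Lt, ∀ y ∈ Lt, x ≠ y → G.Adj x y) ∨
      ((∀ x ∈ Lt, (innerNbrs G P Q x).card = 1) ∧ (∀ x ∈ Lt, ∃! y, y ∈ Lt ∧ G.Adj x y) ∧
        3 ≤ Lt.card)) → (∃ a k : ℕ, 1 ≤ a ∧ 2 ≤ k ∧ HasAdjMatrix G (matII a k)) ∨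
      (∃ l m : ℕ, m ≤ l ∧ 2 ≤ m ∧ HasAdjMatrix G (matIII l m)) := by
    rintro (hLc | ⟨-, hLm', hLcard⟩) <;> rcases hRshape with hRc | ⟨-, hRm', hRcard⟩
    · exfalso
      obtain ⟨x, y, hxy, hn⟩ := h.not_complete
      rcases hcov x with hx | hx <;> rcases hcov y with hy | hy
      · exact hn (hLc x hx y hy hxy)
      · exact hn (hadj x hx y hy)
      · exact hn (hadj y hy x hx).symm
      · exact hn (hRc x hx y hy hxy)
    · left
      obtain ⟨k, hk, hm⟩ := hasAdjMatrix_matII hd hu hadj hLc hRm'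
      exact ⟨_, k, Finset.card_pos.2 ⟨l₀, hl₀⟩, by omega, hm⟩
    · left
      obtain ⟨k, hk, hm⟩ := hasAdjMatrix_matII hd.symm (by rw [Finset.union_comm, hu])
        (fun x hx y hy => (hadj y hy x hx).symm) hRc hLm'
      exact ⟨_, k, Finset.card_pos.2 ⟨r₀, hr₀⟩, by omega, hm⟩
    · right
      obtain ⟨l, m, hl, hm, hlm⟩ := hasAdjMatrix_matIII hd hu hadj hLm' hRm'
      rcases le_total m l with hle | hle
      · exact ⟨l, m, hle, by omega, hlm⟩
      · obtain ⟨l', m', hl', hm', hlm'⟩ := hasAdjMatrix_matIII hd.symm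
          (by rw [Finset.union_comm, hu]) (fun x hx y hy => (hadj y hy x hx).symm) hRm' hLm'
        exact ⟨l', m', by omega, by omega, hlm'⟩
  by_cases hz : ∃ u ∈ Lt, (innerNbrs G P Q u).card = 0
  swap
  · push Not at hz
    rcases hhom (h.clique_or_matching (fun x hx y hy => hL1same x hx y hy (hz x hx) (hz y hy))
      (fun x hx y _ e => hclL x hx y e) hz) with h' | h'
    · exact Or.inl h'
    · exact Or.inr (Or.inl h')
  obtain ⟨u, hu', hu0⟩ := hz
  by_cases hnz : ∃ w ∈ Lt, (innerNbrs G P Q w).card ≠ 0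
  swap
  · push Not at hnz
    rcases hhom (Or.inl fun x hx y hy hxy =>
      absurd (hL0 x hx y hy (hnz x hx) (hnz y hy)) hxy) with h' | h'
    · exact Or.inl h'
    · exact Or.inr (Or.inl h')
  right; right
  obtain ⟨w, hw, hw0⟩ := hnz
  set T := Lt.erase u with hT
  have hTpos : ∀ x ∈ T, (innerNbrs G P Q x).card ≠ 0 := fun x hx h0 =>
    Finset.ne_of_mem_erase hx (hL0 x (Finset.mem_of_mem_erase hx) u hu' h0 hu0)
  have hTL : ∀ x ∈ T, x ∈ Lt := fun x hx => Finset.mem_of_mem_erase hx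
  have huinner : ∀ x ∈ T, ¬ G.Adj x u := fun x hx e =>
    innerNbrs_card_pos.2 ⟨x, e.symm, hsameL u hu' x (hTL x hx) e.symm⟩ hu0
  have huw : ¬ SameVec P Q u w := by
    intro e
    have h1 := hdegL u hu'
    have h2 := hdegL w hw
    have d1 := h.deg u
    have d2 := h.deg w
    rw [e.1, e.2, ← d2, Nat.cast_inj] at d1
    omega
  have hwT : w ∈ T := Finset.mem_erase.2 ⟨fun e => hw0 (e ▸ hu0), hw⟩
  have hTsame : ∀ x ∈ T, ∀ y ∈ T, SameVec P Q x y := fun x hx y hy =>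
    hL1same x (hTL x hx) y (hTL y hy) (hTpos x hx) (hTpos y hy)
  have hTcl : ∀ x ∈ T, ∀ y, G.Adj x y → SameVec P Q x y → y ∈ T := fun x hx y e e' =>
    Finset.mem_erase.2 ⟨fun hyu => huinner x hx (hyu ▸ e), hclL x (hTL x hx) y e'⟩
  have hTcard : T.card + 1 = Lt.card := Finset.card_erase_add_one hu'
  -- The Gram matrix of `u`, `w`, `r₀` in terms of the sizes of the classes.
  have hcuw : (Rt.card : ℝ) = P u * P w + Q u * Q w := by
    rw [← h.codeg u w (fun e => huw (e ▸ SameVec.refl u)), hL0N u hu' hu0,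
      Finset.inter_eq_left.2 fun y hy => by simpa using hadj w hw y hy]
  have hur := h.gram_of_adj (hadj u hu' r₀ hr₀) (hns u hu' r₀ hr₀)
  have hwr := h.gram_of_adj (hadj w hw r₀ hr₀) (hns w hw r₀ hr₀)
  have hdu := h.deg u
  have hdw := h.deg w
  have hdr := h.deg r₀
  rw [hdegL u hu', hu0] at hdu
  rw [hdegL w hw] at hdw
  rw [hdegR r₀ hr₀, ← hTcard] at hdr
  rw [hu0] at hur
  push_cast at hdu hdw hdr hur hwr
  have hdet : ∀ a b c d e f : ℝ, a = P u * P u + Q u * Q u → b = P w * P w + Q w * Q w →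
      c = P r₀ * P r₀ + Q r₀ * Q r₀ → d = P u * P w + Q u * Q w →
      e = P u * P r₀ + Q u * Q r₀ → f = P w * P r₀ + Q w * Q r₀ →
      a * b * c + 2 * d * e * f - a * f ^ 2 - b * e ^ 2 - c * d ^ 2 = 0 := by
    rintro a b c d e f rfl rfl rfl rfl rfl rfl; ring
  have hD := hdet (Rt.card - 1) ((innerNbrs G P Q w).card + Rt.card - 1)
    ((innerNbrs G P Q r₀).card + T.card) Rt.card (innerNbrs G P Q r₀).card
    ((innerNbrs G P Q w).card + (innerNbrs G P Q r₀).card)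
    (by linarith) (by linarith) (by linarith) (by linarith) (by linarith) (by linarith)
  have hT2 : (∀ x ∈ T, ∀ y ∈ T, x ≠ y → G.Adj x y) ∧ (innerNbrs G P Q w).card + 1 = T.card := by
    rcases h.clique_or_matching hTsame hTcl hTpos with hc | ⟨hone, -, -⟩
    · refine ⟨hc, ?_⟩
      rw [← Finset.card_erase_add_one hwT]
      congr 2
      ext x
      rw [mem_innerNbrs, Finset.mem_erase]
      exact ⟨fun e => ⟨e.1.ne', hTcl w hwT x e.1 e.2⟩,
        fun e => ⟨hc w hwT x e.2 e.1.symm, hTsame w hwT x e.2⟩⟩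
    · exfalso
      have h1 := hone w hwT
      rw [h1] at hdw
      push_cast at hdw
      have e1 : (P u * P w + Q u * Q w) ^ 2
          ≤ (P u * P u + Q u * Q u) * (P w * P w + Q w * Q w) := by
        nlinarith [sq_nonneg (P u * Q w - P w * Q u)]
      rw [← hcuw, show P u * P u + Q u * Q u = Rt.card - 1 by linarith,
        show P w * P w + Q w * Q w = Rt.card by linarith] at e1
      have : (0 : ℝ) < Rt.card := by exact_mod_cast Finset.card_pos.2 ⟨r₀, hr₀⟩
      nlinarith
  obtain ⟨hTc, hTe⟩ := hT2
  have hTe' : ((innerNbrs G P Q w).card : ℝ) = T.card - 1 := by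
    rw [← hTe]; push_cast; ring
  rw [hTe'] at hD
  have hRpos : (0 : ℝ) < Rt.card := by exact_mod_cast Finset.card_pos.2 ⟨r₀, hr₀⟩
  rcases hRshape with hRc | ⟨hone, -, hR3⟩
  · have hRe : (innerNbrs G P Q r₀).card + 1 = Rt.card := by
      rw [← Finset.card_erase_add_one hr₀]
      congr 2
      ext x
      rw [mem_innerNbrs, Finset.mem_erase]
      exact ⟨fun e => ⟨e.1.ne', hclR r₀ hr₀ x e.2⟩,
        fun e => ⟨hRc r₀ hr₀ x e.2 e.1.symm, hRsame r₀ hr₀ x e.2⟩⟩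
    have hRe' : ((innerNbrs G P Q r₀).card : ℝ) = Rt.card - 1 := by
      rw [← hRe]; push_cast; ring
    rw [hRe'] at hD
    -- In factored form: `(|R| - 2) (|T| - 4) = 4`.
    have hD' : (Rt.card : ℝ) * T.card + 4 = 4 * Rt.card + 2 * T.card := by
      linear_combination hD
    have hN : Rt.card * T.card + 4 = 4 * Rt.card + 2 * T.card := by exact_mod_cast hD'
    have hV := hasAdjMatrix_matV (G := G) (S := Rt) (T := T) (u := u)
      (hd.symm.mono_right (Finset.erase_subset _ _)) (fun e => Finset.disjoint_left.1 hd hu' e)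
      (Finset.notMem_erase u Lt)
      (fun x => by
        rcases hcov x with hx | hx
        · by_cases hxu : x = u
          · exact Or.inr (Or.inr hxu)
          · exact Or.inr (Or.inl (Finset.mem_erase.2 ⟨hxu, hx⟩))
        · exact Or.inl hx)
      (fun x hx y hy => (hadj y (hTL y hy) x hx).symm) hRc hTc
      (fun x hx => (hadj u hu' x hx).symm) huinner
    have hcase : (Rt.card = 6 ∧ T.card = 5) ∨ (Rt.card = 4 ∧ T.card = 6) ∨
        (Rt.card = 3 ∧ T.card = 8) := by
      have hb : 5 ≤ T.card := by
        by_contra hlt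
        have : T.card ≤ 4 := by omega
        interval_cases T.card <;> omega
      have hb' : T.card ≤ 8 := by
        by_contra hlt
        have h9 : 9 ≤ T.card := by omega
        have : Rt.card < 3 := by
          by_contra h3
          have h3 : 3 ≤ Rt.card := by omega
          obtain ⟨x, hx⟩ := Nat.exists_eq_add_of_le h9
          obtain ⟨y, hy⟩ := Nat.exists_eq_add_of_le h3
          rw [hx, hy] at hN
          nlinarith
        interval_cases Rt.card <;> omega
      interval_cases T.card <;> omega
    rcases hcase with ⟨h1, h2⟩ | ⟨h1, h2⟩ | ⟨h1, h2⟩ <;> rw [h1, h2] at hV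
    · exact Or.inl hV
    · exact Or.inr (Or.inl hV)
    · exact Or.inr (Or.inr hV)
  · exfalso
    rw [hone r₀ hr₀] at hD
    push_cast at hD
    have h4 : (4 : ℝ) * Rt.card = 4 := by linear_combination -hD
    have h5 : 4 * Rt.card = 4 := by exact_mod_cast h4
    omega

end PlanarRep
end

/-! ### Relations whose rows and columns differ by swaps -/

section DoubleCount
variable {α β : Type*} [DecidableEq α] [DecidableEq β]

/-- Count the pairs `(x', y)` with `x' ∈ S` and `y` in the row of `x` and in the row of `x'`: all
columns have size `t'`, and every row other than that of `x` shares `t - 1` elements with it. Stated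
without subtraction. -/
theorem card_mul_of_swap {S : Finset α} {T : Finset β} {rel : α → β → Prop}
    [∀ a b, Decidable (rel a b)] {t t' : ℕ}
    {x : α} (hx : x ∈ S) (hrow : ∀ x ∈ S, (T.filter (rel x)).card = t)
    (hcol : ∀ y ∈ T, (S.filter (fun x => rel x y)).card = t')
    (hswap : ∀ x' ∈ S, x ≠ x' → (T.filter (rel x) \ T.filter (rel x')).card = 1) :
    t * t' + S.card = S.card * t + 1 := by
  have h1 : ∑ x' ∈ S, (T.filter (rel x) ∩ T.filter (rel x')).card = t * t' := by
    have h2 := Finset.sum_card_bipartiteAbove_eq_sum_card_bipartiteBelow (s := S)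
      (t := T.filter (rel x)) rel
    have h3 : ∀ y ∈ T.filter (rel x), (S.bipartiteBelow rel y).card = t' :=
      fun y hy => hcol y (Finset.mem_filter.1 hy).1
    rw [Finset.sum_congr rfl h3, Finset.sum_const, hrow x hx, smul_eq_mul] at h2
    rw [← h2]
    refine Finset.sum_congr rfl fun x' _ => ?_
    congr 1
    ext y
    simp only [Finset.mem_inter, Finset.mem_filter, Finset.mem_bipartiteAbove]
    tauto
  have h4 : ∑ x' ∈ S, (T.filter (rel x) \ T.filter (rel x')).card + 1 = S.card := by
    rw [← Finset.add_sum_erase S _ hx, Finset.sdiff_self, Finset.card_empty, zero_add,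
      Finset.sum_congr rfl (fun x' hx' => hswap x' (Finset.mem_of_mem_erase hx')
        (Finset.ne_of_mem_erase hx').symm), Finset.sum_const, smul_eq_mul, mul_one,
      Finset.card_erase_add_one hx]
  have h5 : ∑ x' ∈ S, (T.filter (rel x) ∩ T.filter (rel x')).card
      + ∑ x' ∈ S, (T.filter (rel x) \ T.filter (rel x')).card = S.card * t := by
    rw [← Finset.sum_add_distrib]
    simp only [Finset.card_inter_add_card_sdiff]
    rw [hrow x hx, Finset.sum_const, smul_eq_mul]
  omega

theorem card_eq_of_swap {S : Finset α} {f : α → Finset β}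
    (h : ∀ x ∈ S, ∀ y ∈ S, x ≠ y → (f x \ f y).card = 1) {x y : α} (hx : x ∈ S) (hy : y ∈ S) :
    (f x).card = (f y).card := by
  by_cases e : x = y
  · rw [e]
  · have h1 := h x hx y hy e
    have h2 := h y hy x hx (Ne.symm e)
    have h3 := Finset.card_inter_add_card_sdiff (f x) (f y)
    have h4 := Finset.card_inter_add_card_sdiff (f y) (f x)
    rw [Finset.inter_comm] at h4
    omega

/-- If any two rows of a relation between `S` and `T` differ by a swap, any two columns differ by a
swap, and some row has at least two elements, then the relation is the complement of a perfect
matching. -/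
theorem coMatching_of_swap {S : Finset α} {T : Finset β} {rel : α → β → Prop}
    [∀ a b, Decidable (rel a b)]
    (hS : ∀ x ∈ S, ∀ x' ∈ S, x ≠ x' → (T.filter (rel x) \ T.filter (rel x')).card = 1)
    (hT : ∀ y ∈ T, ∀ y' ∈ T, y ≠ y' →
      (S.filter (fun x => rel x y) \ S.filter (fun x => rel x y')).card = 1)
    {x₀ : α} (hx₀ : x₀ ∈ S) (h2 : 2 ≤ (T.filter (rel x₀)).card) :
    S.card = T.card ∧ (T.filter (rel x₀)).card + 1 = T.card ∧
      (∀ x ∈ S, ∃! y, y ∈ T ∧ ¬ rel x y) ∧ (∀ y ∈ T, ∃! x, x ∈ S ∧ ¬ rel x y) := by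
  set t := (T.filter (rel x₀)).card with ht
  obtain ⟨y₀, hy₀⟩ := Finset.card_pos.1 (show 0 < (T.filter (rel x₀)).card by omega)
  have hy₀ : y₀ ∈ T := (Finset.mem_filter.1 hy₀).1
  set t' := (S.filter (fun x => rel x y₀)).card with ht'
  have hrow : ∀ x ∈ S, (T.filter (rel x)).card = t := fun x hx =>
    card_eq_of_swap (f := fun x => T.filter (rel x)) hS hx hx₀
  have hcol : ∀ y ∈ T, (S.filter (fun x => rel x y)).card = t' := fun y hy =>
    card_eq_of_swap (f := fun y => S.filter (fun x => rel x y)) hT hy hy₀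
  have e1 := card_mul_of_swap hx₀ hrow hcol (hS x₀ hx₀)
  have e2 := card_mul_of_swap (rel := fun y x => rel x y) hy₀ hcol hrow (hT y₀ hy₀)
  have e3 : S.card * t = T.card * t' := by
    have := Finset.sum_card_bipartiteAbove_eq_sum_card_bipartiteBelow (s := S) (t := T) rel
    have a1 : ∀ x ∈ S, (T.bipartiteAbove rel x).card = t := hrow
    have a2 : ∀ y ∈ T, (S.bipartiteBelow rel y).card = t' := hcol
    rwa [Finset.sum_congr rfl a1, Finset.sum_congr rfl a2, Finset.sum_const, Finset.sum_const,
      smul_eq_mul, smul_eq_mul] at this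
  have hST : S.card = T.card := by
    rw [mul_comm t' t] at e2
    omega
  have hpos : 0 < T.card := Finset.card_pos.2 ⟨y₀, hy₀⟩
  have htt : t = t' := by
    rw [hST] at e3
    exact Nat.eq_of_mul_eq_mul_left hpos e3
  have hn : t + 1 = T.card := by
    rw [← htt, hST] at e1
    obtain ⟨u, hu⟩ := Nat.exists_eq_add_of_le h2
    rw [hu] at e1 ⊢
    have : (u + 1) * T.card = (u + 1) * (2 + u + 1) := by nlinarith
    exact (Nat.eq_of_mul_eq_mul_left (Nat.succ_pos u) this).symm
  refine ⟨hST, hn, fun x hx => ?_, fun y hy => ?_⟩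
  · have h3 := Finset.card_filter_add_card_filter_not (s := T) (rel x)
    rw [hrow x hx] at h3
    obtain ⟨y, hy⟩ := Finset.card_eq_one.1 (show (T.filter (fun y => ¬ rel x y)).card = 1 by omega)
    refine ⟨y, ?_, fun z hz => ?_⟩
    · simpa using (hy ▸ Finset.mem_singleton_self y : y ∈ T.filter (fun y => ¬ rel x y))
    · have : z ∈ T.filter (fun y => ¬ rel x y) := by simpa using hz
      simpa [hy] using this
  · have h3 := Finset.card_filter_add_card_filter_not (s := S) (fun x => rel x y)
    rw [hcol y hy] at h3
    obtain ⟨x, hx⟩ := Finset.card_eq_one.1 (show (S.filter (fun x => ¬ rel x y)).card = 1 by omega)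
    refine ⟨x, ?_, fun z hz => ?_⟩
    · simpa using (hx ▸ Finset.mem_singleton_self x : x ∈ S.filter (fun x => ¬ rel x y))
    · have : z ∈ S.filter (fun x => ¬ rel x y) := by simpa using hz
      simpa [hx] using this
end DoubleCount

/-! ### Orthogonal vectors on opposite sides -/

section
variable {V : Type*} [Fintype V] [DecidableEq V] {G : SimpleGraph V} [DecidableRel G.Adj]
namespace PlanarRep
variable {P Q : V → ℝ} {r s : ℝ}

theorem gram_nonneg (h : PlanarRep G P Q r s) (i j : V) : 0 ≤ P i * P j + Q i * Q j := by
  by_cases e : i = j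
  · subst e; nlinarith [mul_self_nonneg (P i), mul_self_nonneg (Q i)]
  · rw [← h.codeg i j e]; positivity

theorem one_le_gram_self (h : PlanarRep G P Q r s) (i : V) : 1 ≤ P i * P i + Q i * Q i := by
  have h1 := h.deg i
  have h2 : (2 : ℝ) ≤ G.degree i := by exact_mod_cast h.two_le_degree i
  linarith

theorem exists_opp_adj (h : PlanarRep G P Q r s) (i : V) :
    ∃ j, G.Adj i j ∧ P i * Q i * (P j * Q j) < 0 := by
  obtain ⟨j, hj, hs⟩ := h.exists_adj_not_same i
  exact ⟨j, hj, h.side_mul_side_neg hj hs⟩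

omit [Fintype V] [DecidableEq V] in
/-- Expansion of `⟪v i, v j⟫` in the orthogonal basis `v l`, `v c`, with denominators cleared. -/
theorem gram_expand {l c : V} (ho : P l * P c + Q l * Q c = 0) (i j : V) :
    (P l * P l + Q l * Q l) * (P c * P c + Q c * Q c) * (P i * P j + Q i * Q j)
      = (P c * P c + Q c * Q c) * ((P l * P i + Q l * Q i) * (P l * P j + Q l * Q j))
        + (P l * P l + Q l * Q l) * ((P c * P i + Q c * Q i) * (P c * P j + Q c * Q j)) := by
  linear_combination ((P l * P c + Q l * Q c) * (P i * P j + Q i * Q j)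
    - (P c * P i + Q c * Q i) * (P l * P j + Q l * Q j)
    - (P l * P i + Q l * Q i) * (P c * P j + Q c * Q j)) * ho

/-- All edges from the positive to the negative side have the orientation of the pair `(v l, v c)`.
By Lagrange's identity, `⟪v l, v i⟫ ⟪v c, v j⟫ - ⟪v l, v j⟫ ⟪v c, v i⟫` is the product of the two
cross products, hence positive. -/
theorem orth_sign (h : PlanarRep G P Q r s) {l c : V} (hl : 0 < P l * Q l)
    (ho : P l * P c + Q l * Q c = 0) {i j : V} (hi : 0 < P i * Q i) (hj : P j * Q j < 0)
    (hij : G.Adj i j) : 0 < P l * P i + Q l * Q i ∧ 0 < P c * P j + Q c * Q j := by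
  have hneg : ∀ i j, 0 < P i * Q i → P j * Q j < 0 → G.Adj i j → P i * Q j - P j * Q i < 0 := by
    intro i j hi hj hij
    have := h.cross_mul_side_neg hij (not_same_of_opp (mul_neg_of_pos_of_neg hi hj))
    by_contra hge
    push Not at hge
    nlinarith [mul_nonneg hge hi.le]
  have hD : P l * Q c - P c * Q l < 0 := by
    obtain ⟨u, hu, hs⟩ := h.exists_opp_adj l
    have hu' : P u * Q u < 0 := by
      by_contra hge
      push Not at hge
      nlinarith [mul_nonneg hl.le hge]
    have h1 := hneg l u hl hu' hu
    have h2 := h.gram_nonneg c u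
    have h3 := h.one_le_gram_self l
    have h4 := h.one_le_gram_self c
    have h5 : (P l * Q c - P c * Q l) * (P l * Q u - P u * Q l)
        = (P l * P l + Q l * Q l) * (P c * P u + Q c * Q u) := by
      linear_combination -(P l * P u + Q l * Q u) * ho
    have h6 : (P l * Q c - P c * Q l) ^ 2
        = (P l * P l + Q l * Q l) * (P c * P c + Q c * Q c) := by
      linear_combination -(P l * P c + Q l * Q c) * ho
    have h7 : (P l * Q c - P c * Q l) ^ 2 ≠ 0 := by rw [h6]; positivity
    have h8 : P l * Q c - P c * Q l ≠ 0 := fun e => h7 (by rw [e]; ring)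
    refine lt_of_le_of_ne ?_ h8
    by_contra hge
    push Not at hge
    have h9 := mul_neg_of_pos_of_neg hge h1
    rw [h5] at h9
    nlinarith [mul_nonneg (zero_le_one.trans h3) h2]
  have h1 := mul_pos_of_neg_of_neg hD (hneg i j hi hj hij)
  have h2 : (P l * Q c - P c * Q l) * (P i * Q j - P j * Q i)
      = (P l * P i + Q l * Q i) * (P c * P j + Q c * Q j)
        - (P l * P j + Q l * Q j) * (P c * P i + Q c * Q i) := by ring
  rw [h2] at h1
  have h3 := mul_nonneg (h.gram_nonneg l j) (h.gram_nonneg c i)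
  have h4 := h.gram_nonneg l i
  have h5 := h.gram_nonneg c j
  constructor
  · refine lt_of_le_of_ne h4 fun e => ?_
    rw [← e] at h1; linarith
  · refine lt_of_le_of_ne h5 fun e => ?_
    rw [← e] at h1; linarith

theorem orth_pos_right (h : PlanarRep G P Q r s) {l c : V} (hl : 0 < P l * Q l)
    (ho : P l * P c + Q l * Q c = 0) {j : V} (hj : P j * Q j < 0) :
    0 < P c * P j + Q c * Q j := by
  obtain ⟨i, hi, hs⟩ := h.exists_opp_adj j
  exact (h.orth_sign hl ho (by
    by_contra hge; push Not at hge
    nlinarith [mul_nonneg_of_nonpos_of_nonpos hj.le hge]) hj hi.symm).2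

/-- Let `v l ⟂ v c` be on opposite sides. A vertex `j` on the side of `l` with `⟪v c, v j⟫ ≠ 0`,
that is, whose vector lies off the axis of `v l`, is adjacent to the whole other side. -/
theorem adj_of_interior (h : PlanarRep G P Q r s) {l c : V} (hl : 0 < P l * Q l)
    (ho : P l * P c + Q l * Q c = 0) {j : V} (hj : 0 < P j * Q j)
    (hY : P c * P j + Q c * Q j ≠ 0) {x : V} (hx : P x * Q x < 0) : G.Adj j x := by
  by_contra hn
  have h0 := h.gram_of_not_adj hn (mul_neg_of_pos_of_neg hj hx)
  have e := gram_expand ho j x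
  rw [h0, mul_zero] at e
  have h1 := h.orth_pos_right hl ho hx
  have h2 := h.gram_nonneg l j
  have h3 := h.gram_nonneg l x
  have h4 := h.one_le_gram_self l
  have h5 := h.one_le_gram_self c
  have h6 : 0 < P c * P j + Q c * Q j := lt_of_le_of_ne (h.gram_nonneg c j) hY.symm
  have : 0 < (P l * P l + Q l * Q l) * ((P c * P j + Q c * Q j) * (P c * P x + Q c * Q x)) := by
    positivity
  have : 0 ≤ (P c * P c + Q c * Q c) * ((P l * P j + Q l * Q j) * (P l * P x + Q l * Q x)) := by
    positivity
  linarith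

/-- A vertex `j` off the axis has inner neighbours: otherwise all vertices of the other side would
have some, among them `c` and a neighbour of `l`, against `innerNbrs_eq_empty_or`. -/
theorem innerNbrs_ne_zero_of_interior (h : PlanarRep G P Q r s) {l c : V} (hl : 0 < P l * Q l)
    (hc : P c * Q c < 0) (ho : P l * P c + Q l * Q c = 0) {j : V} (hj : 0 < P j * Q j)
    (hY : P c * P j + Q c * Q j ≠ 0) : (innerNbrs G P Q j).card ≠ 0 := by
  intro h0
  have hpos : ∀ x, P x * Q x < 0 → (innerNbrs G P Q x).card ≠ 0 := by
    intro x hx hx0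
    have hjx := h.adj_of_interior hl ho hj hY hx
    have e := h.gram_of_adj hjx (not_same_of_opp (mul_neg_of_pos_of_neg hj hx))
    have e2 := gram_expand ho j x
    rw [e, h0, hx0] at e2
    have h1 := h.orth_pos_right hl ho hx
    have h2 := h.gram_nonneg l j
    have h3 := h.gram_nonneg l x
    have h4 := h.one_le_gram_self l
    have h5 := h.one_le_gram_self c
    have h6 : 0 < P c * P j + Q c * Q j := lt_of_le_of_ne (h.gram_nonneg c j) hY.symm
    have : 0 < (P l * P l + Q l * Q l) * ((P c * P j + Q c * Q j) * (P c * P x + Q c * Q x)) := by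
      positivity
    have : 0 ≤ (P c * P c + Q c * Q c) * ((P l * P j + Q l * Q j) * (P l * P x + Q l * Q x)) := by
      positivity
    simp only [Nat.cast_zero, add_zero, mul_zero] at e2
    linarith
  obtain ⟨x, hlx, hs⟩ := h.exists_opp_adj l
  have hx : P x * Q x < 0 := by
    by_contra hge; push Not at hge; nlinarith [mul_nonneg hl.le hge]
  have e := h.gram_of_adj hlx (not_same_of_opp hs)
  have hcx : ¬ SameVec P Q c x := by
    intro e'
    rw [← e'.1, ← e'.2, ho] at e
    have : (innerNbrs G P Q l).card + (innerNbrs G P Q x).card = 0 := by exact_mod_cast e.symm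
    exact hpos x hx (by omega)
  rcases h.innerNbrs_eq_empty_or (k := j) hcx
    (fun e' => hcx (h.same_of_adj e' (mul_pos_of_neg_of_neg hc hx)))
    (h.adj_of_interior hl ho hj hY hc).symm (h.adj_of_interior hl ho hj hY hx).symm
    (fun e' => not_same_of_opp (mul_neg_of_pos_of_neg hj hc) e'.symm)
    (fun e' => not_same_of_opp (mul_neg_of_pos_of_neg hj hx) e'.symm) with h1 | h1
  · exact hpos c hc h1
  · exact hpos x hx h1

/-- If `j` lies off the axis of `v l`, then all vertices on the side of `l` outside the class of `j`
have the vector of `l` and no inner neighbours. -/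
theorem of_interior (h : PlanarRep G P Q r s) {l c : V} (hl : 0 < P l * Q l)
    (hc : P c * Q c < 0) (ho : P l * P c + Q l * Q c = 0) {j : V} (hj : 0 < P j * Q j)
    (hY : P c * P j + Q c * Q j ≠ 0) :
    P l * P j + Q l * Q j = P l * P l + Q l * Q l + 1 ∧
      ∀ i, 0 < P i * Q i → ¬ SameVec P Q j i →
        (innerNbrs G P Q i).card = 0 ∧ SameVec P Q l i := by
  have hadj : ∀ x, P x * Q x < 0 → G.Adj j x := fun x hx => h.adj_of_interior hl ho hj hY hx
  have hj0 := h.innerNbrs_ne_zero_of_interior hl hc ho hj hY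
  have hempty : ∀ i, 0 < P i * Q i → ¬ SameVec P Q j i → (innerNbrs G P Q i).card = 0 := by
    intro i hi hji
    obtain ⟨x, hix, hs⟩ := h.exists_opp_adj i
    have hx : P x * Q x < 0 := by
      by_contra hge; push Not at hge; nlinarith [mul_nonneg hi.le hge]
    rcases h.innerNbrs_eq_empty_or (k := x) hji
      (fun e => hji (h.same_of_adj e (mul_pos hj hi))) (hadj x hx) hix
      (not_same_of_opp (mul_neg_of_pos_of_neg hj hx)) (not_same_of_opp hs) with h1 | h1
    · exact absurd h1 hj0
    · exact h1
  have hY0 : ∀ i, 0 < P i * Q i → ¬ SameVec P Q j i → P c * P i + Q c * Q i = 0 := by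
    intro i hi hji
    by_contra hne
    exact h.innerNbrs_ne_zero_of_interior hl hc ho hi hne (hempty i hi hji)
  have hgram : ∀ i, 0 < P i * Q i → ¬ SameVec P Q j i →
      P j * P i + Q j * Q i = P i * P i + Q i * Q i + 1 := by
    intro i hi hji
    rw [← h.deg i, ← h.codeg j i (fun e => hji (e ▸ SameVec.refl j)),
      ← SimpleGraph.card_neighborFinset_eq_degree, Finset.inter_eq_right.2]
    intro x hx
    rw [SimpleGraph.mem_neighborFinset] at hx ⊢
    refine hadj x ?_
    by_contra hge
    have hx' : 0 < P x * Q x := lt_of_le_of_ne (not_lt.1 hge) (h.side_ne_zero x).symm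
    exact innerNbrs_card_pos.2 ⟨x, hx, h.same_of_adj hx (mul_pos hi hx')⟩ (hempty i hi hji)
  have h4 := h.one_le_gram_self l
  have h5 := h.one_le_gram_self c
  have hb0 : P c * P c + Q c * Q c ≠ 0 := by positivity
  have ha0 : P l * P l + Q l * Q l ≠ 0 := by positivity
  have ho' : P c * P l + Q c * Q l = 0 := by linarith
  have hjl : ¬ SameVec P Q j l := fun e => hY (by rw [e.1, e.2]; exact ho')
  have hXj : P l * P j + Q l * Q j = P l * P l + Q l * Q l + 1 := by
    have := hgram l hl hjl; linarith
  refine ⟨hXj, fun i hi hji => ⟨hempty i hi hji, ?_⟩⟩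
  have e1 := gram_expand ho j i
  have e2 := gram_expand ho i i
  rw [hY0 i hi hji, mul_zero, mul_zero, add_zero] at e1 e2
  rw [hgram i hi hji, hXj] at e1
  set a := P l * P l + Q l * Q l
  set b := P c * P c + Q c * Q c
  set X := P l * P i + Q l * Q i with hX
  set B := P i * P i + Q i * Q i
  have e2' : a * B = X * X := mul_left_cancel₀ hb0 (by linear_combination e2)
  have e1' : a * (B + 1) = (a + 1) * X := mul_left_cancel₀ hb0 (by linear_combination e1)
  have e3 : (X - 1) * (X - a) = 0 := by linear_combination e1' - e2'
  have hB := h.one_le_gram_self i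
  have hXa : X = a := by
    rcases mul_eq_zero.1 e3 with h1 | h1
    · have h2 : X = 1 := by linarith
      rw [h2] at e2' ⊢
      nlinarith
    · linarith
  have hBa : B = a := by
    rw [hXa] at e2'; exact mul_left_cancel₀ ha0 e2'
  exact SameVec.of_dist (by
    show a + B = 2 * X
    rw [hBa, hXa]; ring)

/-- It is impossible that both sides have vertices off their axes: for such `j` and `k`, adjacent to
each other, the expansion of `⟪v j, v k⟫` contradicts `gram_of_adj`. -/
theorem not_both_interior (h : PlanarRep G P Q r s) {l c : V} (hl : 0 < P l * Q l)
    (hc : P c * Q c < 0) (ho : P l * P c + Q l * Q c = 0) {j : V} (hj : 0 < P j * Q j)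
    (hY : P c * P j + Q c * Q j ≠ 0) {k : V} (hk : P k * Q k < 0) :
    P l * P k + Q l * Q k = 0 := by
  by_contra hX
  have hn := h.neg
  have A := h.of_interior hl hc ho hj hY
  have B := hn.of_interior (l := c) (c := l) (j := k) (by linarith) (by linarith) (by linarith)
    (by linarith) (by intro e; exact hX (by linear_combination e))
  have hjk := h.adj_of_interior hl ho hj hY hk
  have hjc := h.adj_of_interior hl ho hj hY hc
  have hkl := (hn.adj_of_interior (l := c) (c := l) (j := k) (x := l) (by linarith)
    (by linarith) (by linarith) (by intro e; exact hX (by linear_combination e))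
    (by linarith)).symm
  have ho' : P c * P l + Q c * Q l = 0 := by linarith
  have el : (innerNbrs G P Q l).card = 0 :=
    (A.2 l hl fun e => hY (by rw [e.1, e.2]; exact ho')).1
  have ec : (innerNbrs G P Q c).card = 0 := by
    have := (B.2 c (by linarith) fun e => hX (by
      have e' := SameVec.neg_iff.1 e
      rw [e'.1, e'.2]; exact ho)).1
    rwa [innerNbrs_neg] at this
  have ej := h.innerNbrs_ne_zero_of_interior hl hc ho hj hY
  have g1 := h.gram_of_adj hjk (not_same_of_opp (mul_neg_of_pos_of_neg hj hk))
  have g2 := h.gram_of_adj hjc (not_same_of_opp (mul_neg_of_pos_of_neg hj hc))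
  have g3 := h.gram_of_adj hkl (not_same_of_opp (mul_neg_of_pos_of_neg hl hk))
  rw [ec] at g2
  rw [el] at g3
  have e := gram_expand ho j k
  have B1 := B.1
  have h4 := h.one_le_gram_self l
  have h5 := h.one_le_gram_self c
  push_cast at g2 g3
  have g2' : P c * P j + Q c * Q j = (innerNbrs G P Q j).card := by linarith
  have B1' : P c * P k + Q c * Q k = P c * P c + Q c * Q c + 1 := by linarith
  rw [g1, g3, A.1, g2', B1'] at e
  have ej' : (0 : ℝ) < (innerNbrs G P Q j).card := by exact_mod_cast Nat.pos_of_ne_zero ej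
  have ek' : (0 : ℝ) ≤ (innerNbrs G P Q k).card := by positivity
  have p1 : 0 ≤ (P c * P c + Q c * Q c) * ((innerNbrs G P Q k).card : ℝ) := by positivity
  have p2 : 0 < (P l * P l + Q l * Q l) * ((innerNbrs G P Q j).card : ℝ) := by positivity
  nlinarith

end PlanarRep
end

/-! ### The case of a vector off the axes -/

section
variable {V : Type*} [Fintype V] [DecidableEq V] {G : SimpleGraph V} [DecidableRel G.Adj]

theorem hasAdjMatrix_matVI {S T U : Finset V} (hST : Disjoint S T) (hSU : Disjoint S U)
    (hTU : Disjoint T U) (hun : ∀ x, x ∈ S ∨ x ∈ T ∨ x ∈ U)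
    (hSS : ∀ x ∈ S, ∀ y ∈ S, x ≠ y → G.Adj x y) (hSTa : ∀ x ∈ S, ∀ y ∈ T, G.Adj x y)
    (hSUa : ∀ x ∈ S, ∀ y ∈ U, ¬ G.Adj x y) (hTT : ∀ x ∈ T, ∀ y ∈ T, ¬ G.Adj x y)
    (hUU : ∀ x ∈ U, ∀ y ∈ U, ¬ G.Adj x y)
    (h1 : ∀ x ∈ T, ∃! y, y ∈ U ∧ ¬ G.Adj x y) (h2 : ∀ y ∈ U, ∃! x, x ∈ T ∧ ¬ G.Adj x y) :
    HasAdjMatrix G (matVI S.card T.card) := by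
  obtain ⟨f, hf⟩ := Enumerates.exists_fin S
  obtain ⟨g, k, hg, hk, hgk⟩ := Enumerates.exists_partner (R := fun x y => ¬ G.Adj x y) h1 h2
  have hd2 : Disjoint S (T ∪ U) := Finset.disjoint_union_right.2 ⟨hST, hSU⟩
  have hu : S ∪ (T ∪ U) = Finset.univ := by
    ext x
    simp only [Finset.mem_union, Finset.mem_univ, iff_true]
    exact hun x
  refine hasAdjMatrix_of_enumerates (hu ▸ hf.sumElim (hg.sumElim hk hTU) hd2) ?_
  have e1 : ∀ i j, G.Adj (f i) (f j) ↔ ¬ i = j := fun i j =>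
    ⟨fun e h => G.irrefl (h ▸ e), fun h => hSS _ (hf.mem i) _ (hf.mem j) fun e => h (hf.1 e)⟩
  have e2 : ∀ i j, G.Adj (g i) (k j) ↔ ¬ i = j := fun i j => (not_iff_comm.1 (hgk i j)).symm
  rintro (i | i | i) (j | j | j)
  · simp [matVI, blocks3, JsubI_apply, e1]
  · simp [matVI, blocks3, allOnes_apply, hSTa _ (hf.mem i) _ (hg.mem j)]
  · simp [matVI, blocks3, hSUa _ (hf.mem i) _ (hk.mem j)]
  · simp [matVI, blocks3, allOnes_apply, (hSTa _ (hf.mem j) _ (hg.mem i)).symm]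
  · simp [matVI, blocks3, hTT _ (hg.mem i) _ (hg.mem j)]
  · simp [matVI, blocks3, JsubI_apply, e2]
  · simp [matVI, blocks3, G.adj_comm (k i), hSUa _ (hf.mem j) _ (hk.mem i)]
  · simp [matVI, blocks3, JsubI_apply, G.adj_comm (k i), e2, eq_comm]
  · simp [matVI, blocks3, hUU _ (hk.mem i) _ (hk.mem j)]

namespace PlanarRep
variable {P Q : V → ℝ} {r s : ℝ}

open Classical in
/-- Let `l ~ c` have orthogonal vectors and let `j`, on the side of `l`, lie off the axis of `v l`.
Then the other side is a single independent class, completely joined to the clique of `j` and joined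
to the independent class of `l` by the complement of a perfect matching; the norm of `v j` gives an
equation for the sizes that leaves two solutions. -/
theorem interior_cases (h : PlanarRep G P Q r s) {l c : V} (hl : 0 < P l * Q l)
    (hc : P c * Q c < 0) (ho : P l * P c + Q l * Q c = 0) (hlc : G.Adj l c)
    {j : V} (hj : 0 < P j * Q j) (hY : P c * P j + Q c * Q j ≠ 0) :
    HasAdjMatrix G (matVI 3 5) ∨ HasAdjMatrix G (matVI 4 4) := by
  have hopp : ∀ x y, 0 < P x * Q x → P y * Q y < 0 → ¬ SameVec P Q x y := fun x y hx hy =>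
    not_same_of_opp (mul_neg_of_pos_of_neg hx hy)
  have hadj : ∀ x, P x * Q x < 0 → G.Adj j x := fun x hx => h.adj_of_interior hl ho hj hY hx
  have hj0 := h.innerNbrs_ne_zero_of_interior hl hc ho hj hY
  obtain ⟨hXj, hint⟩ := h.of_interior hl hc ho hj hY
  have hX0 : ∀ x, P x * Q x < 0 → P l * P x + Q l * Q x = 0 := fun x hx =>
    h.not_both_interior hl hc ho hj hY hx
  have ho' : P c * P l + Q c * Q l = 0 := by linarith
  have h4 := h.one_le_gram_self l
  have h5 := h.one_le_gram_self c
  have ha0 : P l * P l + Q l * Q l ≠ 0 := by positivity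
  have hjl : ¬ SameVec P Q j l := fun e => hY (by rw [e.1, e.2]; exact ho')
  have hc0 : (innerNbrs G P Q c).card = 0 := by
    have g := h.gram_of_adj hlc (hopp l c hl hc)
    rw [ho] at g
    have : (innerNbrs G P Q l).card + (innerNbrs G P Q c).card = 0 := by exact_mod_cast g.symm
    omega
  have hYj : P c * P j + Q c * Q j = (innerNbrs G P Q j).card := by
    have g := h.gram_of_adj (hadj c hc) (hopp j c hj hc)
    rw [hc0, Nat.cast_zero, add_zero] at g
    linarith
  obtain ⟨j', hjj', sjj'⟩ := innerNbrs_card_pos.1 hj0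
  have hj' : 0 < P j' * Q j' := by rw [← sjj'.1, ← sjj'.2]; exact hj
  have hadj' : ∀ x, P x * Q x < 0 → G.Adj j' x := fun x hx =>
    h.adj_iff_of_twin sjj' hjj' (fun e => by rw [e] at hx; linarith)
      (fun e => by rw [e] at hx; linarith) |>.1 (hadj x hx)
  have hcdeg : 3 ≤ G.degree c := by
    have hsub : ({l, j, j'} : Finset V) ⊆ G.neighborFinset c := by
      intro x hx
      simp only [Finset.mem_insert, Finset.mem_singleton] at hx
      rw [SimpleGraph.mem_neighborFinset]
      rcases hx with rfl | rfl | rfl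
      · exact hlc.symm
      · exact (hadj c hc).symm
      · exact (hadj' c hc).symm
    have := Finset.card_le_card hsub
    rwa [SimpleGraph.card_neighborFinset_eq_degree, Finset.card_insert_of_notMem,
      Finset.card_insert_of_notMem, Finset.card_singleton] at this
    · simpa using hjj'.ne
    · rw [Finset.mem_insert, Finset.mem_singleton]
      rintro (rfl | rfl)
      · exact hjl (SameVec.refl _)
      · exact hjl sjj'
  -- All vectors of the other side lie on the axis of `v c`; comparing a second one with `v c` by
  -- integrality shows that they are equal.
  have hRsame : ∀ x, P x * Q x < 0 → SameVec P Q c x := by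
    intro x hx
    by_contra hne
    have hcx : c ≠ x := fun e => hne (e ▸ SameVec.refl c)
    have e1 := gram_expand ho j x
    have e2 := gram_expand ho x x
    rw [hX0 x hx, mul_zero, mul_zero, zero_add] at e1
    rw [hX0 x hx, mul_zero, mul_zero, zero_add] at e2
    have g := h.gram_of_adj (hadj x hx) (hopp j x hj hx)
    have hle := codeg_le_degree (G := G) c x
    have hcod := h.codeg c x hcx
    have hdeg := h.deg c
    have hdx := h.deg x
    set n := (G.neighborFinset c ∩ G.neighborFinset x).card
    rw [g, hYj, ← hcod] at e1
    rw [← hcod] at e2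
    obtain ⟨b, hb⟩ : ∃ b, G.degree c = b + 1 := ⟨G.degree c - 1, by omega⟩
    obtain ⟨y, hy⟩ : ∃ y, G.degree x = y + 1 := ⟨G.degree x - 1, by
      have := h.two_le_degree x; omega⟩
    rw [hb] at hdeg
    rw [hy] at hdx
    push_cast at hdeg hdx
    have hb' : P c * P c + Q c * Q c = b := by linarith
    have hy' : P x * P x + Q x * Q x = y := by linarith
    rw [hb'] at e1 e2
    rw [hy'] at e2
    have e1' : (b : ℝ) * ((innerNbrs G P Q j).card + (innerNbrs G P Q x).card)
        = (innerNbrs G P Q j).card * n := mul_left_cancel₀ ha0 (by linear_combination e1)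
    have e2' : (b : ℝ) * y = n * n := mul_left_cancel₀ ha0 (by linear_combination e2)
    have n1 : b * ((innerNbrs G P Q j).card + (innerNbrs G P Q x).card)
        = (innerNbrs G P Q j).card * n := by exact_mod_cast e1'
    have n2 : b * y = n * n := by exact_mod_cast e2'
    have hbn : b ≤ n := by
      have : (innerNbrs G P Q j).card * b ≤ (innerNbrs G P Q j).card * n := by
        rw [← n1]; nlinarith
      exact Nat.le_of_mul_le_mul_left this (Nat.pos_of_ne_zero hj0)
    rcases Nat.lt_or_ge b n with hlt | hge
    · have hn : n = b + 1 := by omega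
      rw [hn] at n2
      have : b ∣ 1 := by
        have h1 : b ∣ (b + 1) * (b + 1) := ⟨y, n2.symm⟩
        have h2 : (b + 1) * (b + 1) = b * (b + 2) + 1 := by ring
        rw [h2] at h1
        exact (Nat.dvd_add_right (Dvd.intro _ rfl)).1 h1
      have := Nat.dvd_one.1 this
      omega
    · have hn : n = b := by omega
      rw [hn] at n2
      have hby : y = b := Nat.eq_of_mul_eq_mul_left (by omega) n2
      exact hne (SameVec.of_dist (by rw [hb', hy', ← hcod, hn, hby]; ring))
  -- The class `J` of `j`, the side `R` of `c`, and the remaining vertices `L`, which look like `l`.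
  set J : Finset V := {x | SameVec P Q j x} with hJ
  set R : Finset V := {x | P x * Q x < 0} with hR
  set L : Finset V := {x | 0 < P x * Q x ∧ ¬ SameVec P Q j x} with hL
  have mJ : ∀ x, x ∈ J ↔ SameVec P Q j x := fun x => by simp [hJ]
  have mR : ∀ x, x ∈ R ↔ P x * Q x < 0 := fun x => by simp [hR]
  have mL : ∀ x, x ∈ L ↔ 0 < P x * Q x ∧ ¬ SameVec P Q j x := fun x => by simp [hL]
  have hJpos : ∀ x ∈ J, 0 < P x * Q x := fun x hx => by
    rw [← ((mJ x).1 hx).1, ← ((mJ x).1 hx).2]; exact hj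
  have hJadj : ∀ x ∈ J, ∀ y ∈ R, G.Adj x y := fun x hx y hy =>
    h.adj_of_interior hl ho (hJpos x hx) (by
      rw [← ((mJ x).1 hx).1, ← ((mJ x).1 hx).2]; exact hY) ((mR y).1 hy)
  have hLsame : ∀ x ∈ L, SameVec P Q l x := fun x hx =>
    (hint x ((mL x).1 hx).1 ((mL x).1 hx).2).2
  have hlL : l ∈ L := (mL l).2 ⟨hl, hjl⟩
  have hLL : ∀ x ∈ L, ∀ y, G.Adj x y → y ∈ R := by
    intro x hx y e
    rw [mR]
    by_contra hge
    have hy' : 0 < P y * Q y := lt_of_le_of_ne (not_lt.1 hge) (h.side_ne_zero y).symm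
    exact innerNbrs_card_pos.2 ⟨y, e, h.same_of_adj e (mul_pos ((mL x).1 hx).1 hy')⟩
      (hint x ((mL x).1 hx).1 ((mL x).1 hx).2).1
  have hcov : ∀ x, x ∈ J ∨ x ∈ R ∨ x ∈ L := by
    intro x
    rcases lt_or_gt_of_ne (h.side_ne_zero x) with hx | hx
    · exact Or.inr (Or.inl ((mR x).2 hx))
    · by_cases e : SameVec P Q j x
      · exact Or.inl ((mJ x).2 e)
      · exact Or.inr (Or.inr ((mL x).2 ⟨hx, e⟩))
  have hRe : ∀ x ∈ R, (innerNbrs G P Q x).card = 0 := by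
    intro x hx
    have hx' := (mR x).1 hx
    have g := h.gram_of_adj (hadj x hx') (hopp j x hj hx')
    rw [← (hRsame x hx').1, ← (hRsame x hx').2] at g
    have : (innerNbrs G P Q j).card + (innerNbrs G P Q x).card = (innerNbrs G P Q j).card := by
      have e : ((innerNbrs G P Q j).card : ℝ) + (innerNbrs G P Q x).card
        = (innerNbrs G P Q j).card := by linarith
      exact_mod_cast e
    omega
  have hRR : ∀ x ∈ R, ∀ y ∈ R, ¬ G.Adj x y := by
    intro x hx y hy e
    exact innerNbrs_card_pos.2 ⟨y, e, h.same_of_adj e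
      (mul_pos_of_neg_of_neg ((mR x).1 hx) ((mR y).1 hy))⟩ (hRe x hx)
  have hJL : ∀ x ∈ J, ∀ y ∈ L, ¬ G.Adj x y := fun x hx y hy e => by
    have := (mR x).1 (hLL y hy x e.symm)
    linarith [hJpos x hx]
  have hdJR : Disjoint J R := Finset.disjoint_left.2 fun x hx hx' => by
    linarith [hJpos x hx, (mR x).1 hx']
  have hdJL : Disjoint J L := Finset.disjoint_left.2 fun x hx hx' =>
    ((mL x).1 hx').2 ((mJ x).1 hx)
  have hdRL : Disjoint R L := Finset.disjoint_left.2 fun x hx hx' => by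
    linarith [((mL x).1 hx').1, (mR x).1 hx]
  -- The block between `L` and `R`.
  have hNl : ∀ x ∈ L, R.filter (G.Adj x) = G.neighborFinset x := by
    intro x hx
    ext y
    simp only [Finset.mem_filter, SimpleGraph.mem_neighborFinset, and_iff_right_iff_imp]
    exact hLL x hx y
  have hNr : ∀ x ∈ R, G.neighborFinset x = J ∪ L.filter (fun y => G.Adj y x) := by
    intro x hx
    ext y
    simp only [Finset.mem_filter, SimpleGraph.mem_neighborFinset, Finset.mem_union]
    constructor
    · intro e
      rcases hcov y with hy | hy | hy
      · exact Or.inl hy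
      · exact absurd e (hRR x hx y hy)
      · exact Or.inr ⟨hy, e.symm⟩
    · rintro (hy | hy)
      · exact (hJadj y hy x hx).symm
      · exact hy.2.symm
  have hb1 : ∀ x ∈ L, ∀ x' ∈ L, x ≠ x' →
      (R.filter (G.Adj x) \ R.filter (G.Adj x')).card = 1 := by
    intro x hx x' hx' hne
    rw [hNl x hx, hNl x' hx']
    obtain ⟨u, -, hu, -⟩ :=
      h.exists_sdiff_of_same ((hLsame x hx).symm.trans (hLsame x' hx')) hne
    rw [hu, Finset.card_singleton]
  have hb2 : ∀ x ∈ R, ∀ x' ∈ R, x ≠ x' →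
      (L.filter (fun y => G.Adj y x) \ L.filter (fun y => G.Adj y x')).card = 1 := by
    intro x hx x' hx' hne
    obtain ⟨u, -, hu, -⟩ := h.exists_sdiff_of_same
      ((hRsame x ((mR x).1 hx)).symm.trans (hRsame x' ((mR x').1 hx'))) hne
    rw [← Finset.card_singleton u, ← hu, hNr x hx, hNr x' hx']
    congr 1
    ext y
    simp only [Finset.mem_sdiff, Finset.mem_union]
    constructor
    · rintro ⟨a, b⟩
      refine ⟨Or.inr a, ?_⟩
      rintro (e | e)
      · exact Finset.disjoint_left.1 hdJL e (Finset.mem_filter.1 a).1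
      · exact b e
    · rintro ⟨a | a, b⟩
      · exact absurd (Or.inl a) b
      · exact ⟨a, fun e => b (Or.inr e)⟩
  have hl2 : 2 ≤ (R.filter (G.Adj l)).card := by
    rw [hNl l hlL, SimpleGraph.card_neighborFinset_eq_degree]; exact h.two_le_degree l
  obtain ⟨hcard, ht, hm1, hm2⟩ := coMatching_of_swap hb1 hb2 hlL hl2
  have hcR : c ∈ R := (mR c).2 hc
  have hjJ : j ∈ J := (mJ j).2 (SameVec.refl j)
  have hm1' : ∀ x ∈ R, ∃! y, y ∈ L ∧ ¬ G.Adj x y := by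
    intro x hx
    obtain ⟨y, hy, hy'⟩ := hm2 x hx
    exact ⟨y, ⟨hy.1, fun e => hy.2 e.symm⟩, fun z hz => hy' z ⟨hz.1, fun e => hz.2 e.symm⟩⟩
  have hm2' : ∀ x ∈ L, ∃! y, y ∈ R ∧ ¬ G.Adj y x := by
    intro x hx
    obtain ⟨y, hy, hy'⟩ := hm1 x hx
    exact ⟨y, ⟨hy.1, fun e => hy.2 e.symm⟩, fun z hz => hy' z ⟨hz.1, fun e => hz.2 e.symm⟩⟩
  -- With `deg l = a + 1`, all norms are expressed by `a`, `|J|` and the number of inner neighbours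
  -- of `j`.
  rw [hNl l hlL, SimpleGraph.card_neighborFinset_eq_degree] at ht
  have hdegc : G.degree c + 1 = J.card + L.card := by
    obtain ⟨y, hy, hy'⟩ := hm1' c hcR
    rw [← SimpleGraph.card_neighborFinset_eq_degree, hNr c hcR, Finset.card_union_of_disjoint
      (Finset.disjoint_of_subset_right (Finset.filter_subset _ _) hdJL)]
    have := Finset.card_filter_add_card_filter_not (s := L) (fun y => G.Adj y c)
    have h1 : (L.filter (fun y => ¬ G.Adj y c)).card = 1 := by
      rw [Finset.card_eq_one]
      refine ⟨y, ?_⟩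
      ext z
      simp only [Finset.mem_filter, Finset.mem_singleton]
      exact ⟨fun e => hy' z ⟨e.1, fun e' => e.2 e'.symm⟩,
        fun e => e ▸ ⟨hy.1, fun e' => hy.2 e'.symm⟩⟩
    omega
  have hdegj : G.degree j = (innerNbrs G P Q j).card + R.card := by
    refine degree_eq_add P Q R fun y => ⟨fun hy => ⟨hJadj j hjJ y hy,
      hopp j y hj ((mR y).1 hy)⟩, fun e => ?_⟩
    rcases hcov y with hy | hy | hy
    · exact absurd ((mJ y).1 hy) e.2
    · exact hy
    · exact absurd e.1 (hJL j hjJ y hy)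
  have hL2 := h.two_le_degree l
  obtain ⟨a, ha⟩ : ∃ a, G.degree l = a + 1 := ⟨G.degree l - 1, by omega⟩
  have hRa : R.card = a + 2 := by omega
  have hdl := h.deg l
  have hdc := h.deg c
  have hdj := h.deg j
  have hdegc' : G.degree c = J.card + a + 1 := by omega
  rw [ha] at hdl
  rw [hdegc'] at hdc
  rw [hdegj, hRa] at hdj
  push_cast at hdl hdc hdj
  have e := gram_expand ho j j
  rw [hXj, hYj, show P l * P l + Q l * Q l = a by linarith,
    show P c * P c + Q c * Q c = J.card + a by linarith,
    show P j * P j + Q j * Q j = (innerNbrs G P Q j).card + a + 1 by linarith] at e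
  have hJc : ∀ x ∈ J, ∀ y ∈ J, SameVec P Q x y := fun x hx y hy =>
    ((mJ x).1 hx).symm.trans ((mJ y).1 hy)
  have hJe : ∀ x ∈ J, (innerNbrs G P Q x).card ≠ 0 := fun x hx =>
    h.innerNbrs_ne_zero_of_interior hl hc ho (hJpos x hx) (by
      rw [← ((mJ x).1 hx).1, ← ((mJ x).1 hx).2]; exact hY)
  rcases h.clique_or_matching hJc (fun x hx y _ e => (mJ y).2 (((mJ x).1 hx).trans e)) hJe with
    hcl | ⟨hone, -, -⟩
  · have hJE : (innerNbrs G P Q j).card + 1 = J.card := by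
      rw [← Finset.card_erase_add_one hjJ]
      congr 2
      ext x
      rw [mem_innerNbrs, Finset.mem_erase, mJ]
      exact ⟨fun e => ⟨e.1.ne', e.2⟩,
        fun e => ⟨hcl j hjJ x ((mJ x).2 e.2) e.1.symm, e.2⟩⟩
    rw [← hJE] at e
    push_cast at e
    set E := (innerNbrs G P Q j).card
    have hfac : ((a : ℝ) + 1) * (E * a) = (a + 1) * (E + a + 1) := by
      linear_combination e
    have ha1 : (a : ℝ) + 1 ≠ 0 := by positivity
    -- In factored form: `(E - 1) (a - 1) = 2`.
    have hN : E * a = E + a + 1 := by exact_mod_cast mul_left_cancel₀ ha1 hfac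
    have hV := hasAdjMatrix_matVI (G := G) hdJR hdJL hdRL hcov hcl hJadj hJL hRR
      (fun x hx y hy e' => by linarith [((mL y).1 hy).1, (mR y).1 (hLL x hx y e')]) hm1' hm2'
    rw [← hJE, hRa] at hV
    have hE0 : 1 ≤ E := Nat.pos_of_ne_zero hj0
    have hcase : (E = 2 ∧ a = 3) ∨ (E = 3 ∧ a = 2) := by
      obtain ⟨E', hE'⟩ := Nat.exists_eq_add_of_le hE0
      obtain ⟨a', ha'⟩ := Nat.exists_eq_add_of_le (show 1 ≤ a by omega)
      rw [hE', ha'] at hN ⊢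
      have h2 : E' * a' = 2 := by nlinarith
      have h3 : E' ∣ 2 := ⟨a', h2.symm⟩
      have h4 := Nat.le_of_dvd (by norm_num) h3
      interval_cases E' <;> omega
    rcases hcase with ⟨h1, h2⟩ | ⟨h1, h2⟩ <;> rw [h1, h2] at hV
    · exact Or.inl hV
    · exact Or.inr hV
  · exfalso
    rw [hone j hjJ] at e
    push_cast at e
    have h6 : (0 : ℝ) < J.card := by exact_mod_cast Finset.card_pos.2 ⟨j, hjJ⟩
    have h7 : (0 : ℝ) ≤ a := by positivity
    have : (J.card : ℝ) = -2 * a := by linear_combination -e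
    linarith

end PlanarRep
end

/-! ### Bipartite graphs -/

section
variable {V : Type*} [Fintype V] [DecidableEq V] {G : SimpleGraph V} [DecidableRel G.Adj]

theorem hasAdjMatrix_bipartiteBlock {α β : Type*} {N : Matrix α β ℝ} {f : α → V} {g : β → V}
    {S T : Finset V} (hf : Enumerates f S) (hg : Enumerates g T) (hd : Disjoint S T)
    (hu : S ∪ T = Finset.univ) (hS : ∀ x ∈ S, ∀ y ∈ S, ¬ G.Adj x y)
    (hT : ∀ x ∈ T, ∀ y ∈ T, ¬ G.Adj x y)
    (hN : ∀ i j, N i j = if G.Adj (f i) (g j) then 1 else 0) :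
    HasAdjMatrix G (bipartiteBlock N) := by
  refine hasAdjMatrix_of_enumerates (hu ▸ hf.sumElim hg hd) ?_
  rintro (i | i) (j | j)
  · simp [bipartiteBlock, hS _ (hf.mem i) _ (hf.mem j)]
  · exact hN i j
  · exact (hN j i).trans (if_congr (G.adj_comm _ _) rfl rfl)
  · simp [bipartiteBlock, hT _ (hg.mem i) _ (hg.mem j)]

theorem bipartiteBlock_JsubI (m : ℕ) : bipartiteBlock (JsubI m) = matI m := by
  have : (JsubI m)ᵀ = JsubI m := by
    ext i j; simp [JsubI_apply, eq_comm]
  rw [bipartiteBlock, matI, this]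

namespace PlanarRep
variable {P Q : V → ℝ} {r s : ℝ}

/-- `L` and `R` are the two colour classes of the bipartite graph `G`; the vectors within each of
them are parallel, and each is a union of classes of equal vectors. -/
structure IsBip (G : SimpleGraph V) [DecidableRel G.Adj] (P Q : V → ℝ) (L R : Finset V) : Prop where
  disj : Disjoint L R
  union : L ∪ R = Finset.univ
  adjL : ∀ x ∈ L, ∀ y, G.Adj x y → y ∈ R
  adjR : ∀ x ∈ R, ∀ y, G.Adj x y → y ∈ L
  crossL : ∀ x ∈ L, ∀ y ∈ L, P x * Q y - P y * Q x = 0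
  crossR : ∀ x ∈ R, ∀ y ∈ R, P x * Q y - P y * Q x = 0
  closedL : ∀ x ∈ L, ∀ y, SameVec P Q x y → y ∈ L
  closedR : ∀ x ∈ R, ∀ y, SameVec P Q x y → y ∈ R
  ne : L.Nonempty
  neR : R.Nonempty

namespace IsBip
variable {L R : Finset V}

theorem swap (hb : IsBip G P Q L R) : IsBip G P Q R L where
  disj := hb.disj.symm
  union := by rw [Finset.union_comm, hb.union]
  adjL := hb.adjR
  adjR := hb.adjL
  crossL := hb.crossR
  crossR := hb.crossL
  closedL := hb.closedR
  closedR := hb.closedL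
  ne := hb.neR
  neR := hb.ne

theorem not_adj (hb : IsBip G P Q L R) : ∀ x ∈ L, ∀ y ∈ L, ¬ G.Adj x y := fun x hx y hy e =>
  Finset.disjoint_left.1 hb.disj hy (hb.adjL x hx y e)

theorem filter_eq (hb : IsBip G P Q L R) {x : V} (hx : x ∈ L) :
    R.filter (G.Adj x) = G.neighborFinset x := by
  ext y
  simp only [Finset.mem_filter, SimpleGraph.mem_neighborFinset, and_iff_right_iff_imp]
  exact hb.adjL x hx y

theorem filter_eq' (hb : IsBip G P Q L R) {x : V} (hx : x ∈ R) :
    L.filter (fun y => G.Adj y x) = G.neighborFinset x := by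
  rw [← hb.swap.filter_eq hx]
  simp only [G.adj_comm]

theorem degree_of_not_same (hb : IsBip G P Q L R) (h : PlanarRep G P Q r s) {x y : V}
    (hx : x ∈ L) (hy : y ∈ L) (hs : ¬ SameVec P Q x y) :
    (G.degree x = 2 ∧ G.degree y = 5 ∧ G.neighborFinset x ⊆ G.neighborFinset y) ∨
    (G.degree x = 5 ∧ G.degree y = 2 ∧ G.neighborFinset y ⊆ G.neighborFinset x) := by
  rcases le_total (G.degree x) (G.degree y) with hd | hd
  · obtain ⟨a, b, -, c⟩ := h.of_parallel (hb.crossL x hx y hy) hs hd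
    exact Or.inl ⟨a, b, c⟩
  · obtain ⟨a, b, -, c⟩ := h.of_parallel (hb.crossL y hy x hx) (fun e => hs e.symm) hd
    exact Or.inr ⟨b, a, c⟩

theorem degree_eq_of_same (h : PlanarRep G P Q r s) {x y : V} (hs : SameVec P Q x y) :
    G.degree x = G.degree y := by
  have h1 := h.deg x
  rw [hs.1, hs.2, ← h.deg y] at h1
  exact_mod_cast h1

/-- If `L` contains two different vectors, then it consists of one class of vertices of degree `2`
and one of degree `5`, with nested neighbourhoods. -/
theorem two_classes (hb : IsBip G P Q L R) (h : PlanarRep G P Q r s)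
    (hns : ¬ ∀ x ∈ L, ∀ y ∈ L, SameVec P Q x y) :
    (∃ x ∈ L, G.degree x = 2) ∧ (∃ x ∈ L, G.degree x = 5) ∧
      (∀ x ∈ L, G.degree x = 2 ∨ G.degree x = 5) ∧
      (∀ x ∈ L, ∀ y ∈ L, G.degree x = G.degree y → SameVec P Q x y) ∧
      (∀ x ∈ L, ∀ y ∈ L, G.degree x = 2 → G.degree y = 5 →
        G.neighborFinset x ⊆ G.neighborFinset y) := by
  push Not at hns
  obtain ⟨x, hx, y, hy, hxy⟩ := hns
  refine ⟨?_, ?_, fun z hz => ?_, fun z hz w hw e => ?_, fun z hz w hw e1 e2 => ?_⟩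
  · rcases hb.degree_of_not_same h hx hy hxy with ⟨a, b, -⟩ | ⟨a, b, -⟩
    exacts [⟨x, hx, a⟩, ⟨y, hy, b⟩]
  · rcases hb.degree_of_not_same h hx hy hxy with ⟨a, b, -⟩ | ⟨a, b, -⟩
    exacts [⟨y, hy, b⟩, ⟨x, hx, a⟩]
  · by_cases hxz : SameVec P Q z x
    · have hzy : ¬ SameVec P Q z y := fun e => hxy (hxz.symm.trans e)
      rcases hb.degree_of_not_same h hz hy hzy with ⟨a, b, -⟩ | ⟨a, b, -⟩
      exacts [Or.inl a, Or.inr a]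
    · rcases hb.degree_of_not_same h hz hx hxz with ⟨a, b, -⟩ | ⟨a, b, -⟩
      exacts [Or.inl a, Or.inr a]
  · by_contra hs
    rcases hb.degree_of_not_same h hz hw hs with ⟨a, b, -⟩ | ⟨a, b, -⟩ <;> omega
  · have hs : ¬ SameVec P Q z w := fun e => by
      have := degree_eq_of_same h e; omega
    rcases hb.degree_of_not_same h hz hw hs with ⟨a, b, c⟩ | ⟨a, b, c⟩
    · exact c
    · omega

theorem one_one (hb : IsBip G P Q L R) (h : PlanarRep G P Q r s)
    (hL : ∀ x ∈ L, ∀ y ∈ L, SameVec P Q x y) (hR : ∀ x ∈ R, ∀ y ∈ R, SameVec P Q x y) :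
    ∃ m : ℕ, 3 ≤ m ∧ HasAdjMatrix G (matI m) := by
  obtain ⟨l, hl⟩ := hb.ne
  have b1 : ∀ x ∈ L, ∀ x' ∈ L, x ≠ x' →
      (R.filter (G.Adj x) \ R.filter (G.Adj x')).card = 1 := by
    intro x hx x' hx' hne
    rw [hb.filter_eq hx, hb.filter_eq hx']
    obtain ⟨u, -, hu, -⟩ := h.exists_sdiff_of_same (hL x hx x' hx') hne
    rw [hu, Finset.card_singleton]
  have b2 : ∀ x ∈ R, ∀ x' ∈ R, x ≠ x' →
      (L.filter (fun y => G.Adj y x) \ L.filter (fun y => G.Adj y x')).card = 1 := by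
    intro x hx x' hx' hne
    rw [hb.filter_eq' hx, hb.filter_eq' hx']
    obtain ⟨u, -, hu, -⟩ := h.exists_sdiff_of_same (hR x hx x' hx') hne
    rw [hu, Finset.card_singleton]
  have h2 : 2 ≤ (R.filter (G.Adj l)).card := by
    rw [hb.filter_eq hl, SimpleGraph.card_neighborFinset_eq_degree]; exact h.two_le_degree l
  obtain ⟨hc, ht, m1, m2⟩ := coMatching_of_swap b1 b2 hl h2
  obtain ⟨f, g, hf, hg, hfg⟩ := Enumerates.exists_partner (R := fun x y => ¬ G.Adj x y) m1 m2
  refine ⟨L.card, by omega, ?_⟩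
  rw [← bipartiteBlock_JsubI]
  refine hasAdjMatrix_bipartiteBlock hf hg hb.disj hb.union hb.not_adj hb.swap.not_adj ?_
  intro i j
  rw [JsubI_apply, if_congr (hfg i j).symm rfl rfl]
  by_cases e : G.Adj (f i) (g j) <;> simp [e]

/-- If `R` were one class and `L` two, then the vertices of degree `5` would be adjacent to all of
`R`, so `|R| = 5`, while those of degree `2` form the complement of a perfect matching with `R`, so
`|R| = 3`. -/
theorem not_two_one (hb : IsBip G P Q L R) (h : PlanarRep G P Q r s)
    (hL : ¬ ∀ x ∈ L, ∀ y ∈ L, SameVec P Q x y) : ¬ ∀ x ∈ R, ∀ y ∈ R, SameVec P Q x y := by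
  intro hR
  obtain ⟨⟨l₁, hl₁, d₁⟩, ⟨l₄, hl₄, d₄⟩, hdeg, hsame, hsub⟩ := hb.two_classes h hL
  obtain ⟨c, hc⟩ := h.exists_adj l₁
  have hcR := hb.adjL l₁ hl₁ c hc
  have hc4 : ∀ x ∈ L, G.degree x = 5 → G.Adj x c := fun x hx hx5 => by
    have := hsub l₁ hl₁ x hx d₁ hx5 (by simpa using hc)
    simpa using this
  have hall : ∀ x ∈ L, G.degree x = 5 → ∀ y ∈ R, G.Adj x y := by
    intro x hx hx5 y hy
    by_contra hn
    have hne : c ≠ y := fun e => hn (e ▸ hc4 x hx hx5)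
    obtain ⟨u, v, hu, hv, huv⟩ := h.exists_sdiff_of_same (hR c hcR y hy) hne
    have hxu : x ∈ G.neighborFinset c \ G.neighborFinset y := by
      simp only [Finset.mem_sdiff, SimpleGraph.mem_neighborFinset]
      exact ⟨(hc4 x hx hx5).symm, fun e => hn e.symm⟩
    rw [hu, Finset.mem_singleton] at hxu
    subst hxu
    have hv' : v ∈ G.neighborFinset y \ G.neighborFinset c := by rw [hv]; simp
    simp only [Finset.mem_sdiff, SimpleGraph.mem_neighborFinset] at hv'
    exact hv'.2 (hc4 v (hb.closedL x hx v huv) (by rw [← degree_eq_of_same h huv, hx5])).symm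
  have hR5 : R.card = 5 := by
    rw [← d₄, ← SimpleGraph.card_neighborFinset_eq_degree, ← hb.filter_eq hl₄,
      Finset.filter_true_of_mem (hall l₄ hl₄ d₄)]
  set L₁ := L.filter (fun x => G.degree x = 2) with hL₁
  have b1 : ∀ x ∈ L₁, ∀ x' ∈ L₁, x ≠ x' →
      (R.filter (G.Adj x) \ R.filter (G.Adj x')).card = 1 := by
    intro x hx x' hx' hne
    rw [hL₁, Finset.mem_filter] at hx hx'
    rw [hb.filter_eq hx.1, hb.filter_eq hx'.1]
    obtain ⟨u, -, hu, -⟩ := h.exists_sdiff_of_same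
      (hsame x hx.1 x' hx'.1 (hx.2.trans hx'.2.symm)) hne
    rw [hu, Finset.card_singleton]
  have b2 : ∀ x ∈ R, ∀ x' ∈ R, x ≠ x' →
      (L₁.filter (fun y => G.Adj y x) \ L₁.filter (fun y => G.Adj y x')).card = 1 := by
    intro x hx x' hx' hne
    obtain ⟨u, -, hu, -⟩ := h.exists_sdiff_of_same (hR x hx x' hx') hne
    rw [← Finset.card_singleton u, ← hu]
    congr 1
    ext y
    simp only [Finset.mem_sdiff, Finset.mem_filter, SimpleGraph.mem_neighborFinset, hL₁]
    constructor
    · rintro ⟨⟨⟨a, b⟩, c⟩, d⟩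
      exact ⟨c.symm, fun e => d ⟨⟨a, b⟩, e.symm⟩⟩
    · rintro ⟨a, b⟩
      have hyL := hb.adjR x hx y a
      have hy2 : G.degree y = 2 := by
        rcases hdeg y hyL with e | e
        · exact e
        · exact absurd (hall y hyL e x' hx').symm b
      exact ⟨⟨⟨hyL, hy2⟩, a.symm⟩, fun e => b e.2.symm⟩
  have hl₁' : l₁ ∈ L₁ := Finset.mem_filter.2 ⟨hl₁, d₁⟩
  have h2 : (R.filter (G.Adj l₁)).card = 2 := by
    rw [hb.filter_eq hl₁, SimpleGraph.card_neighborFinset_eq_degree, d₁]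
  have := (coMatching_of_swap b1 b2 hl₁' h2.ge).2.1
  omega

end IsBip
end PlanarRep
end

section
variable {V : Type*} [Fintype V] [DecidableEq V] {G : SimpleGraph V} [DecidableRel G.Adj]
namespace PlanarRep
variable {P Q : V → ℝ} {r s : ℝ}
namespace IsBip
variable {L R : Finset V}

/-- If two vertices of degree `2` are adjacent, then `R` has a single vertex of degree `5`, which is
adjacent to all of `L`, and every vertex of degree `2` in `L` has one more neighbour, of degree
`2`. -/
theorem matched_half (hb : IsBip G P Q L R) (h : PlanarRep G P Q r s)
    (hL : ¬ ∀ x ∈ L, ∀ y ∈ L, SameVec P Q x y) (hR : ¬ ∀ x ∈ R, ∀ y ∈ R, SameVec P Q x y)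
    {l₁ r₁ : V} (hl₁ : l₁ ∈ L) (d₁ : G.degree l₁ = 2) (dr₁ : G.degree r₁ = 2)
    (hadj : G.Adj l₁ r₁) :
    ∃ r₄ ∈ R, G.degree r₄ = 5 ∧ (∀ x ∈ L, G.Adj x r₄) ∧
      (∀ y ∈ R, y ≠ r₄ ↔ y ∈ R.filter (fun y => G.degree y = 2)) ∧
      ∀ x ∈ L, G.degree x = 2 → ∃! y, y ∈ R.filter (fun y => G.degree y = 2) ∧ G.Adj x y := by
  have hr₁ := hb.adjL l₁ hl₁ r₁ hadj
  obtain ⟨-, -, hdegL, hsameL, hsubL⟩ := hb.two_classes h hL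
  obtain ⟨-, ⟨r₄, hr₄, d₄⟩, hdegR, hsameR, hsubR⟩ := hb.swap.two_classes h hR
  have hN4 : ∀ y ∈ R, G.degree y = 5 → G.Adj l₁ y := fun y hy hy5 => by
    have := hsubR r₁ hr₁ y hy dr₁ hy5 (by simpa using hadj.symm : l₁ ∈ G.neighborFinset r₁)
    simpa using (by simpa using this : G.Adj y l₁).symm
  have hne : r₁ ≠ r₄ := fun e => by rw [e] at dr₁; omega
  have hNl₁ : G.neighborFinset l₁ = {r₁, r₄} := by
    symm
    refine Finset.eq_of_subset_of_card_le ?_ ?_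
    · intro y hy
      simp only [Finset.mem_insert, Finset.mem_singleton] at hy
      rw [SimpleGraph.mem_neighborFinset]
      rcases hy with rfl | rfl
      exacts [hadj, hN4 _ hr₄ d₄]
    · rw [SimpleGraph.card_neighborFinset_eq_degree, d₁, Finset.card_pair hne]
  have huniq : ∀ y ∈ R, G.degree y = 5 → y = r₄ := by
    intro y hy hy5
    have : y ∈ G.neighborFinset l₁ := by simpa using hN4 y hy hy5
    rw [hNl₁, Finset.mem_insert, Finset.mem_singleton] at this
    rcases this with rfl | e
    · omega
    · exact e
  have hR1 : ∀ y ∈ R, y ≠ r₄ ↔ y ∈ R.filter (fun y => G.degree y = 2) := by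
    intro y hy
    rw [Finset.mem_filter]
    constructor
    · intro e
      refine ⟨hy, ?_⟩
      rcases hdegR y hy with e2 | e5
      · exact e2
      · exact absurd (huniq y hy e5) e
    · rintro ⟨-, e2⟩ rfl
      omega
  have hall : ∀ x ∈ L, G.Adj x r₄ := by
    intro x hx
    rcases hdegL x hx with e | e
    · by_cases hxl : l₁ = x
      · exact hxl ▸ hN4 r₄ hr₄ d₄
      obtain ⟨u, v, hu, hv, huv⟩ := h.exists_sdiff_of_same (hsameL l₁ hl₁ x hx (d₁.trans e.symm)) hxl
      by_contra hn
      have h1 : r₄ ∈ G.neighborFinset l₁ \ G.neighborFinset x := by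
        simp only [Finset.mem_sdiff, SimpleGraph.mem_neighborFinset]
        exact ⟨hN4 r₄ hr₄ d₄, hn⟩
      rw [hu, Finset.mem_singleton] at h1
      subst h1
      have h2 : v ∈ G.neighborFinset x \ G.neighborFinset l₁ := by rw [hv]; simp
      rw [huniq v (hb.closedR _ hr₄ v huv) (by rw [← degree_eq_of_same h huv, d₄])] at h2
      simp only [Finset.mem_sdiff, SimpleGraph.mem_neighborFinset] at h2
      exact hn h2.1
    · have := hsubL l₁ hl₁ x hx d₁ e (by simpa using hN4 r₄ hr₄ d₄ : r₄ ∈ G.neighborFinset l₁)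
      simpa using this
  refine ⟨r₄, hr₄, d₄, hall, hR1, fun x hx hx2 => ?_⟩
  have hc : ((G.neighborFinset x).erase r₄).card = 1 := by
    rw [Finset.card_erase_of_mem (by simpa using hall x hx),
      SimpleGraph.card_neighborFinset_eq_degree, hx2]
  obtain ⟨y, hy⟩ := Finset.card_eq_one.1 hc
  have hm : ∀ z, z ∈ (G.neighborFinset x).erase r₄ ↔
      z ∈ R.filter (fun y => G.degree y = 2) ∧ G.Adj x z := by
    intro z
    rw [Finset.mem_erase, SimpleGraph.mem_neighborFinset]
    constructor
    · rintro ⟨a, b⟩; exact ⟨(hR1 z (hb.adjL x hx z b)).1 a, b⟩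
    · rintro ⟨a, b⟩; exact ⟨(hR1 z (hb.adjL x hx z b)).2 a, b⟩
  refine ⟨y, (hm y).1 (by rw [hy]; simp), fun z hz => ?_⟩
  have := (hm z).2 hz
  rw [hy] at this
  simpa using this

theorem card_filter_of_matched (hb : IsBip G P Q L R)
    {l₄ r₄ : V} (hl₄ : l₄ ∈ L) (d₄ : G.degree l₄ = 5) (hr₄ : r₄ ∈ R)
    (hall : ∀ y ∈ R, G.Adj y l₄)
    (hR1 : ∀ y ∈ R, y ≠ r₄ ↔ y ∈ R.filter (fun y => G.degree y = 2)) :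
    (R.filter (fun y => G.degree y = 2)).card = 4 := by
  have hR5 : R.card = 5 := by
    rw [← d₄, ← SimpleGraph.card_neighborFinset_eq_degree, ← hb.filter_eq hl₄,
      Finset.filter_true_of_mem fun y hy => (hall y hy).symm]
  have : R.filter (fun y => G.degree y = 2) = R.erase r₄ := by
    ext y
    rw [Finset.mem_erase]
    constructor
    · intro hy
      have hyR := (Finset.mem_filter.1 hy).1
      exact ⟨(hR1 y hyR).2 hy, hyR⟩
    · rintro ⟨a, b⟩; exact (hR1 y b).1 a
  rw [this, Finset.card_erase_of_mem hr₄, hR5]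

theorem hasAdjMatrix_N₁ (hb : IsBip G P Q L R) (h : PlanarRep G P Q r s)
    (hL : ¬ ∀ x ∈ L, ∀ y ∈ L, SameVec P Q x y) (hR : ¬ ∀ x ∈ R, ∀ y ∈ R, SameVec P Q x y)
    {l₁ r₁ : V} (hl₁ : l₁ ∈ L) (d₁ : G.degree l₁ = 2) (dr₁ : G.degree r₁ = 2)
    (hadj : G.Adj l₁ r₁) : HasAdjMatrix G (bipartiteBlock matN₁) := by
  obtain ⟨r₄, hr₄, dr₄, hallL, hR1, hmL⟩ := hb.matched_half h hL hR hl₁ d₁ dr₁ hadj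
  obtain ⟨l₄, hl₄, dl₄, hallR, hL1, hmR⟩ := hb.swap.matched_half h hR hL
    (hb.adjL l₁ hl₁ r₁ hadj) dr₁ d₁ hadj.symm
  have hcL := hb.swap.card_filter_of_matched hr₄ dr₄ hl₄ hallL hL1
  set L₁ := L.filter (fun y => G.degree y = 2)
  set R₁ := R.filter (fun y => G.degree y = 2)
  have hL₁ : ∀ x ∈ L₁, x ∈ L := fun x hx => (Finset.mem_filter.1 hx).1
  have hR₁ : ∀ x ∈ R₁, x ∈ R := fun x hx => (Finset.mem_filter.1 hx).1
  obtain ⟨f, g, hf, hg, hfg⟩ := Enumerates.exists_partner' hcL (R := G.Adj)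
    (fun x hx => hmL x (hL₁ x hx) (Finset.mem_filter.1 hx).2)
    (fun y hy => by
      obtain ⟨x, hx, hx'⟩ := hmR y (hR₁ y hy) (Finset.mem_filter.1 hy).2
      exact ⟨x, ⟨hx.1, hx.2.symm⟩, fun z hz => hx' z ⟨hz.1, hz.2.symm⟩⟩)
  have dL : Disjoint {l₄} L₁ := by
    rw [Finset.disjoint_singleton_left]
    exact fun e => (hL1 l₄ hl₄).2 e rfl
  have dR : Disjoint {r₄} R₁ := by
    rw [Finset.disjoint_singleton_left]
    exact fun e => (hR1 r₄ hr₄).2 e rfl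
  have uL : {l₄} ∪ L₁ = L := by
    ext x
    rw [Finset.mem_union, Finset.mem_singleton]
    constructor
    · rintro (rfl | hx)
      exacts [hl₄, hL₁ x hx]
    · intro hx
      by_cases e : x = l₄
      exacts [Or.inl e, Or.inr ((hL1 x hx).1 e)]
  have uR : {r₄} ∪ R₁ = R := by
    ext x
    rw [Finset.mem_union, Finset.mem_singleton]
    constructor
    · rintro (rfl | hx)
      exacts [hr₄, hR₁ x hx]
    · intro hx
      by_cases e : x = r₄
      exacts [Or.inl e, Or.inr ((hR1 x hx).1 e)]
  refine hasAdjMatrix_bipartiteBlock (uL ▸ (Enumerates.unit l₄).sumElim hf dL)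
    (uR ▸ (Enumerates.unit r₄).sumElim hg dR) hb.disj hb.union hb.not_adj hb.swap.not_adj ?_
  rintro (i | i) (j | j)
  · simp [matN₁, hallL l₄ hl₄]
  · simp [matN₁, allOnes_apply, (hallR _ (hR₁ _ (hg.mem j))).symm]
  · simp [matN₁, allOnes_apply, hallL _ (hL₁ _ (hf.mem i))]
  · simp [matN₁, Matrix.one_apply, hfg]

/-- If vertices of degree `2` are never adjacent, then those of degree `5` always are (across the
two sides), and between the degree-`2` vertices of `L` and the degree-`5` vertices of `R` the graph
is `K_{3,3}` minus a perfect matching. -/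
theorem comatched_half (hb : IsBip G P Q L R) (h : PlanarRep G P Q r s)
    (hL : ¬ ∀ x ∈ L, ∀ y ∈ L, SameVec P Q x y) (hR : ¬ ∀ x ∈ R, ∀ y ∈ R, SameVec P Q x y)
    (hno : ∀ x ∈ L, ∀ y ∈ R, G.degree x = 2 → G.degree y = 2 → ¬ G.Adj x y) :
    (∀ x ∈ L, ∀ y ∈ R, G.degree x = 5 → G.degree y = 5 → G.Adj x y) ∧
    (L.filter (fun y => G.degree y = 2)).card = 3 ∧
    (∀ x ∈ L.filter (fun y => G.degree y = 2),
      ∃! y, y ∈ R.filter (fun y => G.degree y = 5) ∧ ¬ G.Adj x y) ∧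
    (∀ y ∈ R.filter (fun y => G.degree y = 5),
      ∃! x, x ∈ L.filter (fun y => G.degree y = 2) ∧ ¬ G.Adj x y) := by
  obtain ⟨⟨l₁, hl₁, d₁⟩, -, hdegL, hsameL, hsubL⟩ := hb.two_classes h hL
  obtain ⟨⟨r₁, hr₁, dr₁⟩, -, hdegR, hsameR, hsubR⟩ := hb.swap.two_classes h hR
  have hcomp : ∀ x ∈ L, ∀ y ∈ R, G.degree x = 5 → G.degree y = 5 → G.Adj x y := by
    intro x hx y hy hx5 hy5
    obtain ⟨z, hz⟩ := h.exists_adj r₁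
    have hzL := hb.adjR r₁ hr₁ z hz
    have hz5 : G.degree z = 5 := by
      rcases hdegL z hzL with e | e
      · exact absurd hz.symm (hno z hzL r₁ hr₁ e dr₁)
      · exact e
    obtain ⟨w, hw, hw2, hxw⟩ : ∃ w ∈ R, G.degree w = 2 ∧ G.Adj x w := by
      by_cases hxr : G.Adj x r₁
      · exact ⟨r₁, hr₁, dr₁, hxr⟩
      have hne : z ≠ x := fun e => hxr (e ▸ hz.symm)
      obtain ⟨u, v, hu, hv, huv⟩ := h.exists_sdiff_of_same
        (hsameL z hzL x hx (hz5.trans hx5.symm)) hne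
      have h1 : r₁ ∈ G.neighborFinset z \ G.neighborFinset x := by
        simp only [Finset.mem_sdiff, SimpleGraph.mem_neighborFinset]
        exact ⟨hz.symm, hxr⟩
      rw [hu, Finset.mem_singleton] at h1
      subst h1
      have h2 : v ∈ G.neighborFinset x \ G.neighborFinset z := by rw [hv]; simp
      simp only [Finset.mem_sdiff, SimpleGraph.mem_neighborFinset] at h2
      exact ⟨v, hb.closedR _ hr₁ v huv, by rw [← degree_eq_of_same h huv, dr₁], h2.1⟩
    have := hsubR w hw y hy hw2 hy5 (by simpa using hxw.symm : x ∈ G.neighborFinset w)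
    exact (by simpa using this : G.Adj y x).symm
  set L₁ := L.filter (fun y => G.degree y = 2) with hL₁
  set R₄ := R.filter (fun y => G.degree y = 5) with hR₄
  have hN : ∀ x ∈ L₁, R₄.filter (G.Adj x) = G.neighborFinset x := by
    intro x hx
    obtain ⟨hxL, hx2⟩ := Finset.mem_filter.1 hx
    ext y
    simp only [hR₄, Finset.mem_filter, SimpleGraph.mem_neighborFinset, and_iff_right_iff_imp]
    intro e
    have hyR := hb.adjL x hxL y e
    refine ⟨hyR, ?_⟩
    rcases hdegR y hyR with e2 | e5
    · exact absurd e (hno x hxL y hyR hx2 e2)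
    · exact e5
  have b1 : ∀ x ∈ L₁, ∀ x' ∈ L₁, x ≠ x' →
      (R₄.filter (G.Adj x) \ R₄.filter (G.Adj x')).card = 1 := by
    intro x hx x' hx' hne
    rw [hN x hx, hN x' hx']
    obtain ⟨u, -, hu, -⟩ := h.exists_sdiff_of_same
      (hsameL x (Finset.mem_filter.1 hx).1 x' (Finset.mem_filter.1 hx').1
        ((Finset.mem_filter.1 hx).2.trans (Finset.mem_filter.1 hx').2.symm)) hne
    rw [hu, Finset.card_singleton]
  have b2 : ∀ x ∈ R₄, ∀ x' ∈ R₄, x ≠ x' →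
      (L₁.filter (fun y => G.Adj y x) \ L₁.filter (fun y => G.Adj y x')).card = 1 := by
    intro x hx x' hx' hne
    obtain ⟨hxR, hx5⟩ := Finset.mem_filter.1 hx
    obtain ⟨hxR', hx5'⟩ := Finset.mem_filter.1 hx'
    obtain ⟨u, -, hu, -⟩ := h.exists_sdiff_of_same (hsameR x hxR x' hxR' (hx5.trans hx5'.symm)) hne
    rw [← Finset.card_singleton u, ← hu]
    congr 1
    ext y
    simp only [Finset.mem_sdiff, Finset.mem_filter, SimpleGraph.mem_neighborFinset, hL₁]
    constructor
    · rintro ⟨⟨⟨a, b⟩, c⟩, d⟩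
      exact ⟨c.symm, fun e => d ⟨⟨a, b⟩, e.symm⟩⟩
    · rintro ⟨a, b⟩
      have hyL := hb.adjR x hxR y a
      have hy2 : G.degree y = 2 := by
        rcases hdegL y hyL with e | e
        · exact e
        · exact absurd (hcomp y hyL x' hxR' e hx5').symm b
      exact ⟨⟨⟨hyL, hy2⟩, a.symm⟩, fun e => b e.2.symm⟩
  have hl₁' : l₁ ∈ L₁ := Finset.mem_filter.2 ⟨hl₁, d₁⟩
  have h2 : (R₄.filter (G.Adj l₁)).card = 2 := by
    rw [hN l₁ hl₁', SimpleGraph.card_neighborFinset_eq_degree, d₁]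
  obtain ⟨c1, c2, m1, m2⟩ := coMatching_of_swap b1 b2 hl₁' h2.ge
  exact ⟨hcomp, by omega, m1, m2⟩

theorem hasAdjMatrix_N₂ (hb : IsBip G P Q L R) (h : PlanarRep G P Q r s)
    (hL : ¬ ∀ x ∈ L, ∀ y ∈ L, SameVec P Q x y) (hR : ¬ ∀ x ∈ R, ∀ y ∈ R, SameVec P Q x y)
    (hno : ∀ x ∈ L, ∀ y ∈ R, G.degree x = 2 → G.degree y = 2 → ¬ G.Adj x y) :
    HasAdjMatrix G (bipartiteBlock matN₂) := by
  obtain ⟨hcomp, c1, m1, m2⟩ := hb.comatched_half h hL hR hno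
  obtain ⟨-, c1', m1', m2'⟩ := hb.swap.comatched_half h hR hL
    fun x hx y hy a b e => hno y hy x hx b a e.symm
  obtain ⟨-, -, hdegL, -, -⟩ := hb.two_classes h hL
  obtain ⟨-, -, hdegR, -, -⟩ := hb.swap.two_classes h hR
  obtain ⟨f₁, g₄, hf₁, hg₄, e₁⟩ := Enumerates.exists_partner' c1 m1 m2
  obtain ⟨g₁, f₄, hg₁, hf₄, e₂⟩ := Enumerates.exists_partner' c1' m1' m2'
  have dsj : ∀ S : Finset V, Disjoint (S.filter (fun y => G.degree y = 5))
      (S.filter (fun y => G.degree y = 2)) := fun S => Finset.disjoint_left.2 fun x hx hx' => by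
    have := (Finset.mem_filter.1 hx).2
    have := (Finset.mem_filter.1 hx').2
    omega
  have un : ∀ S : Finset V, (∀ x ∈ S, G.degree x = 2 ∨ G.degree x = 5) →
      S.filter (fun y => G.degree y = 5) ∪ S.filter (fun y => G.degree y = 2) = S := by
    intro S hS
    ext x
    simp only [Finset.mem_union, Finset.mem_filter]
    constructor
    · rintro (e | e) <;> exact e.1
    · intro hx
      rcases hS x hx with e | e
      exacts [Or.inr ⟨hx, e⟩, Or.inl ⟨hx, e⟩]
  refine hasAdjMatrix_bipartiteBlock (un L hdegL ▸ hf₄.sumElim hf₁ (dsj L))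
    ((Finset.union_comm _ _).trans (un R hdegR) ▸ hg₁.sumElim hg₄ (dsj R).symm)
    hb.disj hb.union hb.not_adj hb.swap.not_adj ?_
  rintro (i | i) (j | j)
  · have := e₂ j i
    rw [not_iff_comm] at this
    simp [matN₂, JsubI_apply, G.adj_comm (f₄ i), ← this, eq_comm]
  · obtain ⟨a, b⟩ := Finset.mem_filter.1 (hf₄.mem i)
    obtain ⟨a', b'⟩ := Finset.mem_filter.1 (hg₄.mem j)
    simp [matN₂, allOnes_apply, hcomp _ a _ a' b b']
  · obtain ⟨a, b⟩ := Finset.mem_filter.1 (hf₁.mem i)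
    obtain ⟨a', b'⟩ := Finset.mem_filter.1 (hg₁.mem j)
    simp [matN₂, hno _ a _ a' b b']
  · have := e₁ i j
    rw [not_iff_comm] at this
    simp [matN₂, JsubI_apply, ← this]

end IsBip

theorem bip_cases (h : PlanarRep G P Q r s) {L R : Finset V} (hb : IsBip G P Q L R) :
    (∃ m : ℕ, 3 ≤ m ∧ HasAdjMatrix G (matI m)) ∨
      (HasAdjMatrix G (bipartiteBlock matN₁) ∨ HasAdjMatrix G (bipartiteBlock matN₂)) := by
  by_cases hL : ∀ x ∈ L, ∀ y ∈ L, SameVec P Q x y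
  · by_cases hR : ∀ x ∈ R, ∀ y ∈ R, SameVec P Q x y
    · exact Or.inl (hb.one_one h hL hR)
    · exact absurd hL (hb.swap.not_two_one h hR)
  · by_cases hR : ∀ x ∈ R, ∀ y ∈ R, SameVec P Q x y
    · exact absurd hR (hb.not_two_one h hL)
    · right
      by_cases hno : ∀ x ∈ L, ∀ y ∈ R, G.degree x = 2 → G.degree y = 2 → ¬ G.Adj x y
      · exact Or.inr (hb.hasAdjMatrix_N₂ h hL hR hno)
      · push Not at hno
        obtain ⟨x, hx, y, hy, hx2, hy2, e⟩ := hno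
        exact Or.inl (hb.hasAdjMatrix_N₁ h hL hR hx hx2 hy2 e)

open Classical in
/-- If all vectors lie on the axes of two orthogonal vectors on opposite sides, then no vertex has
inner neighbours, and `G` is bipartite with the two sides as colour classes. -/
theorem isBip_of_orthogonal (h : PlanarRep G P Q r s) {l c : V} (hl : 0 < P l * Q l)
    (hc : P c * Q c < 0) (ho : P l * P c + Q l * Q c = 0)
    (hL : ∀ i, 0 < P i * Q i → P c * P i + Q c * Q i = 0)
    (hR : ∀ i, P i * Q i < 0 → P l * P i + Q l * Q i = 0) :
    IsBip G P Q {x | 0 < P x * Q x} {x | P x * Q x < 0} := by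
  have h4 := h.one_le_gram_self l
  have h5 := h.one_le_gram_self c
  have e0 : ∀ i, (innerNbrs G P Q i).card = 0 := by
    intro i
    obtain ⟨j, hj, hs⟩ := h.exists_opp_adj i
    have g := h.gram_of_adj hj (not_same_of_opp hs)
    have e := gram_expand ho i j
    have hz : (P c * P c + Q c * Q c) * ((P l * P i + Q l * Q i) * (P l * P j + Q l * Q j))
        + (P l * P l + Q l * Q l) * ((P c * P i + Q c * Q i) * (P c * P j + Q c * Q j)) = 0 := by
      rcases lt_or_gt_of_ne (h.side_ne_zero i) with hi | hi
      · have hj' : 0 < P j * Q j := by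
          by_contra hge; push Not at hge
          nlinarith [mul_nonneg_of_nonpos_of_nonpos hi.le hge]
        rw [hR i hi, hL j hj']; ring
      · have hj' : P j * Q j < 0 := by
          by_contra hge; push Not at hge; nlinarith [mul_nonneg hi.le hge]
        rw [hL i hi, hR j hj']; ring
    rw [hz, g] at e
    have hab : (P l * P l + Q l * Q l) * (P c * P c + Q c * Q c) ≠ 0 := by positivity
    have := (mul_eq_zero.1 e).resolve_left hab
    have : (innerNbrs G P Q i).card + (innerNbrs G P Q j).card = 0 := by exact_mod_cast this
    omega
  have hopp : ∀ i j, G.Adj i j → P i * Q i * (P j * Q j) < 0 := by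
    intro i j hij
    refine h.side_mul_side_neg hij fun e => ?_
    exact innerNbrs_card_pos.2 ⟨j, hij, e⟩ (e0 i)
  constructor
  · rw [Finset.disjoint_left]
    intro x hx hx'
    simp only [Finset.mem_filter, Finset.mem_univ, true_and] at hx hx'
    linarith
  · ext x
    simpa using (lt_or_gt_of_ne (h.side_ne_zero x)).symm
  · intro x hx y hxy
    simp only [Finset.mem_filter, Finset.mem_univ, true_and] at hx ⊢
    have := hopp x y hxy
    by_contra hge; push Not at hge; nlinarith [mul_nonneg hx.le hge]
  · intro x hx y hxy
    simp only [Finset.mem_filter, Finset.mem_univ, true_and] at hx ⊢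
    have := hopp x y hxy
    by_contra hge; push Not at hge
    nlinarith [mul_nonneg_of_nonpos_of_nonpos hx.le hge]
  · intro x hx y hy
    simp only [Finset.mem_filter, Finset.mem_univ, true_and] at hx hy
    have hxy : (P c * P c + Q c * Q c) * (P x * Q y - P y * Q x) = 0 := by
      linear_combination (P c * Q y - P y * Q c) * hL x hx - (P c * Q x - P x * Q c) * hL y hy
    exact (mul_eq_zero.1 hxy).resolve_left (by positivity)
  · intro x hx y hy
    simp only [Finset.mem_filter, Finset.mem_univ, true_and] at hx hy
    have hxy : (P l * P l + Q l * Q l) * (P x * Q y - P y * Q x) = 0 := by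
      linear_combination (P l * Q y - P y * Q l) * hR x hx - (P l * Q x - P x * Q l) * hR y hy
    exact (mul_eq_zero.1 hxy).resolve_left (by positivity)
  · intro x hx y e
    simp only [Finset.mem_filter, Finset.mem_univ, true_and] at hx ⊢
    rw [← e.1, ← e.2]; exact hx
  · intro x hx y e
    simp only [Finset.mem_filter, Finset.mem_univ, true_and] at hx ⊢
    rw [← e.1, ← e.2]; exact hx
  · exact ⟨l, by simpa using hl⟩
  · exact ⟨c, by simpa using hc⟩

end PlanarRep
end

/-! ### The classification -/

section
variable {V : Type*} [Fintype V] [DecidableEq V] {G : SimpleGraph V} [DecidableRel G.Adj]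

namespace PlanarRep
variable {P Q : V → ℝ} {r s : ℝ}

/-- `interior_cases` without assuming that the orthogonal pair is adjacent: an opposite
neighbour of `l` is also orthogonal to `l`, so it can take the role of `c`. -/
theorem interior_cases_of_orthogonal (h : PlanarRep G P Q r s) {l c : V} (hl : 0 < P l * Q l)
    (hc : P c * Q c < 0) (ho : P l * P c + Q l * Q c = 0)
    {j : V} (hj : 0 < P j * Q j) (hY : P c * P j + Q c * Q j ≠ 0) :
    HasAdjMatrix G (matVI 3 5) ∨ HasAdjMatrix G (matVI 4 4) := by
  obtain ⟨x, hlx, hs⟩ := h.exists_opp_adj l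
  have hx : P x * Q x < 0 := by
    by_contra hge; push Not at hge; nlinarith [mul_nonneg hl.le hge]
  refine h.interior_cases hl hx (h.not_both_interior hl hc ho hj hY hx) hlx hj fun e0 => ?_
  have g := h.gram_of_adj (h.adj_of_interior hl ho hj hY hx)
    (not_same_of_opp (mul_neg_of_pos_of_neg hj hx))
  rw [show P j * P x + Q j * Q x = 0 by linarith] at g
  have : (innerNbrs G P Q j).card + (innerNbrs G P Q x).card = 0 := by exact_mod_cast g.symm
  exact h.innerNbrs_ne_zero_of_interior hl hc ho hj hY (by omega)

/-- If some two vertices on opposite sides have orthogonal vectors, then `G` is bipartite, or some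
vector lies off the two axes and `interior_cases` applies, possibly with the sides exchanged. -/
theorem orthogonal_cases (h : PlanarRep G P Q r s) {l c : V} (hl : 0 < P l * Q l)
    (hc : P c * Q c < 0) (ho : P l * P c + Q l * Q c = 0) :
    ((∃ m : ℕ, 3 ≤ m ∧ HasAdjMatrix G (matI m)) ∨
      (HasAdjMatrix G (bipartiteBlock matN₁) ∨ HasAdjMatrix G (bipartiteBlock matN₂))) ∨
    (HasAdjMatrix G (matVI 3 5) ∨ HasAdjMatrix G (matVI 4 4)) := by
  by_cases hL : ∀ i, 0 < P i * Q i → P c * P i + Q c * Q i = 0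
  · by_cases hR : ∀ i, P i * Q i < 0 → P l * P i + Q l * Q i = 0
    · exact Or.inl (h.bip_cases (h.isBip_of_orthogonal hl hc ho hL hR))
    · push Not at hR
      obtain ⟨j, hj, hX⟩ := hR
      exact Or.inr (h.neg.interior_cases_of_orthogonal (l := c) (c := l) (j := j)
        (by linarith) (by linarith) (by linarith) (by linarith)
        fun e => hX (by linear_combination e))
  · push Not at hL
    obtain ⟨j, hj, hY⟩ := hL
    exact Or.inr (h.interior_cases_of_orthogonal hl hc ho hj hY)

/-- If no two vertices on opposite sides have orthogonal vectors, then `G` is the join of its two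
sides, and by `gram_of_adj` on one of them all vertices have inner neighbours. -/
theorem join_cases_of_not_orthogonal (h : PlanarRep G P Q r s)
    (ho : ∀ i j, P i * Q i * (P j * Q j) < 0 → P i * P j + Q i * Q j ≠ 0) :
    (∃ a k : ℕ, 1 ≤ a ∧ 2 ≤ k ∧ HasAdjMatrix G (matII a k)) ∨
      (∃ l m : ℕ, m ≤ l ∧ 2 ≤ m ∧ HasAdjMatrix G (matIII l m)) ∨
      (HasAdjMatrix G (matV 6 5) ∨ HasAdjMatrix G (matV 4 6) ∨ HasAdjMatrix G (matV 3 8)) := by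
  have hcomp : ∀ i j, P i * Q i * (P j * Q j) < 0 → G.Adj i j := fun i j hs => by
    by_contra hn
    exact ho i j hs (h.gram_of_not_adj hn hs)
  by_cases hR : ∀ j, P j * Q j < 0 → (innerNbrs G P Q j).card ≠ 0
  · exact h.join_cases hcomp hR
  · push Not at hR
    obtain ⟨c, hc, hc0⟩ := hR
    refine h.neg.join_cases (fun i j hs => hcomp i j (by linarith)) fun j hj hj0 => ?_
    rw [innerNbrs_neg] at hj0
    have hs : P j * Q j * (P c * Q c) < 0 := mul_neg_of_pos_of_neg (by linarith) hc
    have g := h.gram_of_adj (hcomp j c hs) (not_same_of_opp hs)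
    rw [hj0, hc0] at g
    exact ho j c hs (by simpa using g)

end PlanarRep

theorem InClassG.classification (hG : InClassG G) :
    (∃ m : ℕ, 3 ≤ m ∧ HasAdjMatrix G (matI m)) ∨
      (∃ a k : ℕ, 1 ≤ a ∧ 2 ≤ k ∧ HasAdjMatrix G (matII a k)) ∨
      (∃ l m : ℕ, m ≤ l ∧ 2 ≤ m ∧ HasAdjMatrix G (matIII l m)) ∨
      (HasAdjMatrix G (bipartiteBlock matN₁) ∨ HasAdjMatrix G (bipartiteBlock matN₂)) ∨
      (HasAdjMatrix G (matV 6 5) ∨ HasAdjMatrix G (matV 4 6) ∨ HasAdjMatrix G (matV 3 8)) ∨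
      (HasAdjMatrix G (matVI 3 5) ∨ HasAdjMatrix G (matVI 4 4)) := by
  obtain ⟨P, Q, r, s, h⟩ := hG.exists_planarRep
  by_cases ho : ∀ i j, P i * Q i * (P j * Q j) < 0 → P i * P j + Q i * Q j ≠ 0
  · rcases h.join_cases_of_not_orthogonal ho with e | e | e
    · exact Or.inr (Or.inl e)
    · exact Or.inr (Or.inr (Or.inl e))
    · exact Or.inr (Or.inr (Or.inr (Or.inr (Or.inl e))))
  · push Not at ho
    obtain ⟨i, j, hs, ho⟩ := ho
    have key : ((∃ m : ℕ, 3 ≤ m ∧ HasAdjMatrix G (matI m)) ∨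
        (HasAdjMatrix G (bipartiteBlock matN₁) ∨ HasAdjMatrix G (bipartiteBlock matN₂))) ∨
        (HasAdjMatrix G (matVI 3 5) ∨ HasAdjMatrix G (matVI 4 4)) := by
      rcases lt_or_gt_of_ne (h.side_ne_zero i) with hi | hi
      · exact h.orthogonal_cases (l := j) (c := i)
          (by by_contra hge; push Not at hge
              nlinarith [mul_nonneg_of_nonpos_of_nonpos hi.le hge]) hi (by linarith)
      · exact h.orthogonal_cases hi
          (by by_contra hge; push Not at hge; nlinarith [mul_nonneg hi.le hge]) ho
    rcases key with (e | e) | e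
    · exact Or.inl e
    · exact Or.inr (Or.inr (Or.inr (Or.inl e)))
    · exact Or.inr (Or.inr (Or.inr (Or.inr (Or.inr e))))

end

/-! ### Spectra from traces and quotient matrices -/

section
variable {α : Type*} [Fintype α] [DecidableEq α]

/-- The trace of `f(M)` is the sum of the values of `f` at the eigenvalues; stated for any matrix
`B` acting on the eigenvectors of `M` by scalars. -/
theorem trace_eq_sum_of_eigenvectors {M : Matrix α α ℝ} (hM : M.IsHermitian) (B : Matrix α α ℝ)
    (f : α → ℝ) (hB : ∀ k, B *ᵥ ⇑(hM.eigenvectorBasis k) = f k • ⇑(hM.eigenvectorBasis k)) :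
    B.trace = ∑ k, f k := by
  let U : Matrix α α ℝ := hM.eigenvectorUnitary
  have hUU : U * Uᵀ = 1 := by
    have := Unitary.mul_star_self_of_mem hM.eigenvectorUnitary.2
    simpa [star_eq_conjTranspose, U] using this
  have hBU : B * U = U * diagonal f := by
    ext i k
    have hcol : (fun i => U i k) = ⇑(hM.eigenvectorBasis k) := by
      ext i; exact hM.eigenvectorUnitary_apply i k
    have := congrFun (hB k) i
    rw [← hcol] at this
    rw [mul_diagonal, mul_apply]
    simpa [mulVec, dotProduct, mul_comm] using this
  have : B = U * diagonal f * Uᵀ := by rw [← hBU, Matrix.mul_assoc, hUU, Matrix.mul_one]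
  rw [this, Matrix.trace_mul_comm, ← Matrix.mul_assoc, mul_eq_one_comm.1 hUU, Matrix.one_mul,
    trace_diagonal]

/-- A real symmetric matrix with zero diagonal annihilated by `(x² - 1)(x - r)(x - s)` has only the
eigenvalues `±1`, `r`, `s`; the traces of `M² - 1`, `M(M² - 1)`, `M` and the order determine the
multiplicities. -/
theorem matSpectrum_eq_of_trace {M : Matrix α α ℝ} (hM : M.IsHermitian) {r s : ℝ} {p q : ℕ}
    (hr : 1 < r) (hs : s < -1)
    (h0 : (M * M - (r + s) • M + (r * s) • 1) * (M * M - 1) = 0)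
    (h1 : M.trace = 0) (h2 : (M * M - 1).trace = r ^ 2 - 1 + (s ^ 2 - 1))
    (h3 : (M * (M * M - 1)).trace = r * (r ^ 2 - 1) + s * (s ^ 2 - 1))
    (hcard : p + q + 2 = Fintype.card α) (hpq : r + s + p - q = 0) :
    matSpectrum M = specMultiset r s p q := by
  have hroots : matSpectrum M = Finset.univ.val.map hM.eigenvalues := by
    rw [matSpectrum, hM.roots_charpoly_eq_eigenvalues]; rfl
  set ev := hM.eigenvalues with hev
  have e1 : ∀ k, M *ᵥ ⇑(hM.eigenvectorBasis k) = ev k • ⇑(hM.eigenvectorBasis k) :=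
    hM.mulVec_eigenvectorBasis
  have e2 : ∀ k, (M * M - 1) *ᵥ ⇑(hM.eigenvectorBasis k)
      = (ev k ^ 2 - 1) • ⇑(hM.eigenvectorBasis k) := by
    intro k
    rw [sub_mulVec, ← mulVec_mulVec, e1, mulVec_smul, e1, one_mulVec, sub_smul, one_smul, pow_two,
      mul_smul]
  have e3 : ∀ k, (M * (M * M - 1)) *ᵥ ⇑(hM.eigenvectorBasis k)
      = (ev k * (ev k ^ 2 - 1)) • ⇑(hM.eigenvectorBasis k) := by
    intro k
    rw [← mulVec_mulVec, e2, mulVec_smul, e1, smul_smul, mul_comm]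
  have e4 : ∀ k, (ev k - r) * (ev k - s) * (ev k ^ 2 - 1) = 0 := by
    intro k
    have := congrArg (· *ᵥ ⇑(hM.eigenvectorBasis k)) h0
    simp only [← mulVec_mulVec, e2, mulVec_smul, zero_mulVec, add_mulVec, sub_mulVec, smul_mulVec,
      one_mulVec, e1, smul_smul, ← sub_smul, ← add_smul] at this
    have hne : (⇑(hM.eigenvectorBasis k) : α → ℝ) ≠ 0 := by
      intro e
      exact hM.eigenvectorBasis.orthonormal.ne_zero k (by ext i; exact congrFun e i)
    have := (smul_eq_zero.1 this).resolve_right hne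
    linear_combination this
  have hval : ∀ k, ev k = r ∨ ev k = s ∨ ev k = 1 ∨ ev k = -1 := by
    intro k
    rcases mul_eq_zero.1 (e4 k) with h | h
    · rcases mul_eq_zero.1 h with h | h
      · exact Or.inl (by linarith)
      · exact Or.inr (Or.inl (by linarith))
    · have : (ev k - 1) * (ev k + 1) = 0 := by linear_combination h
      rcases mul_eq_zero.1 this with h | h
      · exact Or.inr (Or.inr (Or.inl (by linarith)))
      · exact Or.inr (Or.inr (Or.inr (by linarith)))
  -- For each `f`, summing `f` over the eigenvalues amounts to weighting by multiplicities.
  let n : ℝ → ℕ := fun x => (Finset.univ.filter fun k => ev k = x).card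
  have hsum : ∀ f : ℝ → ℝ, ∑ k, f (ev k) = n r * f r + n s * f s + n 1 * f 1 + n (-1) * f (-1) := by
    intro f
    have hn : ∀ x, (n x : ℝ) * f x = ∑ k, if ev k = x then f x else 0 := by
      intro x
      rw [← Finset.sum_filter, Finset.sum_const, nsmul_eq_mul]
    rw [hn, hn, hn, hn, ← Finset.sum_add_distrib, ← Finset.sum_add_distrib,
      ← Finset.sum_add_distrib]
    refine Finset.sum_congr rfl fun k _ => ?_
    rcases hval k with h | h | h | h
    · rw [h, if_pos rfl, if_neg (by linarith), if_neg (by linarith), if_neg (by linarith)]; ring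
    · rw [h, if_neg (by linarith), if_pos rfl, if_neg (by linarith), if_neg (by linarith)]; ring
    · rw [h, if_neg (by linarith), if_neg (by linarith), if_pos rfl, if_neg (by norm_num)]; ring
    · rw [h, if_neg (by linarith), if_neg (by linarith), if_neg (by norm_num), if_pos rfl]; ring
  have t0 := hsum fun _ => 1
  have t1 := hsum fun x => x
  have t2 := hsum fun x => x ^ 2 - 1
  have t3 := hsum fun x => x * (x ^ 2 - 1)
  rw [← trace_eq_sum_of_eigenvectors hM _ _ e1, h1] at t1
  rw [← trace_eq_sum_of_eigenvectors hM _ _ e2, h2] at t2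
  rw [← trace_eq_sum_of_eigenvectors hM _ _ e3, h3] at t3
  rw [Finset.sum_const, Finset.card_univ, nsmul_eq_mul, ← hcard] at t0
  push_cast at t0
  have hr2 : r ^ 2 - 1 ≠ 0 := by nlinarith
  have hs2 : s ^ 2 - 1 ≠ 0 := by nlinarith
  have hrs : r - s ≠ 0 := by linarith
  have nr : (n r : ℝ) = 1 := by
    have : (r - s) * (r ^ 2 - 1) * (n r - 1) = 0 := by linear_combination s * t2 - t3
    linarith [(mul_eq_zero.1 this).resolve_left (mul_ne_zero hrs hr2)]
  have ns : (n s : ℝ) = 1 := by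
    have : (r - s) * (s ^ 2 - 1) * (n s - 1) = 0 := by linear_combination t3 - r * t2
    linarith [(mul_eq_zero.1 this).resolve_left (mul_ne_zero hrs hs2)]
  rw [nr, ns] at t0 t1
  have np : (n 1 : ℝ) = p := by linarith
  have nq : (n (-1) : ℝ) = q := by linarith
  rw [Nat.cast_inj] at np nq
  rw [Nat.cast_eq_one] at nr ns
  have hcount : ∀ x, (Finset.univ.val.map ev).count x = n x := by
    intro x
    rw [Multiset.count_map]
    simp only [n, Finset.card_def, Finset.filter_val, eq_comm]
  rw [hroots]
  ext x
  rw [hcount]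
  have hc : (specMultiset r s p q).count x = (if x = r then 1 else 0) + (if x = s then 1 else 0)
      + (if x = 1 then p else 0) + (if x = -1 then q else 0) := by
    simp only [specMultiset, Multiset.count_add, Multiset.count_replicate, Multiset.insert_eq_cons,
      Multiset.count_cons, Multiset.count_singleton, eq_comm (a := x)]
    ring
  rw [hc]
  by_cases xr : x = r
  · rw [if_pos xr, if_neg (by linarith), if_neg (by linarith), if_neg (by linarith), xr, nr]
  by_cases xs : x = s
  · rw [if_neg xr, if_pos xs, if_neg (by linarith), if_neg (by linarith), xs, ns]
  by_cases x1 : x = 1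
  · rw [if_neg xr, if_neg xs, if_pos x1, if_neg (by linarith), x1, np]; ring
  by_cases x2 : x = -1
  · rw [if_neg xr, if_neg xs, if_neg x1, if_pos x2, x2, nq]; ring
  rw [if_neg xr, if_neg xs, if_neg x1, if_neg x2, Finset.card_eq_zero, Finset.filter_eq_empty_iff]
  intro k _ e
  rcases hval k with h | h | h | h
  exacts [xr (e ▸ h), xs (e ▸ h), x1 (e ▸ h), x2 (e ▸ h)]

/-- The spectrum of a matrix `M` with an equitable partition `κ` (quotient matrix `Qm`) for which
`M² - 1` is constant, with values `b`, on the blocks: all conditions become conditions on the small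
matrices `Qm` and `b`, and they involve `r` and `s` only through `T = r + s` and `D = r * s`. -/
theorem matSpectrum_eq_of_quotient {ι : Type*} [Fintype ι] {M : Matrix α α ℝ}
    (hM : M.IsAdjMatrix) (κ : α → ι) (Qm b : Matrix ι ι ℝ) {r s T D : ℝ} {p q : ℕ}
    (hr : 1 < r) (hs : s < -1) (hT : r + s = T) (hD : r * s = D)
    (hQ : ∀ (f : ι → ℝ) i, ∑ k, M i k * f (κ k) = ∑ C, Qm (κ i) C * f C)
    (hb : ∀ i j, (M * M) i j = b (κ i) (κ j) + if i = j then 1 else 0)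
    (h0 : Qm * (Qm * b) - T • (Qm * b) + D • b = 0)
    (h2 : ∑ i, b (κ i) (κ i) = T ^ 2 - 2 * D - 2)
    (h3 : ∑ i, (Qm * b) (κ i) (κ i) = T ^ 3 - 3 * T * D - T)
    (hcard : p + q + 2 = Fintype.card α) (hpq : T + p - q = 0) :
    matSpectrum M = specMultiset r s p q := by
  subst hT hD
  have hB : M * M - 1 = Matrix.of fun i j => b (κ i) (κ j) := by
    ext i j
    rw [Matrix.sub_apply, hb, one_apply, of_apply]; ring
  have hMB : ∀ c : Matrix ι ι ℝ, M * (Matrix.of fun i j => c (κ i) (κ j))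
      = Matrix.of fun i j => (Qm * c) (κ i) (κ j) := by
    intro c
    ext i j
    rw [mul_apply, of_apply, mul_apply]
    exact hQ (fun C => c C (κ j)) i
  refine matSpectrum_eq_of_trace ?_ hr hs ?_ ?_ ?_ ?_ hcard hpq
  · rw [IsHermitian, conjTranspose_eq_transpose_of_trivial]; exact hM.symm
  · rw [add_mul, sub_mul, smul_mul, smul_mul, Matrix.mul_assoc, Matrix.one_mul, hB, hMB, hMB]
    ext i j
    have := congrFun (congrFun h0 (κ i)) (κ j)
    simpa using this
  · exact Finset.sum_eq_zero fun i _ => hM.apply_diag i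
  · rw [hB]
    simp only [trace, diag_apply, of_apply, h2]; ring
  · rw [hB, hMB]
    simp only [trace, diag_apply, of_apply, h3]; ring

end

/-! ### Spectra of the listed matrices -/

theorem JsubI_comm (n : ℕ) (i j : Fin n) : JsubI n i j = JsubI n j i := by
  simp only [JsubI_apply, eq_comm]

theorem revId_comm (n : ℕ) (i j : Fin n) : revId n i j = revId n j i := by
  have : i = Fin.rev j ↔ j = Fin.rev i := by rw [eq_comm, Fin.rev_eq_iff]
  simp only [revId_apply, this]

theorem sum_JsubI (n : ℕ) (i : Fin n) : ∑ k, JsubI n i k = n - 1 := by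
  simp [JsubI, allOnes, Finset.sum_sub_distrib, one_apply]

theorem sum_JsubI' (n : ℕ) (i : Fin n) : ∑ k, JsubI n k i = n - 1 := by
  rw [← sum_JsubI n i]; exact Finset.sum_congr rfl fun k _ => JsubI_comm n k i

/-- The entries of `(J - I)² = (n - 2) J + I`. -/
theorem sum_JsubI_mul_JsubI (n : ℕ) (i j : Fin n) :
    ∑ k, JsubI n i k * JsubI n k j = n - 2 + if i = j then 1 else 0 := by
  have : ∀ k, JsubI n i k * JsubI n k j = JsubI n i k - if k = j then JsubI n i j else 0 := by
    intro k
    by_cases h : k = j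
    · simp [h, JsubI_apply]
    · simp [h, JsubI_apply n k j]
  simp only [this, Finset.sum_sub_distrib, sum_JsubI, Finset.sum_ite_eq', Finset.mem_univ, if_true]
  rw [JsubI_apply]
  split_ifs <;> ring

theorem sum_revId (n : ℕ) (i : Fin n) : ∑ k, revId n i k = 1 := by
  simp only [revId_comm n i, revId_apply]
  simp

theorem sum_revId' (n : ℕ) (i : Fin n) : ∑ k, revId n k i = 1 := by
  simp [revId_apply]

theorem sum_revId_mul_revId (n : ℕ) (i j : Fin n) :
    ∑ k, revId n i k * revId n k j = if i = j then 1 else 0 := by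
  simp [revId_apply]

theorem revId_self (k : ℕ) (i : Fin (2 * k)) : revId (2 * k) i i = 0 := by
  rw [revId_apply, if_neg]
  intro h
  have := congrArg Fin.val h
  rw [Fin.val_rev] at this
  omega

theorem JsubI_eq_zero_or_one (n : ℕ) (i j : Fin n) : JsubI n i j = 0 ∨ JsubI n i j = 1 := by
  rw [JsubI_apply]; split_ifs <;> simp

theorem revId_eq_zero_or_one (n : ℕ) (i j : Fin n) : revId n i j = 0 ∨ revId n i j = 1 := by
  rw [revId_apply]; split_ifs <;> simp

theorem isAdjMatrix_matI (m : ℕ) : (matI m).IsAdjMatrix where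
  zero_or_one := by
    rintro (i | i) (j | j) <;> simp [matI, JsubI_eq_zero_or_one]
  symm := by
    ext (i | i) (j | j) <;>
      first | exact JsubI_comm _ _ _ | exact revId_comm _ _ _ | rfl
  apply_diag := by
    rintro (i | i) <;> simp [matI]

theorem isAdjMatrix_matII (a k : ℕ) : (matII a k).IsAdjMatrix where
  zero_or_one := by
    rintro (i | i) (j | j) <;>
      simp [matII, JsubI_eq_zero_or_one, revId_eq_zero_or_one, allOnes_apply]
  symm := by
    ext (i | i) (j | j) <;>
      first | exact JsubI_comm _ _ _ | exact revId_comm _ _ _ | rfl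
  apply_diag := by
    rintro (i | i) <;> simp [matII, JsubI_apply, revId_self]

theorem isAdjMatrix_matIII (l m : ℕ) : (matIII l m).IsAdjMatrix where
  zero_or_one := by
    rintro (i | i) (j | j) <;> simp [matIII, revId_eq_zero_or_one, allOnes_apply]
  symm := by
    ext (i | i) (j | j) <;>
      first | exact JsubI_comm _ _ _ | exact revId_comm _ _ _ | rfl
  apply_diag := by
    rintro (i | i) <;> simp [matIII, revId_self]

theorem isAdjMatrix_bipartiteBlock {α β : Type*} {N : Matrix α β ℝ}
    (hN : ∀ i j, N i j = 0 ∨ N i j = 1) : (bipartiteBlock N).IsAdjMatrix where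
  zero_or_one := by
    rintro (i | i) (j | j) <;> simp [bipartiteBlock, hN]
  symm := by
    ext (i | i) (j | j) <;> simp [bipartiteBlock]
  apply_diag := by
    rintro (i | i) <;> simp [bipartiteBlock]

theorem isAdjMatrix_matN₁ : (bipartiteBlock matN₁).IsAdjMatrix := by
  refine isAdjMatrix_bipartiteBlock ?_
  rintro (i | i) (j | j) <;> simp [matN₁, allOnes_apply, one_apply, em']

theorem isAdjMatrix_matN₂ : (bipartiteBlock matN₂).IsAdjMatrix := by
  refine isAdjMatrix_bipartiteBlock ?_
  rintro (i | i) (j | j) <;> simp [matN₂, allOnes_apply, JsubI_eq_zero_or_one]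

theorem isAdjMatrix_matV (a b : ℕ) : (matV a b).IsAdjMatrix where
  zero_or_one := by
    rintro (i | i | i) (j | j | j) <;>
      simp [matV, blocks3, JsubI_eq_zero_or_one, allOnes_apply]
  symm := by
    ext (i | i | i) (j | j | j) <;>
      first | exact JsubI_comm _ _ _ | exact revId_comm _ _ _ | rfl
  apply_diag := by
    rintro (i | i | i) <;> simp [matV, blocks3, JsubI_apply]

theorem isAdjMatrix_matVI (a m : ℕ) : (matVI a m).IsAdjMatrix where
  zero_or_one := by
    rintro (i | i | i) (j | j | j) <;>
      simp [matVI, blocks3, JsubI_eq_zero_or_one, allOnes_apply]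
  symm := by
    ext (i | i | i) (j | j | j) <;>
      first | exact JsubI_comm _ _ _ | exact revId_comm _ _ _ | rfl
  apply_diag := by
    rintro (i | i | i) <;> simp [matVI, blocks3, JsubI_apply]

theorem matSpectrum_matI {m : ℕ} (hm : 3 ≤ m) : matSpectrum (matI m)
    = specMultiset ((m : ℝ) - 1) (-((m : ℝ) - 1)) (m - 1) (m - 1) := by
  have hm' : (3 : ℝ) ≤ m := by exact_mod_cast hm
  refine matSpectrum_eq_of_quotient (isAdjMatrix_matI m) (Sum.elim (fun _ => 0) fun _ => 1)
    !![0, (m : ℝ) - 1; (m : ℝ) - 1, 0] !![(m : ℝ) - 2, 0; 0, (m : ℝ) - 2] (T := 0)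
    (D := -((m : ℝ) - 1) ^ 2) (by linarith) (by linarith) (by ring) (by ring) ?_ ?_ ?_ ?_ ?_ ?_ ?_
  · rintro f (i | i) <;>
      simp [matI, Fintype.sum_sum_type, Fin.sum_univ_succ, ← Finset.sum_mul, sum_JsubI]
  · rintro (i | i) (j | j) <;>
      simp [matI, mul_apply, Fintype.sum_sum_type, sum_JsubI_mul_JsubI]
  · ext i j
    fin_cases i <;> fin_cases j <;> simp <;> ring
  · simp [Fintype.sum_sum_type]; ring
  · simp [Fintype.sum_sum_type, mul_apply, Fin.sum_univ_succ]
  · simp; omega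
  · simp

/-- The lower bound puts the roots `a / 2 ± √… / 2` above `1` and below `-1`. -/
theorem roots_matII {a k : ℕ} (ha : 1 ≤ a) (hk : 2 ≤ k) :
    (a : ℝ) + 2 < √((a : ℝ) ^ 2 + 8 * (a : ℝ) * (k : ℝ) - 4 * (a : ℝ) + 4) ∧
    √((a : ℝ) ^ 2 + 8 * (a : ℝ) * (k : ℝ) - 4 * (a : ℝ) + 4) ^ 2
      = (a : ℝ) ^ 2 + 8 * (a : ℝ) * (k : ℝ) - 4 * (a : ℝ) + 4 := by
  have ha' : (1 : ℝ) ≤ a := by exact_mod_cast ha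
  have hk' : (2 : ℝ) ≤ k := by exact_mod_cast hk
  have h : (a : ℝ) * 2 ≤ a * k := by gcongr
  exact ⟨Real.lt_sqrt_of_sq_lt (by nlinarith), Real.sq_sqrt (by nlinarith)⟩

theorem matSpectrum_matII {a k : ℕ} (ha : 1 ≤ a) (hk : 2 ≤ k) : matSpectrum (matII a k)
    = specMultiset
        ((a : ℝ) / 2 + 1 / 2 * √((a : ℝ) ^ 2 + 8 * (a : ℝ) * (k : ℝ) - 4 * (a : ℝ) + 4))
        ((a : ℝ) / 2 - 1 / 2 * √((a : ℝ) ^ 2 + 8 * (a : ℝ) * (k : ℝ) - 4 * (a : ℝ) + 4))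
        (k - 1) (a + k - 1) := by
  obtain ⟨h1, h2⟩ := roots_matII ha hk
  have ha' : (1 : ℝ) ≤ a := by exact_mod_cast ha
  refine matSpectrum_eq_of_quotient (isAdjMatrix_matII a k) (Sum.elim (fun _ => 0) fun _ => 1)
    !![(a : ℝ) - 1, 2 * k; (a : ℝ), 1] !![(a : ℝ) + 2 * k - 2, a; (a : ℝ), a] (T := a)
    (D := -(2 * a * k - a + 1)) (by linarith) (by linarith) (by ring) (by linear_combination -h2 / 4)
    ?_ ?_ ?_ ?_ ?_ ?_ ?_
  · rintro f (i | i) <;>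
      simp [matII, Fintype.sum_sum_type, Fin.sum_univ_succ, ← Finset.sum_mul, sum_JsubI, sum_revId,
        allOnes_apply]
  · rintro (i | i) (j | j) <;>
      simp [matII, mul_apply, Fintype.sum_sum_type, sum_JsubI_mul_JsubI, sum_JsubI, sum_JsubI',
        sum_revId, sum_revId', sum_revId_mul_revId, allOnes_apply]
    ring
  · ext i j
    fin_cases i <;> fin_cases j <;> simp <;> ring
  · simp [Fintype.sum_sum_type]; ring
  · simp [Fintype.sum_sum_type, mul_apply, Fin.sum_univ_succ]; ring
  · simp; omega
  · rw [Nat.cast_sub (by omega), Nat.cast_sub (by omega)]; push_cast; ring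

theorem two_le_sqrt_mul {l m : ℕ} (hml : m ≤ l) (hm : 2 ≤ m) : 2 ≤ √((l : ℝ) * (m : ℝ)) := by
  have hl' : (2 : ℝ) ≤ l := by exact_mod_cast hm.trans hml
  have hm' : (2 : ℝ) ≤ m := by exact_mod_cast hm
  exact Real.le_sqrt_of_sq_le (by nlinarith)

theorem matSpectrum_matIII {l m : ℕ} (hml : m ≤ l) (hm : 2 ≤ m) : matSpectrum (matIII l m)
    = specMultiset (1 + 2 * √((l : ℝ) * (m : ℝ))) (1 - 2 * √((l : ℝ) * (m : ℝ)))
        (l + m - 2) (l + m) := by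
  have h1 := two_le_sqrt_mul hml hm
  have h2 : √((l : ℝ) * (m : ℝ)) ^ 2 = l * m := Real.sq_sqrt (by positivity)
  refine matSpectrum_eq_of_quotient (isAdjMatrix_matIII l m) (Sum.elim (fun _ => 0) fun _ => 1)
    !![1, 2 * (m : ℝ); 2 * (l : ℝ), 1] !![2 * (m : ℝ), 2; 2, 2 * (l : ℝ)] (T := 2)
    (D := 1 - 4 * l * m) (by linarith) (by linarith) (by ring) (by linear_combination -4 * h2)
    ?_ ?_ ?_ ?_ ?_ ?_ ?_
  · rintro f (i | i) <;>
      simp [matIII, Fintype.sum_sum_type, Fin.sum_univ_succ, ← Finset.sum_mul, sum_revId,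
        allOnes_apply]
  · rintro (i | i) (j | j) <;>
      simp [matIII, mul_apply, Fintype.sum_sum_type,
        sum_revId, sum_revId', sum_revId_mul_revId, allOnes_apply] <;> ring
  · ext i j
    fin_cases i <;> fin_cases j <;> simp <;> ring
  · simp [Fintype.sum_sum_type]; ring
  · simp [Fintype.sum_sum_type, mul_apply, Fin.sum_univ_succ]; ring
  · simp; omega
  · rw [Nat.cast_sub (by omega)]; push_cast; ring

theorem matSpectrum_matN₁ : matSpectrum (bipartiteBlock matN₁) = specMultiset 3 (-3) 4 4 := by
  refine matSpectrum_eq_of_quotient isAdjMatrix_matN₁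
    (Sum.elim (Sum.elim (fun _ => 0) fun _ => 1) (Sum.elim (fun _ => 2) fun _ => 3))
    !![0, 0, 1, 4; 0, 0, 1, 1; 1, 4, 0, 0; 1, 1, 0, 0]
    !![4, 2, 0, 0; 2, 1, 0, 0; 0, 0, 4, 2; 0, 0, 2, 1] (T := 0) (D := -9)
    (by norm_num) (by norm_num) (by norm_num) (by norm_num) ?_ ?_ ?_ ?_ ?_ ?_ ?_
  · rintro f ((i | i) | (i | i)) <;>
      simp [bipartiteBlock, matN₁, Fintype.sum_sum_type, Fin.sum_univ_four,
        allOnes_apply, one_apply]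
  · rintro ((i | i) | (i | i)) ((j | j) | (j | j)) <;>
      simp [bipartiteBlock, matN₁, mul_apply, Fintype.sum_sum_type, allOnes_apply, one_apply,
        eq_comm] <;> norm_num
  · ext i j
    fin_cases i <;> fin_cases j <;> simp <;> norm_num
  · simp [Fintype.sum_sum_type]; norm_num
  · simp [Fintype.sum_sum_type, mul_apply, Fin.sum_univ_four]
  · simp
  · norm_num

theorem matSpectrum_matN₂ : matSpectrum (bipartiteBlock matN₂) = specMultiset 4 (-4) 5 5 := by
  refine matSpectrum_eq_of_quotient isAdjMatrix_matN₂
    (Sum.elim (Sum.elim (fun _ => 0) fun _ => 1) (Sum.elim (fun _ => 2) fun _ => 3))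
    !![0, 0, 2, 3; 0, 0, 0, 2; 2, 0, 0, 0; 3, 2, 0, 0]
    !![4, 2, 0, 0; 2, 1, 0, 0; 0, 0, 1, 2; 0, 0, 2, 4] (T := 0) (D := -16)
    (by norm_num) (by norm_num) (by norm_num) (by norm_num) ?_ ?_ ?_ ?_ ?_ ?_ ?_
  · rintro f ((i | i) | (i | i)) <;>
      simp [bipartiteBlock, matN₂, Fintype.sum_sum_type, Fin.sum_univ_four, ← Finset.sum_mul,
        allOnes_apply, sum_JsubI, sum_JsubI'] <;> norm_num
  · rintro ((i | i) | (i | i)) ((j | j) | (j | j)) <;>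
      simp [bipartiteBlock, matN₂, mul_apply, Fintype.sum_sum_type, allOnes_apply, sum_JsubI,
        sum_JsubI', sum_JsubI_mul_JsubI, JsubI_comm 3 _ i, JsubI_comm 3 j] <;> ring
  · ext i j
    fin_cases i <;> fin_cases j <;> simp <;> norm_num
  · simp [Fintype.sum_sum_type]; norm_num
  · simp [Fintype.sum_sum_type, mul_apply, Fin.sum_univ_four]
  · simp
  · norm_num

/-- The quotient matrix of the partition of `matV a b` into its three blocks. -/
def quotientV (a b : ℝ) : Matrix (Fin 3) (Fin 3) ℝ := !![a - 1, b, 1; a, b - 1, 0; a, 0, 0]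

/-- The values of `(matV a b)² - 1` on the blocks. -/
def squareV (a b : ℝ) : Matrix (Fin 3) (Fin 3) ℝ :=
  !![a + b - 1, a + b - 2, a - 1; a + b - 2, a + b - 2, a; a - 1, a, a - 1]

/-- The quotient matrix of the partition of `matVI a m` into its three blocks. -/
def quotientVI (a m : ℝ) : Matrix (Fin 3) (Fin 3) ℝ := !![a - 1, m, 0; a, 0, m - 1; 0, m - 1, 0]

/-- The values of `(matVI a m)² - 1` on the blocks. -/
def squareVI (a m : ℝ) : Matrix (Fin 3) (Fin 3) ℝ :=
  !![a + m - 2, a - 1, m - 1; a - 1, a + m - 2, 0; m - 1, 0, m - 2]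

/-- Reduction of the spectrum of `matV a b` to numerical identities; `h2` and `h3` compare the
traces of `M² - 1` and `M (M² - 1)` with the power sums of `r` and `s`. -/
theorem matSpectrum_matV {a b p q : ℕ} {r s T D : ℝ} (hr : 1 < r) (hs : s < -1)
    (hT : r + s = T) (hD : r * s = D)
    (h0 : quotientV a b * (quotientV a b * squareV a b) - T • (quotientV a b * squareV a b)
      + D • squareV a b = 0)
    (h2 : (a : ℝ) * (a + b - 1) + b * (a + b - 2) + (a - 1) = T ^ 2 - 2 * D - 2)
    (h3 : (a : ℝ) * ((a - 1) * (a + b - 1) + b * (a + b - 2) + (a - 1))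
        + b * (a * (a + b - 2) + (b - 1) * (a + b - 2)) + a * (a - 1) = T ^ 3 - 3 * T * D - T)
    (hcard : p + q + 2 = a + b + 1) (hpq : T + p - q = 0) :
    matSpectrum (matV a b) = specMultiset r s p q := by
  refine matSpectrum_eq_of_quotient (isAdjMatrix_matV a b)
    (Sum.elim (fun _ => 0) (Sum.elim (fun _ => 1) fun _ => 2)) _ _ hr hs hT hD
    ?_ ?_ h0 ?_ ?_ ?_ hpq
  · rintro f (i | i | i) <;>
      simp [matV, quotientV, blocks3, Fintype.sum_sum_type, Fin.sum_univ_three, ← Finset.sum_mul,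
        sum_JsubI, allOnes_apply]
    ring
  · rintro (i | i | i) (j | j | j) <;>
      simp [matV, squareV, blocks3, mul_apply, Fintype.sum_sum_type, sum_JsubI_mul_JsubI,
        sum_JsubI, sum_JsubI', allOnes_apply] <;> ring
  · simp [squareV, Fintype.sum_sum_type]; linarith
  · simp [quotientV, squareV, Fintype.sum_sum_type, mul_apply, Fin.sum_univ_three]; linarith
  · simp [hcard]; ring

/-- Reduction of the spectrum of `matVI a m` to numerical identities, as in `matSpectrum_matV`. -/
theorem matSpectrum_matVI {a m p q : ℕ} {r s T D : ℝ} (hr : 1 < r) (hs : s < -1)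
    (hT : r + s = T) (hD : r * s = D)
    (h0 : quotientVI a m * (quotientVI a m * squareVI a m) - T • (quotientVI a m * squareVI a m)
      + D • squareVI a m = 0)
    (h2 : (a : ℝ) * (a + m - 2) + m * (a + m - 2) + m * (m - 2) = T ^ 2 - 2 * D - 2)
    (h3 : (a : ℝ) * ((a - 1) * (a + m - 2) + m * (a - 1)) + m * (a * (a - 1) + (m - 1) * 0)
        + m * ((m - 1) * 0) = T ^ 3 - 3 * T * D - T)
    (hcard : p + q + 2 = a + m + m) (hpq : T + p - q = 0) :
    matSpectrum (matVI a m) = specMultiset r s p q := by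
  refine matSpectrum_eq_of_quotient (isAdjMatrix_matVI a m)
    (Sum.elim (fun _ => 0) (Sum.elim (fun _ => 1) fun _ => 2)) _ _ hr hs hT hD
    ?_ ?_ h0 ?_ ?_ ?_ hpq
  · rintro f (i | i | i) <;>
      simp [matVI, quotientVI, blocks3, Fintype.sum_sum_type, Fin.sum_univ_three, ← Finset.sum_mul,
        sum_JsubI, allOnes_apply]
  · rintro (i | i | i) (j | j | j) <;>
      simp [matVI, squareVI, blocks3, mul_apply, Fintype.sum_sum_type, sum_JsubI_mul_JsubI,
        sum_JsubI, sum_JsubI', allOnes_apply] <;> ring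
  · simp [squareVI, Fintype.sum_sum_type]; linarith
  · simp [quotientVI, squareVI, Fintype.sum_sum_type, mul_apply, Fin.sum_univ_three]; linarith
  · simp [hcard]; ring

theorem five_halves_lt_sqrt_10 : 5 / 2 < √(10 : ℝ) := Real.lt_sqrt_of_sq_lt (by norm_num)

theorem nine_lt_sqrt_129 : 9 < √(129 : ℝ) := Real.lt_sqrt_of_sq_lt (by norm_num)

theorem five_lt_sqrt_37 : 5 < √(37 : ℝ) := Real.lt_sqrt_of_sq_lt (by norm_num)

theorem two_lt_sqrt_7 : 2 < √(7 : ℝ) := Real.lt_sqrt_of_sq_lt (by norm_num)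

theorem matSpectrum_matV_6_5 :
    matSpectrum (matV 6 5) = specMultiset (4 + 2 * √10) (4 - 2 * √10) 1 9 := by
  have h1 := five_halves_lt_sqrt_10
  have h2 : √(10 : ℝ) ^ 2 = 10 := Real.sq_sqrt (by norm_num)
  refine matSpectrum_matV (T := 8) (D := -24) (by linarith) (by linarith) (by ring)
    (by linear_combination -4 * h2) ?_ (by norm_num) (by norm_num) (by norm_num) (by norm_num)
  ext i j
  fin_cases i <;> fin_cases j <;> simp [quotientV, squareV] <;> norm_num

theorem matSpectrum_matV_4_6 :
    matSpectrum (matV 4 6) = specMultiset ((7 + √129) / 2) ((7 - √129) / 2) 1 8 := by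
  have h1 := nine_lt_sqrt_129
  have h2 : √(129 : ℝ) ^ 2 = 129 := Real.sq_sqrt (by norm_num)
  refine matSpectrum_matV (T := 7) (D := -20) (by linarith) (by linarith) (by ring)
    (by linear_combination -h2 / 4) ?_ (by norm_num) (by norm_num) (by norm_num) (by norm_num)
  ext i j
  fin_cases i <;> fin_cases j <;> simp [quotientV, squareV] <;> norm_num

theorem matSpectrum_matV_3_8 :
    matSpectrum (matV 3 8) = specMultiset (4 + √37) (4 - √37) 1 9 := by
  have h1 := five_lt_sqrt_37
  have h2 : √(37 : ℝ) ^ 2 = 37 := Real.sq_sqrt (by norm_num)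
  refine matSpectrum_matV (T := 8) (D := -21) (by linarith) (by linarith) (by ring)
    (by linear_combination -h2) ?_ (by norm_num) (by norm_num) (by norm_num) (by norm_num)
  ext i j
  fin_cases i <;> fin_cases j <;> simp [quotientV, squareV] <;> norm_num

theorem matSpectrum_matVI_3_5 :
    matSpectrum (matVI 3 5) = specMultiset ((1 + √129) / 2) ((1 - √129) / 2) 5 6 := by
  have h1 := nine_lt_sqrt_129
  have h2 : √(129 : ℝ) ^ 2 = 129 := Real.sq_sqrt (by norm_num)
  refine matSpectrum_matVI (T := 1) (D := -32) (by linarith) (by linarith) (by ring)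
    (by linear_combination -h2 / 4) ?_ (by norm_num) (by norm_num) (by norm_num) (by norm_num)
  ext i j
  fin_cases i <;> fin_cases j <;> simp [quotientVI, squareVI] <;> norm_num

theorem matSpectrum_matVI_4_4 :
    matSpectrum (matVI 4 4) = specMultiset (1 + 2 * √7) (1 - 2 * √7) 4 6 := by
  have h1 := two_lt_sqrt_7
  have h2 : √(7 : ℝ) ^ 2 = 7 := Real.sq_sqrt (by norm_num)
  refine matSpectrum_matVI (T := 2) (D := -27) (by linarith) (by linarith) (by ring)
    (by linear_combination -4 * h2) ?_ (by norm_num) (by norm_num) (by norm_num) (by norm_num)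
  ext i j
  fin_cases i <;> fin_cases j <;> simp [quotientVI, squareVI] <;> norm_num

/-! ### Connectedness and the converse -/

section
variable {α : Type*} {M : Matrix α α ℝ}

theorem connected_of_reachable (hM : M.IsAdjMatrix) (v : α)
    (h : ∀ x, hM.toGraph.Reachable v x) : hM.toGraph.Connected :=
  (SimpleGraph.connected_iff_exists_forall_reachable _).2 ⟨v, h⟩

theorem reachable_of_entry (hM : M.IsAdjMatrix) {v w : α} (h : M v w = 1) :
    hM.toGraph.Reachable v w :=
  SimpleGraph.Adj.reachable h

/-- Connectedness and spectrum are invariant under reordering the vertices. -/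
theorem inClassG_of_hasAdjMatrix [Fintype α] [DecidableEq α] {V : Type*} [Fintype V]
    [DecidableEq V] {G : SimpleGraph V} [DecidableRel G.Adj] (h : HasAdjMatrix G M)
    (hM : M.IsAdjMatrix) (hc : hM.toGraph.Connected) {r s : ℝ} {p q : ℕ}
    (hspec : matSpectrum M = specMultiset r s p q) (hr : 1 < r) (hs : s < -1) : InClassG G := by
  obtain ⟨e, rfl⟩ := h
  refine ⟨?_, r, s, p, q, hr, hs, ?_⟩
  · let φ : G ≃g hM.toGraph := ⟨e, by intro x y; simp⟩
    exact φ.connected_iff.2 hc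
  · rw [← hspec, matSpectrum, matSpectrum, charpoly_reindex]

theorem exists_ne_ne_of_three_le {m : ℕ} (hm : 3 ≤ m) (i j : Fin m) : ∃ k, k ≠ i ∧ k ≠ j := by
  have : ({i, j} : Finset (Fin m)).card < (Finset.univ : Finset (Fin m)).card := by
    rw [Finset.card_univ, Fintype.card_fin]
    exact Finset.card_le_two.trans_lt hm
  obtain ⟨k, -, hk⟩ := Finset.exists_mem_notMem_of_card_lt_card this
  exact ⟨k, by simpa using hk⟩

theorem connected_matI {m : ℕ} (hm : 3 ≤ m) : (isAdjMatrix_matI m).toGraph.Connected := by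
  set hM := isAdjMatrix_matI m
  have h1 : ∀ i j : Fin m, i ≠ j → hM.toGraph.Reachable (Sum.inl i) (Sum.inr j) := fun i j hij =>
    reachable_of_entry hM (by simp [matI, JsubI_apply, hij])
  have h2 : ∀ i j : Fin m, hM.toGraph.Reachable (Sum.inl i) (Sum.inl j) := fun i j => by
    obtain ⟨k, hi, hj⟩ := exists_ne_ne_of_three_le hm i j
    exact (h1 i k hi.symm).trans (h1 j k hj.symm).symm
  refine connected_of_reachable hM (Sum.inl ⟨0, by omega⟩) ?_
  rintro (i | i)
  · exact h2 _ _
  · obtain ⟨k, hk, -⟩ := exists_ne_ne_of_three_le hm i i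
    exact (h2 _ k).trans (h1 k i hk)

/-- The join of two nonempty graphs is connected. -/
theorem connected_of_join {β γ : Type*} {A : Matrix β β ℝ} {D : Matrix γ γ ℝ} (x : β) (y : γ)
    (hM : (Matrix.fromBlocks A (allOnes β γ) (allOnes γ β) D).IsAdjMatrix) :
    hM.toGraph.Connected := by
  have h1 : ∀ i j, hM.toGraph.Reachable (Sum.inl i) (Sum.inr j) := fun i j =>
    reachable_of_entry hM (by simp [allOnes_apply])
  refine connected_of_reachable hM (Sum.inl x) ?_
  rintro (i | i)
  · exact (h1 x y).trans (h1 i y).symm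
  · exact h1 x i

theorem connected_matN₁ : isAdjMatrix_matN₁.toGraph.Connected := by
  set hM := isAdjMatrix_matN₁
  refine connected_of_reachable hM (Sum.inl (Sum.inl ())) ?_
  have h1 : hM.toGraph.Reachable (Sum.inl (Sum.inl ())) (Sum.inr (Sum.inl ())) :=
    reachable_of_entry hM (by simp [bipartiteBlock, matN₁])
  rintro ((i | i) | (i | i))
  · rfl
  · exact h1.trans (reachable_of_entry hM (by simp [bipartiteBlock, matN₁, allOnes_apply]))
  · exact h1
  · exact reachable_of_entry hM (by simp [bipartiteBlock, matN₁, allOnes_apply])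

theorem connected_matN₂ : isAdjMatrix_matN₂.toGraph.Connected := by
  set hM := isAdjMatrix_matN₂
  have h1 : ∀ i j, hM.toGraph.Reachable (Sum.inl (Sum.inl i)) (Sum.inr (Sum.inr j)) := fun i j =>
    reachable_of_entry hM (by simp [bipartiteBlock, matN₂, allOnes_apply])
  have h2 : ∀ i j, hM.toGraph.Reachable (Sum.inl (Sum.inl i)) (Sum.inl (Sum.inl j)) := fun i j =>
    (h1 i 0).trans (h1 j 0).symm
  refine connected_of_reachable hM (Sum.inl (Sum.inl 0)) ?_
  rintro ((i | i) | (i | i))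
  · exact h2 _ _
  · obtain ⟨k, hk, -⟩ := exists_ne_ne_of_three_le le_rfl i i
    exact (h1 0 k).trans
      (reachable_of_entry hM (by simp [bipartiteBlock, matN₂, JsubI_apply, hk.symm]))
  · obtain ⟨k, hk, -⟩ := exists_ne_ne_of_three_le le_rfl i i
    exact (h2 0 k).trans (reachable_of_entry hM (by simp [bipartiteBlock, matN₂, JsubI_apply, hk]))
  · exact h1 0 i

theorem connected_matV {a : ℕ} (ha : 1 ≤ a) (b : ℕ) :
    (isAdjMatrix_matV a b).toGraph.Connected := by
  set hM := isAdjMatrix_matV a b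
  refine connected_of_reachable hM (Sum.inl ⟨0, ha⟩) ?_
  rintro (i | i | i)
  · by_cases h : ⟨0, ha⟩ = i
    · rw [h]
    · exact reachable_of_entry hM (by simp [matV, blocks3, JsubI_apply, h])
  · exact reachable_of_entry hM (by simp [matV, blocks3, allOnes_apply])
  · exact reachable_of_entry hM (by simp [matV, blocks3, allOnes_apply])

theorem connected_matVI {a m : ℕ} (ha : 1 ≤ a) (hm : 3 ≤ m) :
    (isAdjMatrix_matVI a m).toGraph.Connected := by
  set hM := isAdjMatrix_matVI a m
  have h1 : ∀ i j, hM.toGraph.Reachable (Sum.inl i) (Sum.inr (Sum.inl j)) := fun i j =>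
    reachable_of_entry hM (by simp [matVI, blocks3, allOnes_apply])
  refine connected_of_reachable hM (Sum.inl ⟨0, ha⟩) ?_
  rintro (i | i | i)
  · exact (h1 _ ⟨0, by omega⟩).trans (h1 _ _).symm
  · exact h1 _ i
  · obtain ⟨k, hk, -⟩ := exists_ne_ne_of_three_le hm i i
    exact (h1 _ k).trans (reachable_of_entry hM (by simp [matVI, blocks3, JsubI_apply, hk]))

end

theorem inClassG_of_classification {V : Type*} [Fintype V] [DecidableEq V]
    {G : SimpleGraph V} [DecidableRel G.Adj]
    (h : (∃ m : ℕ, 3 ≤ m ∧ HasAdjMatrix G (matI m)) ∨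
      (∃ a k : ℕ, 1 ≤ a ∧ 2 ≤ k ∧ HasAdjMatrix G (matII a k)) ∨
      (∃ l m : ℕ, m ≤ l ∧ 2 ≤ m ∧ HasAdjMatrix G (matIII l m)) ∨
      (HasAdjMatrix G (bipartiteBlock matN₁) ∨ HasAdjMatrix G (bipartiteBlock matN₂)) ∨
      (HasAdjMatrix G (matV 6 5) ∨ HasAdjMatrix G (matV 4 6) ∨ HasAdjMatrix G (matV 3 8)) ∨
      (HasAdjMatrix G (matVI 3 5) ∨ HasAdjMatrix G (matVI 4 4))) : InClassG G := by
  have s10 := five_halves_lt_sqrt_10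
  have s129 := nine_lt_sqrt_129
  have s37 := five_lt_sqrt_37
  have s7 := two_lt_sqrt_7
  rcases h with ⟨m, hm, h⟩ | ⟨a, k, ha, hk, h⟩ | ⟨l, m, hml, hm, h⟩ | (h | h) | (h | h | h) | (h | h)
  · have hm' : (3 : ℝ) ≤ m := by exact_mod_cast hm
    exact inClassG_of_hasAdjMatrix h _ (connected_matI hm) (matSpectrum_matI hm)
      (by linarith) (by linarith)
  · obtain ⟨h1, -⟩ := roots_matII ha hk
    have ha' : (1 : ℝ) ≤ a := by exact_mod_cast ha
    exact inClassG_of_hasAdjMatrix h _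
      (connected_of_join ⟨0, ha⟩ ⟨0, by omega⟩ (isAdjMatrix_matII a k))
      (matSpectrum_matII ha hk) (by linarith) (by linarith)
  · have h1 := two_le_sqrt_mul hml hm
    exact inClassG_of_hasAdjMatrix h _
      (connected_of_join ⟨0, by omega⟩ ⟨0, by omega⟩ (isAdjMatrix_matIII l m))
      (matSpectrum_matIII hml hm) (by linarith) (by linarith)
  · exact inClassG_of_hasAdjMatrix h _ connected_matN₁ matSpectrum_matN₁ (by norm_num) (by norm_num)
  · exact inClassG_of_hasAdjMatrix h _ connected_matN₂ matSpectrum_matN₂ (by norm_num) (by norm_num)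
  · exact inClassG_of_hasAdjMatrix h _ (connected_matV (by norm_num) _) matSpectrum_matV_6_5
      (by linarith) (by linarith)
  · exact inClassG_of_hasAdjMatrix h _ (connected_matV (by norm_num) _) matSpectrum_matV_4_6
      (by linarith) (by linarith)
  · exact inClassG_of_hasAdjMatrix h _ (connected_matV (by norm_num) _) matSpectrum_matV_3_8
      (by linarith) (by linarith)
  · exact inClassG_of_hasAdjMatrix h _ (connected_matVI (by norm_num) (by norm_num))
      matSpectrum_matVI_3_5 (by linarith) (by linarith)
  · exact inClassG_of_hasAdjMatrix h _ (connected_matVI (by norm_num) (by norm_num))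
      matSpectrum_matVI_4_4 (by linarith) (by linarith)

theorem mainTheorem1 {V : Type*} [Fintype V] [DecidableEq V]
    (G : SimpleGraph V) [DecidableRel G.Adj] :
    (InClassG G ↔
      (∃ m : ℕ, 3 ≤ m ∧ HasAdjMatrix G (matI m)) ∨
      (∃ a k : ℕ, 1 ≤ a ∧ 2 ≤ k ∧ HasAdjMatrix G (matII a k)) ∨
      (∃ l m : ℕ, m ≤ l ∧ 2 ≤ m ∧ HasAdjMatrix G (matIII l m)) ∨
      (HasAdjMatrix G (bipartiteBlock matN₁) ∨ HasAdjMatrix G (bipartiteBlock matN₂)) ∨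
      (HasAdjMatrix G (matV 6 5) ∨ HasAdjMatrix G (matV 4 6) ∨ HasAdjMatrix G (matV 3 8)) ∨
      (HasAdjMatrix G (matVI 3 5) ∨ HasAdjMatrix G (matVI 4 4))) ∧
    (∀ m : ℕ, 3 ≤ m → IsGraphMatrixWithSpectrum (matI m)
      (specMultiset ((m : ℝ) - 1) (-((m : ℝ) - 1)) (m - 1) (m - 1))) ∧
    (∀ a k : ℕ, 1 ≤ a → 2 ≤ k → IsGraphMatrixWithSpectrum (matII a k)
      (specMultiset
        ((a : ℝ) / 2 + 1 / 2 * √((a : ℝ) ^ 2 + 8 * (a : ℝ) * (k : ℝ) - 4 * (a : ℝ) + 4))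
        ((a : ℝ) / 2 - 1 / 2 * √((a : ℝ) ^ 2 + 8 * (a : ℝ) * (k : ℝ) - 4 * (a : ℝ) + 4))
        (k - 1) (a + k - 1))) ∧
    (∀ l m : ℕ, m ≤ l → 2 ≤ m → IsGraphMatrixWithSpectrum (matIII l m)
      (specMultiset (1 + 2 * √((l : ℝ) * (m : ℝ))) (1 - 2 * √((l : ℝ) * (m : ℝ)))
        (l + m - 2) (l + m))) ∧
    IsGraphMatrixWithSpectrum (bipartiteBlock matN₁) (specMultiset 3 (-3) 4 4) ∧
    IsGraphMatrixWithSpectrum (bipartiteBlock matN₂) (specMultiset 4 (-4) 5 5) ∧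
    IsGraphMatrixWithSpectrum (matV 6 5) (specMultiset (4 + 2 * √10) (4 - 2 * √10) 1 9) ∧
    IsGraphMatrixWithSpectrum (matV 4 6)
      (specMultiset ((7 + √129) / 2) ((7 - √129) / 2) 1 8) ∧
    IsGraphMatrixWithSpectrum (matV 3 8) (specMultiset (4 + √37) (4 - √37) 1 9) ∧
    IsGraphMatrixWithSpectrum (matVI 3 5)
      (specMultiset ((1 + √129) / 2) ((1 - √129) / 2) 5 6) ∧
    IsGraphMatrixWithSpectrum (matVI 4 4) (specMultiset (1 + 2 * √7) (1 - 2 * √7) 4 6) := by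
  exact ⟨⟨InClassG.classification, inClassG_of_classification⟩,
    fun m hm => ⟨isAdjMatrix_matI m, matSpectrum_matI hm⟩,
    fun a k ha hk => ⟨isAdjMatrix_matII a k, matSpectrum_matII ha hk⟩,
    fun l m hml hm => ⟨isAdjMatrix_matIII l m, matSpectrum_matIII hml hm⟩,
    ⟨isAdjMatrix_matN₁, matSpectrum_matN₁⟩, ⟨isAdjMatrix_matN₂, matSpectrum_matN₂⟩,
    ⟨isAdjMatrix_matV 6 5, matSpectrum_matV_6_5⟩, ⟨isAdjMatrix_matV 4 6, matSpectrum_matV_4_6⟩,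
    ⟨isAdjMatrix_matV 3 8, matSpectrum_matV_3_8⟩, ⟨isAdjMatrix_matVI 3 5, matSpectrum_matVI_3_5⟩,
    ⟨isAdjMatrix_matVI 4 4, matSpectrum_matVI_4_4⟩⟩
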